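/- **Setting.** Let $d\ge 2$ and $A,R\in L^1_{\rm loc}(\mathbb R)^{d\times d}$ (complex matrices). Let $\Phi$ be the fundamental matrix of $y'=A(x)y$ and $\Psi$ that of $y'=(A(x)+R(x))y$, with $\Phi(0)=\Psi(0)=I_d$ (solutions are understood as locally absolutely continuous functions satisfying the equation a.e.). Assume $\sup_{|x-x'|\le 1}\|\Phi(x)\Phi(x')^{-1}\|<\infty$. Write $\mathbb R_+=[0,\infty)$, $\mathbb R_-=(-\infty,0]$ and $\log 0=-\infty$. For a projection $Q$ and $J\in\{\mathbb R,\mathbb R_+,\mathbb R_-\}$, the upper Bohl exponent $\varkappa_J(Q)$ is the infimum of all $\varkappa\in\mathbb R$ such that, for some $C\ge1$, $\|\Phi(x)Q\Phi(x')^{-1}\|\le Ce^{\varkappa(x-x')}$ for all $x\ge x'$ in $J$; the lower Bohl exponent $\varkappa'_J(Q)$ is the supremum of all $\varkappa\in\mathbb R$ such that, for some $C\ge1$, the same inequality holds for all $x\le x'$ in $J$. We write $\varkappa,\varkappa_\pm$ and $\varkappa',\varkappa'_\pm$ for $J=\mathbb R,\mathbb R_\pm$. $Q$ is uniformly conjugated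 by $\Phi$ on $J$ if $\sup_{x\in J}\|\Phi(x)Q\Phi(x)^{-1}\|<\infty$, and it is an exponential dichotomy on $J$ if, for some $a,b>0$ and $C\ge 1$, $\|\Phi(x)Q\Phi(x')^{-1}\|\le Ce^{-a(x-x')}$ for $x\ge x'$ in $J$ and $\|\Phi(x)(I_d-Q)\Phi(x')^{-1}\|\le Ce^{b(x-x')}$ for $x\le x'$ in $J$. The same notions are used for the perturbed equation with $\Psi$ in place of $\Phi$. Put $$\lambda_+(Q)=\limsup_{x\to\infty}\frac{\log\|\Phi(x)Q\|}{x},\qquad \lambda'_-(Q)=-\limsup_{x\to-\infty}\frac{\log\|\Phi(x)Q\|}{|x|}.$$ **Splitting.** Let $2\le d'\le d$, $1\le k_0\le d'-1$, and let $Q$ be an exponential dichotomy for $y'=Ay$ on $\mathbb R$ with $Q=\sum_{j=1}^{k_0}Q_j$ and $I_d-Q=\sum_{j=k_0+1}^{d'}Q_j$, where $Q_1,\dots,Q_{d'}$ are projections with $Q_iQ_j=0$ for $i\ne j$, uniformly conjugated by $\Phi$ on $\mathbb R$, with $\varkappa'(Q_j)\le\varkappa(Q_j)$ for $1\le j\le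 d'$ and $\varkappa(Q_j)<\varkappa'(Q_{j+1})$ for $1\le j\le d'-1$. **Decay of $R$.** Assume $\int_{\mathbb R}\|R(x)\|e^{\beta|x|}\,dx<\infty$ for some $$\beta>\max\Big\{\max_{1\le j\le k_0}\{\lambda_+(Q_j)-\varkappa'_+(Q_j)\},\ \max_{k_0+1\le j\le d'}\{\varkappa_-(Q_j)-\lambda'_-(Q_j)\}\Big\}.$$ **Generalized matrix-valued Jost solutions.** For $1\le j\le k_0$, $Y_+^{(j)}$ denotes any $d\times d$ matrix solution on $\mathbb R_+$ of $Y'=(A+R)Y$ with $\limsup_{x\to\infty}\frac{\log\|Y_+^{(j)}(x)-\Phi(x)Q_j\|}{x}<\varkappa'_+(Q_j)$ and $Y_+^{(j)}(0)=Y_+^{(j)}(0)Q_j$. For $k_0+1\le j\le d'$, $Y_-^{(j)}$ denotes any $d\times d$ matrix solution on $\mathbb R_-$ with $\liminf_{x\to-\infty}\frac{\log\|Y_-^{(j)}(x)-\Phi(x)Q_j\|}{x}>\varkappa_-(Q_j)$ and $Y_-^{(j)}(0)=Y_-^{(j)}(0)Q_j$. **Perturbed splitting.** A family of projections $P_1,\dots,P_{d'}$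 is called a perturbed splitting if: $P_iP_j=0$ for $i\neq j$ whenever $i,j\le k_0$ or $i,j\ge k_0+1$; $P_+=\sum_{j\le k_0}P_j$ is an exponential dichotomy on $\mathbb R_+$, and $I_d-P_-$ with $P_-=\sum_{j\ge k_0+1}P_j$ is an exponential dichotomy on $\mathbb R_-$, for $y'=(A+R)y$; $P_j$ is uniformly conjugated by $\Psi$ on $\mathbb R_+$ for $j\le k_0$ and on $\mathbb R_-$ for $j\ge k_0+1$; and the Bohl segments agree: $[\varkappa'_+(P_j),\varkappa_+(P_j)]=[\varkappa'_+(Q_j),\varkappa_+(Q_j)]$ for $j\le k_0$ and $[\varkappa'_-(P_j),\varkappa_-(P_j)]=[\varkappa'_-(Q_j),\varkappa_-(Q_j)]$ for $j\ge k_0+1$. **Theorem.** Under these assumptions a perturbed splitting exists, and for every perturbed splitting $\{P_j\}$ the following hold. (i) Generalized matrix-valued Jost solutions $Y_+^{(j)}$, $1\le j\le k_0$, and $Y_-^{(j)}$, $k_0+1\le j\le d'$, exist. (ii) $Y_+^{(1)}$ and $Y_-^{(d')}$ are unique, and $\operatorname{ran}(Y_+^{(1)}(0))\subseteq\operatorname{ran}(P_1)$,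 $\operatorname{ran}(Y_-^{(d')}(0))\subseteq\operatorname{ran}(P_{d'})$. (iii) Any generalized Jost solutions satisfy $$\operatorname{ran}(Y_+^{(j)}(0))\setminus\{0\}\subseteq\operatorname{ran}\Big(\sum_{k=1}^{j}P_k\Big)\Big\backslash\operatorname{ran}\Big(\sum_{k=1}^{j-1}P_k\Big),\quad 2\le j\le k_0,$$ $$\operatorname{ran}(Y_-^{(j)}(0))\setminus\{0\}\subseteq\operatorname{ran}\Big(\sum_{k=j}^{d'}P_k\Big)\Big\backslash\operatorname{ran}\Big(\sum_{k=j+1}^{d'}P_k\Big),\quad k_0+1\le j\le d'-1.$$ (iv) If $Y_\pm^{(j)}$ and $\widetilde Y_\pm^{(j)}$ are two generalized Jost solutions associated with the same $Q_j$, then $$\operatorname{ran}(Y_+^{(j)}(0)-\widetilde Y_+^{(j)}(0))\subseteq\operatorname{ran}\Big(\sum_{k=1}^{j-1}P_k\Big),\quad 2\le j\le k_0,$$ $$\operatorname{ran}(Y_-^{(j)}(0)-\widetilde Y_-^{(j)}(0))\subseteq\operatorname{ran}\Big(\sum_{k=j+1}^{d'}P_k\Big),\quad k_0+1\le j\le d'-1.$$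 -/

import Mathlib

open MeasureTheory Filter Set
-- Matrices carry the operator norm of the Euclidean norm; all matrix norms are equivalent.
open scoped Matrix.Norms.L2Operator

namespace JostSplitting

/-! ### Existence of the fundamental matrix for a locally integrable coefficient -/

theorem intervalIntegrable_of_locallyIntegrable {E : Type*} [NormedAddCommGroup E] {f : ℝ → E}
    (hf : LocallyIntegrable f) (a b : ℝ) : IntervalIntegrable f volume a b :=
  intervalIntegrable_iff.mpr
    ((hf.integrableOn_isCompact isCompact_uIcc).mono_set uIoc_subset_uIcc)

theorem integral_mul_exp_integral {f : ℝ → ℝ} (hf : LocallyIntegrable f) (x : ℝ) :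
    ∫ t in (0 : ℝ)..x, f t * Real.exp (∫ s in (0 : ℝ)..t, f s)
      = Real.exp (∫ s in (0 : ℝ)..x, f s) - 1 := by
  set F : ℝ → ℝ := fun t => ∫ s in (0 : ℝ)..t, f s with hF
  have hfi : ∀ a b, IntervalIntegrable f volume a b := intervalIntegrable_of_locallyIntegrable hf
  have hac : AbsolutelyContinuousOnInterval F 0 x :=
    (hfi 0 x).absolutelyContinuousOnInterval_intervalIntegral (by simp)
  obtain ⟨M, hM⟩ := hac.exists_bound
  have hlip : ∀ u ∈ uIcc 0 x, ∀ v ∈ uIcc 0 x,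
      dist (Real.exp (F u)) (Real.exp (F v)) ≤ Real.exp M * dist (F u) (F v) := by
    intro u hu v hv
    have h1 : F u ∈ Icc (-M) M := abs_le.mp (hM u hu)
    have h2 : F v ∈ Icc (-M) M := abs_le.mp (hM v hv)
    have := Convex.norm_image_sub_le_of_norm_hasDerivWithin_le (f := Real.exp) (f' := Real.exp)
      (s := Icc (-M) M) (C := Real.exp M)
      (fun y _ => (Real.hasDerivAt_exp y).hasDerivWithinAt)
      (fun y hy => by
        rw [Real.norm_eq_abs, abs_of_pos (Real.exp_pos y)]
        exact Real.exp_le_exp.mpr hy.2) (convex_Icc _ _) h2 h1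
    simpa [dist_eq_norm] using this
  have hac2 : AbsolutelyContinuousOnInterval (fun t => Real.exp (F t)) 0 x := by
    rw [absolutelyContinuousOnInterval_iff] at hac ⊢
    intro ε hε
    obtain ⟨δ, hδ, h⟩ := hac (ε / Real.exp M) (by positivity)
    refine ⟨δ, hδ, fun E hE hlt => ?_⟩
    have h3 := h E hE hlt
    calc _ ≤ ∑ i ∈ Finset.range E.1, Real.exp M * dist (F (E.2 i).1) (F (E.2 i).2) := by
            refine Finset.sum_le_sum fun i hi => hlip _ ?_ _ ?_
            · exact (hE.1 i hi).1
            · exact (hE.1 i hi).2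
      _ = Real.exp M * ∑ i ∈ Finset.range E.1, dist (F (E.2 i).1) (F (E.2 i).2) := by
            rw [Finset.mul_sum]
      _ < Real.exp M * (ε / Real.exp M) := by gcongr
      _ = ε := by field_simp
  have h4 := hac2.integral_deriv_eq_sub
  have h5 : F 0 = 0 := by simp [hF]
  rw [h5, Real.exp_zero] at h4
  rw [← h4]
  refine intervalIntegral.integral_congr_ae ?_
  filter_upwards [_root_.LocallyIntegrable.ae_hasDerivAt_integral hf] with t ht _
  rw [((ht 0).exp).deriv, mul_comm]

theorem exists_fundamental_aux {E : Type*} [NormedRing E] [NormedAlgebra ℝ E] [CompleteSpace E]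
    {A : ℝ → E} (hA : LocallyIntegrable A) :
    ∃ Y : ℝ → E, Continuous Y ∧ ∀ x, Y x = 1 + ∫ t in (0 : ℝ)..x, A t * Y t := by
  have hn : LocallyIntegrable fun t => ‖A t‖ := fun x => (hA x).norm
  have hii : ∀ a b, IntervalIntegrable A volume a b := intervalIntegrable_of_locallyIntegrable hA
  set a : ℝ → ℝ := fun x => ∫ t in (0 : ℝ)..x, ‖A t‖ with ha
  have hac : Continuous a :=
    intervalIntegral.continuous_primitive (intervalIntegrable_of_locallyIntegrable hn) 0
  set w : ℝ → ℝ := fun x => Real.exp (2 * |a x|) with hw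
  have hwc : Continuous w := by fun_prop
  have hwpos : ∀ x, 0 < w x := fun x => Real.exp_pos _
  have hw1 : ∀ x, 1 ≤ w x := fun x => Real.one_le_exp (by positivity)
  have key : ∀ x, |∫ t in (0 : ℝ)..x, ‖A t‖ * w t| ≤ w x / 2 := by
    intro x
    rcases le_total 0 x with hx | hx
    · have h0 : ∀ t, 0 ≤ t → 0 ≤ a t := fun t ht =>
        intervalIntegral.integral_nonneg ht fun _ _ => norm_nonneg _
      have h := integral_mul_exp_integral (f := fun t => 2 * ‖A t‖) (fun y => (hn y).smul (2 : ℝ)) x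
      simp only [intervalIntegral.integral_const_mul, mul_assoc] at h
      have e : ∫ t in (0 : ℝ)..x, ‖A t‖ * w t
          = ∫ t in (0 : ℝ)..x, ‖A t‖ * Real.exp (2 * a t) := by
        refine intervalIntegral.integral_congr fun t ht => ?_
        rw [uIcc_of_le hx] at ht
        simp only [hw, abs_of_nonneg (h0 t ht.1)]
      rw [e]
      have e2 : w x = Real.exp (2 * a x) := by simp only [hw, abs_of_nonneg (h0 x hx)]
      rw [e2, abs_le]
      have h1 : 1 ≤ Real.exp (2 * a x) := e2 ▸ hw1 x
      constructor <;> linarith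
    · have h0 : ∀ t, t ≤ 0 → a t ≤ 0 := fun t ht => by
        simp only [ha]
        rw [intervalIntegral.integral_symm]
        exact neg_nonpos.mpr (intervalIntegral.integral_nonneg ht fun _ _ => norm_nonneg _)
      have h := integral_mul_exp_integral (f := fun t => (-2) * ‖A t‖) (fun y => (hn y).smul (-2 : ℝ)) x
      simp only [intervalIntegral.integral_const_mul, mul_assoc] at h
      have e : ∫ t in (0 : ℝ)..x, ‖A t‖ * w t
          = ∫ t in (0 : ℝ)..x, ‖A t‖ * Real.exp (-2 * a t) := by
        refine intervalIntegral.integral_congr fun t ht => ?_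
        rw [uIcc_of_ge hx] at ht
        simp only [hw, abs_of_nonpos (h0 t ht.2)]
        ring_nf
      rw [e]
      have e2 : w x = Real.exp (-2 * a x) := by
        simp only [hw, abs_of_nonpos (h0 x hx)]
        ring_nf
      rw [e2, abs_le]
      have h1 : 1 ≤ Real.exp (-2 * a x) := e2 ▸ hw1 x
      constructor <;> linarith
  have hint : ∀ Z : ℝ → E, Continuous Z → ∀ u v, IntervalIntegrable (fun t => A t * Z t) volume u v :=
    fun Z hZ u v => (hii u v).mul_continuousOn hZ.continuousOn
  have hbd : ∀ Z : ℝ → E, Continuous Z → ∀ C, (∀ t, ‖Z t‖ ≤ C * w t) → ∀ x,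
      ‖∫ t in (0 : ℝ)..x, A t * Z t‖ ≤ C * (w x / 2) := by
    intro Z hZ C hC x
    have hC0 : 0 ≤ C := by
      have := (norm_nonneg _).trans (hC 0)
      exact nonneg_of_mul_nonneg_left this (hwpos 0)
    calc ‖∫ t in (0 : ℝ)..x, A t * Z t‖
        ≤ |∫ t in (0 : ℝ)..x, C * (‖A t‖ * w t)| := by
          refine intervalIntegral.norm_integral_le_abs_of_norm_le (ae_of_all _ fun t => ?_) ?_
          · calc ‖A t * Z t‖ ≤ ‖A t‖ * ‖Z t‖ := norm_mul_le _ _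
              _ ≤ ‖A t‖ * (C * w t) := by gcongr; exact hC t
              _ = C * (‖A t‖ * w t) := by ring
          · exact ((intervalIntegrable_of_locallyIntegrable hn _ _).mul_continuousOn hwc.continuousOn).const_mul C
      _ = C * |∫ t in (0 : ℝ)..x, ‖A t‖ * w t| := by
          rw [intervalIntegral.integral_const_mul, abs_mul, abs_of_nonneg hC0]
      _ ≤ C * (w x / 2) := by gcongr; exact key x
  have hcw : ∀ Z : BoundedContinuousFunction ℝ E, Continuous fun t => w t • Z t :=
    fun Z => hwc.smul Z.continuous
  have hcI : ∀ Z : BoundedContinuousFunction ℝ E,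
      Continuous fun x => ∫ t in (0 : ℝ)..x, A t * (w t • Z t) :=
    fun Z => intervalIntegral.continuous_primitive (hint _ (hcw Z)) 0
  let T : BoundedContinuousFunction ℝ E → BoundedContinuousFunction ℝ E := fun Z =>
    BoundedContinuousFunction.ofNormedAddCommGroup
      (fun x => (w x)⁻¹ • ((1 : E) + ∫ t in (0 : ℝ)..x, A t * (w t • Z t)))
      ((hwc.inv₀ fun x => (hwpos x).ne').smul (continuous_const.add (hcI Z)))
      (‖(1 : E)‖ + ‖Z‖) (by
        intro x
        rw [norm_smul, norm_inv, Real.norm_eq_abs, abs_of_pos (hwpos x), inv_mul_le_iff₀ (hwpos x)]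
        have h1 := hbd _ (hcw Z) ‖Z‖ (fun t => by
          rw [norm_smul, Real.norm_eq_abs, abs_of_pos (hwpos t), mul_comm]
          exact mul_le_mul_of_nonneg_right (Z.norm_coe_le_norm t) (hwpos t).le) x
        have h2 := norm_add_le (1 : E) (∫ t in (0 : ℝ)..x, A t * (w t • Z t))
        have h3 := hw1 x
        nlinarith [norm_nonneg (1 : E), norm_nonneg Z])
  have hT : ContractingWith (1 / 2) T := by
    refine ⟨by norm_num, LipschitzWith.of_dist_le_mul fun Z W => ?_⟩
    rw [BoundedContinuousFunction.dist_le (by positivity)]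
    intro x
    rw [dist_eq_norm]
    change ‖(w x)⁻¹ • ((1 : E) + ∫ t in (0 : ℝ)..x, A t * (w t • Z t))
      - (w x)⁻¹ • ((1 : E) + ∫ t in (0 : ℝ)..x, A t * (w t • W t))‖ ≤ _
    rw [← smul_sub, add_sub_add_left_eq_sub,
      ← intervalIntegral.integral_sub (hint _ (hcw Z) _ _) (hint _ (hcw W) _ _),
      norm_smul, norm_inv, Real.norm_eq_abs, abs_of_pos (hwpos x), inv_mul_le_iff₀ (hwpos x)]
    have e : ∀ t, A t * (w t • Z t) - A t * (w t • W t) = A t * (w t • (Z - W) t) := by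
      intro t
      rw [← mul_sub, ← smul_sub]; rfl
    simp only [e]
    have h1 := hbd _ (hcw (Z - W)) ‖Z - W‖ (fun t => by
          rw [norm_smul, Real.norm_eq_abs, abs_of_pos (hwpos t), mul_comm]
          exact mul_le_mul_of_nonneg_right ((Z - W).norm_coe_le_norm t) (hwpos t).le) x
    rw [dist_eq_norm]
    refine h1.trans (le_of_eq ?_)
    push_cast
    ring
  refine ⟨fun x => w x • hT.fixedPoint T x, hcw _, fun x => ?_⟩
  have h := DFunLike.congr_fun hT.fixedPoint_isFixedPt x
  change (w x)⁻¹ • ((1 : E) + ∫ t in (0 : ℝ)..x, A t * (w t • hT.fixedPoint T t)) = _ at h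
  change w x • hT.fixedPoint T x = _
  rw [← h, smul_inv_smul₀ (hwpos x).ne']

/-! ### Linear differential equations with locally integrable coefficients -/

/-- `d × d` complex matrices. -/
abbrev Mat (d : ℕ) : Type := Matrix (Fin d) (Fin d) ℂ

variable {d : ℕ}

/-- `Y` is a (Carathéodory, i.e. locally absolutely continuous) matrix-valued solution of
`Y' = B Y` on an interval `J` containing `0`, written in integrated form.
Only the values of `Y` on `J` matter. -/
def IsSolutionOn (B : ℝ → Mat d) (J : Set ℝ) (Y : ℝ → Mat d) : Prop :=
  ContinuousOn Y J ∧ ∀ x ∈ J, Y x = Y 0 + ∫ t in (0 : ℝ)..x, B t * Y t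

/-- `Φ' = B Φ` on `ℝ` and `Φ 0 = 1`. -/
def IsFundamentalMatrix (B : ℝ → Mat d) (Φ : ℝ → Mat d) : Prop :=
  Φ 0 = 1 ∧ IsSolutionOn B univ Φ

theorem exists_isFundamentalMatrix {B : ℝ → Mat d} (hB : LocallyIntegrable B) :
    ∃ Φ, IsFundamentalMatrix B Φ := by
  obtain ⟨Y, hc, hY⟩ := exists_fundamental_aux hB
  have h0 : Y 0 = 1 := by simpa using hY 0
  exact ⟨Y, h0, hc.continuousOn, fun x _ => by rw [h0]; exact hY x⟩

/-- The fundamental matrix of `y' = B y` (normalized to be the identity at `0`). -/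
noncomputable def fundamentalMatrix (B : ℝ → Mat d) : ℝ → Mat d :=
  Classical.epsilon (IsFundamentalMatrix B)

theorem fundamentalMatrix_spec {B : ℝ → Mat d} (hB : LocallyIntegrable B) :
    IsFundamentalMatrix B (fundamentalMatrix B) :=
  Classical.epsilon_spec (exists_isFundamentalMatrix hB)

/-- The propagator `Φ(x) Φ(x')⁻¹` is exponentially bounded on `ℝ`. -/
def ExponentiallyBounded (Φ : ℝ → Mat d) : Prop :=
  ∃ C : ℝ, ∀ x x' : ℝ, |x - x'| ≤ 1 → ‖Φ x * (Φ x')⁻¹‖ ≤ C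

/-! ### Bohl and Lyapunov exponents, dichotomies -/

/-- The projection `Q` is uniformly conjugated by `Φ` on `J`. -/
def UniformlyConjugated (Φ : ℝ → Mat d) (J : Set ℝ) (Q : Mat d) : Prop :=
  ∃ M : ℝ, ∀ x ∈ J, ‖Φ x * Q * (Φ x)⁻¹‖ ≤ M

/-- The upper Bohl exponent of `Q` on `J`. -/
noncomputable def upperBohl (Φ : ℝ → Mat d) (J : Set ℝ) (Q : Mat d) : EReal :=
  sInf ((fun κ : ℝ => (κ : EReal)) '' {κ : ℝ | ∃ C : ℝ, 1 ≤ C ∧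
    ∀ x ∈ J, ∀ x' ∈ J, x' ≤ x → ‖Φ x * Q * (Φ x')⁻¹‖ ≤ C * Real.exp (κ * (x - x'))})

/-- The lower Bohl exponent of `Q` on `J`. -/
noncomputable def lowerBohl (Φ : ℝ → Mat d) (J : Set ℝ) (Q : Mat d) : EReal :=
  sSup ((fun κ : ℝ => (κ : EReal)) '' {κ : ℝ | ∃ C : ℝ, 1 ≤ C ∧
    ∀ x ∈ J, ∀ x' ∈ J, x ≤ x' → ‖Φ x * Q * (Φ x')⁻¹‖ ≤ C * Real.exp (κ * (x - x'))})

/-- `log ‖M‖`, with the convention `log 0 = -∞`. -/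
noncomputable def logNorm (M : Mat d) : EReal := ENNReal.log ‖M‖ₑ

/-- The upper Lyapunov exponent `λ₊(Q) = limsup_{x → ∞} log ‖Φ(x) Q‖ / x` on `[0, ∞)`. -/
noncomputable def upperLyapunovPos (Φ : ℝ → Mat d) (Q : Mat d) : EReal :=
  limsup (fun x : ℝ => logNorm (Φ x * Q) / (x : EReal)) atTop

/-- The lower Lyapunov exponent `λ'₋(Q) = -limsup_{x → -∞} log ‖Φ(x) Q‖ / |x|` on `(-∞, 0]`. -/
noncomputable def lowerLyapunovNeg (Φ : ℝ → Mat d) (Q : Mat d) : EReal :=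
  -limsup (fun x : ℝ => logNorm (Φ x * Q) / ((|x| : ℝ) : EReal)) atBot

/-- `Q` is an exponential dichotomy projection on `J`. -/
def IsExpDichotomy (Φ : ℝ → Mat d) (J : Set ℝ) (Q : Mat d) : Prop :=
  IsIdempotentElem Q ∧
  ∃ κ κ' C C' : ℝ, 0 < κ ∧ 0 < κ' ∧ 1 ≤ C ∧ 1 ≤ C' ∧
    (∀ x ∈ J, ∀ x' ∈ J, x' ≤ x →
      ‖Φ x * Q * (Φ x')⁻¹‖ ≤ C * Real.exp (-κ * (x - x'))) ∧
    (∀ x ∈ J, ∀ x' ∈ J, x ≤ x' →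
      ‖Φ x * (1 - Q) * (Φ x')⁻¹‖ ≤ C' * Real.exp (κ' * (x - x')))

/-- The dichotomy projection `Q₀` on `ℝ` splits as `Q₀ = Q₁ + ⋯ + Q_{k₀}` and its complement as
`1 - Q₀ = Q_{k₀+1} + ⋯ + Q_{d'}`, with disjoint projections `Q₁, …, Q_{d'}` that are uniformly
conjugated by `Φ` on `ℝ` and whose Bohl segments are disjoint and numbered in increasing order. -/
structure IsOrderedSplitting (Φ : ℝ → Mat d) (k₀ d' : ℕ) (Q₀ : Mat d) (Q : ℕ → Mat d) :
    Prop where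
  dichotomy : IsExpDichotomy Φ univ Q₀
  sum_low : Q₀ = ∑ j ∈ Finset.Icc 1 k₀, Q j
  sum_high : 1 - Q₀ = ∑ j ∈ Finset.Icc (k₀ + 1) d', Q j
  idem : ∀ j ∈ Finset.Icc 1 d', IsIdempotentElem (Q j)
  disjoint : ∀ i ∈ Finset.Icc 1 d', ∀ j ∈ Finset.Icc 1 d', i ≠ j → Q i * Q j = 0
  conj : ∀ j ∈ Finset.Icc 1 d', UniformlyConjugated Φ univ (Q j)
  segment : ∀ j ∈ Finset.Icc 1 d', lowerBohl Φ univ (Q j) ≤ upperBohl Φ univ (Q j)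
  ordered : ∀ j, 1 ≤ j → j < d' → upperBohl Φ univ (Q j) < lowerBohl Φ univ (Q (j + 1))

/-- `P₁, …, P_{k₀}` is an exponential splitting, for the perturbed equation with fundamental
matrix `Ψ`, of a dichotomy projection `P₊ = P₁ + ⋯ + P_{k₀}` on `[0, ∞)`, and
`P_{k₀+1}, …, P_{d'}` is an exponential splitting on `(-∞, 0]` of the complementary
projection `P₋ = P_{k₀+1} + ⋯ + P_{d'}` of a dichotomy projection `1 - P₋`, with the same Bohl
segments on the respective half-lines as the `Q_j` have for the unperturbed equation. -/
structure IsPerturbedSplitting (Φ Ψ : ℝ → Mat d) (k₀ d' : ℕ) (Q P : ℕ → Mat d) : Prop where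
  idem : ∀ j ∈ Finset.Icc 1 d', IsIdempotentElem (P j)
  disjoint_pos : ∀ i ∈ Finset.Icc 1 k₀, ∀ j ∈ Finset.Icc 1 k₀, i ≠ j → P i * P j = 0
  disjoint_neg : ∀ i ∈ Finset.Icc (k₀ + 1) d', ∀ j ∈ Finset.Icc (k₀ + 1) d', i ≠ j →
    P i * P j = 0
  dichotomy_pos : IsExpDichotomy Ψ (Ici 0) (∑ j ∈ Finset.Icc 1 k₀, P j)
  dichotomy_neg : IsExpDichotomy Ψ (Iic 0) (1 - ∑ j ∈ Finset.Icc (k₀ + 1) d', P j)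
  conj_pos : ∀ j ∈ Finset.Icc 1 k₀, UniformlyConjugated Ψ (Ici 0) (P j)
  conj_neg : ∀ j ∈ Finset.Icc (k₀ + 1) d', UniformlyConjugated Ψ (Iic 0) (P j)
  lower_pos : ∀ j ∈ Finset.Icc 1 k₀, lowerBohl Ψ (Ici 0) (P j) = lowerBohl Φ (Ici 0) (Q j)
  upper_pos : ∀ j ∈ Finset.Icc 1 k₀, upperBohl Ψ (Ici 0) (P j) = upperBohl Φ (Ici 0) (Q j)
  lower_neg : ∀ j ∈ Finset.Icc (k₀ + 1) d',
    lowerBohl Ψ (Iic 0) (P j) = lowerBohl Φ (Iic 0) (Q j)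
  upper_neg : ∀ j ∈ Finset.Icc (k₀ + 1) d',
    upperBohl Ψ (Iic 0) (P j) = upperBohl Φ (Iic 0) (Q j)

/-! ### Generalized matrix-valued Jost solutions -/

/-- `Y` is a generalized matrix-valued Jost solution on `[0, ∞)` of `Y' = (A + R) Y` associated
with the projection `Q` (one member of the splitting). -/
def IsJostSolutionPos (A R : ℝ → Mat d) (Q : Mat d) (Y : ℝ → Mat d) : Prop :=
  IsSolutionOn (fun x => A x + R x) (Ici 0) Y ∧
  limsup (fun x : ℝ => logNorm (Y x - fundamentalMatrix A x * Q) / (x : EReal)) atTop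
    < lowerBohl (fundamentalMatrix A) (Ici 0) Q ∧
  Y 0 = Y 0 * Q

/-- `Y` is a generalized matrix-valued Jost solution on `(-∞, 0]` of `Y' = (A + R) Y` associated
with the projection `Q` (one member of the splitting). -/
def IsJostSolutionNeg (A R : ℝ → Mat d) (Q : Mat d) (Y : ℝ → Mat d) : Prop :=
  IsSolutionOn (fun x => A x + R x) (Iic 0) Y ∧
  upperBohl (fundamentalMatrix A) (Iic 0) Q
    < liminf (fun x : ℝ => logNorm (Y x - fundamentalMatrix A x * Q) / (x : EReal)) atBot ∧
  Y 0 = Y 0 * Q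

/-- The range of a matrix, as a subspace of `ℂ^d`. -/
abbrev ran (M : Mat d) : Submodule ℂ (Fin d → ℂ) := LinearMap.range M.mulVecLin

end JostSplitting

open JostSplitting

/-!
Write `Φ` and `Ψ` for the fundamental matrices of the unperturbed and of the perturbed equation.

*Reduction to `[0, ∞)`.* The substitution `x ↦ -x` turns `A`, `R`, `Q j` into `-A(-x)`, `-R(-x)`,
`Q (d' + 1 - j)`, exchanges upper and lower exponents up to sign, and replaces `k₀` by `d' - k₀`.
Every claim on `(-∞, 0]` is therefore a claim on `[0, ∞)` for the reversed equation, and two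
half-line splittings glue to a perturbed splitting (`isPerturbedSplitting_glue`).

*Existence of a perturbed splitting.* If `∫ ‖R‖` is small, a change of variables `S` near the
identity carries `Ψ` to a block diagonal perturbation of `Φ`. In the interaction picture the
`(i, j)` block of `S` is obtained by integrating from `-∞` if `i < j` and from `∞` if `i > j`. The
order of the Bohl segments bounds the kernels of these integrals, so that `S` is the fixed point of
a contraction (`BlockSplitting.exists_fixedPoint`, `BlockSplitting.exists_similarity`). On
`[0, ∞)` smallness is achieved by cutting `R` off to a neighbourhood of infinity
(`BlockSplitting.exists_similarity_halfLine`). An integrable block diagonal perturbation preserves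
all exponential rates by Grönwall's inequality (`HasUpperRate.interaction`), hence the conjugates of
the `Q j` by the value at `0` of the change of variables have the required Bohl exponents
(`IsOrderedSplitting.exists_halfLineSplitting`).

*Jost solutions.* Let `E = P 1 + ⋯ + P (j - 1)`. In the variation of constants formula for
`Φ (Q j)` the `E` part is integrated from `0` and the `1 - E` part from `∞`. The decay rate `β`
compensates for `λ₊(Q j) - ϰ'₊(Q j)`, and the error is `O(exp (γ x))` with `γ` below the lower Bohl
exponent of `Q j` (`exists_asymptotic_solution`, `exists_isJostSolutionPos`). A nonzero solution
in the range of `Q j` cannot grow more slowly than a lower rate, so `λ₊(Q j) ≥ ϰ'₊(Q j)`; this makes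
`β` nonnegative and `R` integrable (`IsOrderedSplitting.decayRate_nonneg`,
`integrable_of_integrable_mul_exp`).

*Ranges.* The single principle is `HasLowerRate.mul_eq_zero`: if `Ψ V` grows more slowly than a
lower rate of `P`, then `P V = 0`. Applied to `1 - (P 1 + ⋯ + P j)` and a Jost solution it gives the
inclusion of ranges, applied to the difference of two Jost solutions it gives the statement on
differences, of which uniqueness is the case `j = 1`. Applied to `Φ` and `Q j` it shows that a
vector in the range of `Y 0` and of `P 1 + ⋯ + P (j - 1)` vanishes.
-/

namespace JostSplitting

variable {d : ℕ}

/-! ### Calculus of indefinite integrals with values in a Banach algebra -/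

theorem absolutelyContinuousOnInterval_of_dist_le {X : Type*} [PseudoMetricSpace X]
    {h : ℝ → X} {α : ℝ → ℝ} {a b K : ℝ} (hα : AbsolutelyContinuousOnInterval α a b) (hK : 0 ≤ K)
    (hd : ∀ u ∈ uIcc a b, ∀ v ∈ uIcc a b, dist (h u) (h v) ≤ K * dist (α u) (α v)) :
    AbsolutelyContinuousOnInterval h a b := by
  rw [absolutelyContinuousOnInterval_iff] at hα ⊢
  intro ε hε
  obtain ⟨δ, hδ, H⟩ := hα (ε / (K + 1)) (by positivity)
  refine ⟨δ, hδ, fun I hI hlt => ?_⟩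
  calc ∑ i ∈ Finset.range I.1, dist (h (I.2 i).1) (h (I.2 i).2)
      ≤ ∑ i ∈ Finset.range I.1, (K + 1) * dist (α (I.2 i).1) (α (I.2 i).2) := by
        refine Finset.sum_le_sum fun i hi => (hd _ (hI.1 i hi).1 _ (hI.1 i hi).2).trans ?_
        gcongr
        linarith
    _ = (K + 1) * ∑ i ∈ Finset.range I.1, dist (α (I.2 i).1) (α (I.2 i).2) := by
        rw [Finset.mul_sum]
    _ < (K + 1) * (ε / (K + 1)) := by gcongr; exact H I hI hlt
    _ = ε := by field_simp

section Primitive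

variable {E : Type*} [NormedRing E] [NormedAlgebra ℝ E] [CompleteSpace E]

theorem dist_integral_le_dist_integral {F : Type*} [NormedAddCommGroup F] [NormedSpace ℝ F]
    {f : ℝ → F} {m : ℝ → ℝ} {a b : ℝ}
    (hf : IntervalIntegrable f volume a b) (hm : IntervalIntegrable m volume a b)
    (hfm : ∀ t, ‖f t‖ ≤ m t) {u v : ℝ} (hu : u ∈ uIcc a b) (hv : v ∈ uIcc a b) :
    dist (∫ t in a..u, f t) (∫ t in a..v, f t) ≤ dist (∫ t in a..u, m t) (∫ t in a..v, m t) := by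
  have sub : ∀ w ∈ uIcc a b, uIcc a w ⊆ uIcc a b := fun w hw => uIcc_subset_uIcc_left hw
  rw [dist_eq_norm, dist_eq_norm,
    intervalIntegral.integral_interval_sub_left (hf.mono_set (sub u hu)) (hf.mono_set (sub v hv)),
    intervalIntegral.integral_interval_sub_left (hm.mono_set (sub u hu)) (hm.mono_set (sub v hv)),
    Real.norm_eq_abs]
  exact intervalIntegral.norm_integral_le_abs_of_norm_le (ae_of_all _ hfm)
    (hm.mono_set (uIcc_subset_uIcc hv hu))

/-- The Banach space valued version of
`IntervalIntegrable.absolutelyContinuousOnInterval_intervalIntegral`. -/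
theorem absolutelyContinuousOnInterval_integral {F : Type*} [NormedAddCommGroup F]
    [NormedSpace ℝ F] {f : ℝ → F} {a b : ℝ} (hf : IntervalIntegrable f volume a b) :
    AbsolutelyContinuousOnInterval (fun x => ∫ t in a..x, f t) a b := by
  refine absolutelyContinuousOnInterval_of_dist_le (K := 1)
    (hf.norm.absolutelyContinuousOnInterval_intervalIntegral (c := a) (by simp)) zero_le_one
    fun u hu v hv => ?_
  rw [one_mul]
  exact dist_integral_le_dist_integral hf hf.norm (fun _ => le_rfl) hu hv

theorem add_integral_mul_add_integral {f g : ℝ → E} {a b : ℝ}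
    (hf : IntervalIntegrable f volume a b) (hg : IntervalIntegrable g volume a b) (u v : E) :
    (u + ∫ t in a..b, f t) * (v + ∫ t in a..b, g t) = u * v +
      ∫ t in a..b, (f t * (v + ∫ s in a..t, g s) + (u + ∫ s in a..t, f s) * g t) := by
  set F : ℝ → E := fun x => u + ∫ t in a..x, f t with hF
  set G : ℝ → E := fun x => v + ∫ t in a..x, g t with hG
  have hFc : ContinuousOn F (uIcc a b) :=
    continuousOn_const.add (absolutelyContinuousOnInterval_integral hf).continuousOn
  have hGc : ContinuousOn G (uIcc a b) :=
    continuousOn_const.add (absolutelyContinuousOnInterval_integral hg).continuousOn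
  have hh : IntervalIntegrable (fun t => f t * G t + F t * g t) volume a b :=
    (hf.mul_continuousOn hGc).add (hg.continuousOn_mul hFc)
  obtain ⟨C, hC⟩ := isCompact_uIcc.exists_bound_of_continuousOn hFc
  obtain ⟨D, hD⟩ := isCompact_uIcc.exists_bound_of_continuousOn hGc
  have hC0 : 0 ≤ C := (norm_nonneg _).trans (hC a (by simp))
  have hD0 : 0 ≤ D := (norm_nonneg _).trans (hD a (by simp))
  set α : ℝ → ℝ := fun x => ∫ t in a..x, (‖f t‖ + ‖g t‖)
  have hm : IntervalIntegrable (fun t => ‖f t‖ + ‖g t‖) volume a b := hf.norm.add hg.norm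
  have hα : AbsolutelyContinuousOnInterval α a b :=
    hm.absolutelyContinuousOnInterval_intervalIntegral (by simp)
  have hFd : ∀ x ∈ uIcc a b, ∀ y ∈ uIcc a b, ‖F x - F y‖ ≤ dist (α x) (α y) := by
    intro x hx y hy
    rw [hF, add_sub_add_left_eq_sub, ← dist_eq_norm]
    exact dist_integral_le_dist_integral hf hm (fun t => le_add_of_nonneg_right (norm_nonneg _)) hx hy
  have hGd : ∀ x ∈ uIcc a b, ∀ y ∈ uIcc a b, ‖G x - G y‖ ≤ dist (α x) (α y) := by
    intro x hx y hy
    rw [hG, add_sub_add_left_eq_sub, ← dist_eq_norm]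
    exact dist_integral_le_dist_integral hg hm (fun t => le_add_of_nonneg_left (norm_nonneg _)) hx hy
  have hFG : AbsolutelyContinuousOnInterval (fun x => F x * G x) a b := by
    refine absolutelyContinuousOnInterval_of_dist_le (K := C + D) hα (by positivity)
      fun x hx y hy => ?_
    rw [dist_eq_norm]
    calc ‖F x * G x - F y * G y‖ = ‖F x * (G x - G y) + (F x - F y) * G y‖ := by
          congr 1; noncomm_ring
      _ ≤ ‖F x‖ * ‖G x - G y‖ + ‖F x - F y‖ * ‖G y‖ :=
          (norm_add_le _ _).trans (add_le_add (norm_mul_le _ _) (norm_mul_le _ _))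
      _ ≤ C * dist (α x) (α y) + dist (α x) (α y) * D := by
          gcongr
          exacts [hC x hx, hGd x hx y hy, hFd x hx y hy, hD y hy]
      _ = (C + D) * dist (α x) (α y) := by ring
  have hH := hFG.sub (absolutelyContinuousOnInterval_integral hh)
  obtain ⟨K, hK⟩ := hH.const_of_ae_hasDerivAt_zero (by
    filter_upwards [hf.ae_hasDerivAt_integral, hg.ae_hasDerivAt_integral,
      hh.ae_hasDerivAt_integral] with x h1 h2 h3 hx
    have e1 := (h1 hx a (by simp)).const_add u
    have e2 := (h2 hx a (by simp)).const_add v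
    have e3 := h3 hx a (by simp)
    convert! (e1.mul e2).sub e3 using 1
    simp [hF, hG])
  have h1 := hK a (by simp)
  have h2 := hK b (by simp)
  rw [← h1] at h2
  simp only [Pi.sub_apply, intervalIntegral.integral_same, sub_zero] at h2
  rw [sub_eq_iff_eq_add] at h2
  have h3 : F a * G a = u * v := by simp [hF, hG]
  rw [h3] at h2
  exact h2

/-- The product rule for indefinite integrals with values in a Banach algebra. -/
theorem mul_eq_add_integral {f g F G : ℝ → E} {a b : ℝ}
    (hf : IntervalIntegrable f volume a b) (hg : IntervalIntegrable g volume a b)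
    (hF : ∀ x ∈ uIcc a b, F x = F a + ∫ t in a..x, f t)
    (hG : ∀ x ∈ uIcc a b, G x = G a + ∫ t in a..x, g t) :
    F b * G b = F a * G a + ∫ t in a..b, (f t * G t + F t * g t) := by
  rw [hF b (by simp), hG b (by simp), add_integral_mul_add_integral hf hg]
  congr 1
  refine intervalIntegral.integral_congr fun t ht => ?_
  simp only [← hF t ht, ← hG t ht]

end Primitive

/-- Grönwall's inequality with an integrable coefficient. -/
theorem le_mul_exp_of_le_add_integral {w b : ℝ → ℝ} {x₀ x C : ℝ} (hx : x₀ ≤ x)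
    (hb : IntervalIntegrable b volume x₀ x) (hb0 : ∀ t, 0 ≤ b t) (hw : ContinuousOn w (Icc x₀ x))
    (h : ∀ y ∈ Icc x₀ x, w y ≤ C + ∫ t in x₀..y, b t * w t) :
    w x ≤ C * Real.exp (∫ t in x₀..x, b t) := by
  have hu : uIcc x₀ x = Icc x₀ x := uIcc_of_le hx
  set U : ℝ → ℝ := fun y => C + ∫ t in x₀..y, b t * w t with hU
  have hbw : IntervalIntegrable (fun t => b t * w t) volume x₀ x :=
    hb.mul_continuousOn (hu ▸ hw)
  -- `U exp (-β)` is absolutely continuous with nonpositive derivative almost everywhere.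
  set β : ℝ → ℝ := fun y => ∫ t in x₀..y, b t with hβ
  have hβac : AbsolutelyContinuousOnInterval β x₀ x :=
    hb.absolutelyContinuousOnInterval_intervalIntegral (by simp)
  obtain ⟨M, hM⟩ := hβac.exists_bound
  have heac : AbsolutelyContinuousOnInterval (fun y => Real.exp (-β y)) x₀ x := by
    refine absolutelyContinuousOnInterval_of_dist_le (K := Real.exp M) hβac (Real.exp_pos _).le
      fun u hu v hv => ?_
    have h1 : -β u ∈ Icc (-M) M := by
      have := abs_le.mp (hM u hu); constructor <;> linarith [this.1, this.2]
    have h2 : -β v ∈ Icc (-M) M := by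
      have := abs_le.mp (hM v hv); constructor <;> linarith [this.1, this.2]
    have := Convex.norm_image_sub_le_of_norm_hasDerivWithin_le (f := Real.exp) (f' := Real.exp)
      (s := Icc (-M) M) (C := Real.exp M)
      (fun y _ => (Real.hasDerivAt_exp y).hasDerivWithinAt)
      (fun y hy => by
        rw [Real.norm_eq_abs, abs_of_pos (Real.exp_pos y)]
        exact Real.exp_le_exp.mpr hy.2) (convex_Icc _ _) h2 h1
    rw [dist_eq_norm]
    refine this.trans (le_of_eq ?_)
    rw [Real.dist_eq, Real.norm_eq_abs, ← abs_neg]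
    congr 2; ring
  have hUac : AbsolutelyContinuousOnInterval U x₀ x := by
    refine absolutelyContinuousOnInterval_of_dist_le (K := 1)
      (hbw.absolutelyContinuousOnInterval_intervalIntegral (c := x₀) (by simp)) zero_le_one
      fun u _ v _ => ?_
    simp [hU]
  have hP := (hUac.fun_mul heac).integral_deriv_eq_sub
  have hle : ∫ t in x₀..x, deriv (fun y => U y * Real.exp (-β y)) t ≤ 0 := by
    refine le_of_le_of_eq (intervalIntegral.integral_mono_ae_restrict (g := fun _ => 0) hx
      (hUac.fun_mul heac).intervalIntegrable_deriv (by simp) ?_) (by simp)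
    have : ∀ᵐ t, t ∈ Icc x₀ x → deriv (fun y => U y * Real.exp (-β y)) t ≤ 0 := by
      filter_upwards [hb.ae_hasDerivAt_integral, hbw.ae_hasDerivAt_integral] with t h1 h2 ht
      have e1 := h1 (hu ▸ ht) x₀ (by simp)
      have e2 := (h2 (hu ▸ ht) x₀ (by simp)).const_add C
      have e3 : HasDerivAt (fun y => U y * Real.exp (-β y))
          (b t * w t * Real.exp (-β t) + U t * (Real.exp (-β t) * -b t)) t := e2.mul e1.neg.exp
      rw [e3.deriv]
      have := h t ht
      have e : b t * w t * Real.exp (-β t) + U t * (Real.exp (-β t) * -b t)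
        = - (b t * Real.exp (-β t) * (U t - w t)) := by ring
      refine (le_of_eq e).trans (neg_nonpos.mpr ?_)
      have : 0 ≤ U t - w t := sub_nonneg.mpr this
      have := hb0 t
      positivity
    exact (ae_restrict_iff' measurableSet_Icc).mpr this
  rw [hP] at hle
  have h0 : U x₀ * Real.exp (-β x₀) = C := by simp [hU, hβ]
  have h1 := h x (right_mem_Icc.mpr hx)
  have h2 : U x * Real.exp (-β x) ≤ C := by linarith
  calc w x ≤ U x := h1
    _ = U x * Real.exp (-β x) * Real.exp (β x) := by
        rw [mul_assoc, ← Real.exp_add]; simp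
    _ ≤ C * Real.exp (β x) := by gcongr

/-! ### Fundamental matrices -/

theorem integral_mul_mul {μ : Measure ℝ} {f : ℝ → Mat d} (hf : Integrable f μ) (M N : Mat d) :
    ∫ t, M * f t * N ∂μ = M * (∫ t, f t ∂μ) * N :=
  (ContinuousLinearMap.mulLeftRight ℝ (Mat d) M N).integral_comp_comm hf

theorem intervalIntegral_mul_mul {f : ℝ → Mat d} {a b : ℝ} (hf : IntervalIntegrable f volume a b)
    (M N : Mat d) : ∫ t in a..b, M * f t * N = M * (∫ t in a..b, f t) * N :=
  (ContinuousLinearMap.mulLeftRight ℝ (Mat d) M N).intervalIntegral_comp_comm hf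

theorem locallyIntegrable_mul_continuous {B Y : ℝ → Mat d} (hB : LocallyIntegrable B)
    (hY : Continuous Y) : LocallyIntegrable fun t => B t * Y t := by
  rw [locallyIntegrable_iff] at hB ⊢
  intro K hK
  exact (hB K hK).mul_continuousOn hY.continuousOn hK

theorem locallyIntegrable_continuous_mul {B Y : ℝ → Mat d} (hB : LocallyIntegrable B)
    (hY : Continuous Y) : LocallyIntegrable fun t => Y t * B t := by
  rw [locallyIntegrable_iff] at hB ⊢
  intro K hK
  exact (hB K hK).continuousOn_mul hY.continuousOn hK

theorem IsSolutionOn.mono {B : ℝ → Mat d} {J J' : Set ℝ} {Y : ℝ → Mat d}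
    (h : IsSolutionOn B J Y) (hJ : J' ⊆ J) : IsSolutionOn B J' Y :=
  ⟨h.1.mono hJ, fun x hx => h.2 x (hJ hx)⟩

/-- Time reversal. -/
theorem IsSolutionOn.comp_neg {B Y : ℝ → Mat d} {J : Set ℝ} (h : IsSolutionOn B J Y) :
    IsSolutionOn (fun x => -B (-x)) (Neg.neg ⁻¹' J) fun x => Y (-x) := by
  refine ⟨h.1.comp continuous_neg.continuousOn fun x hx => hx, fun x hx => ?_⟩
  have := h.2 (-x) hx
  change Y (-x) = Y (-0) + _
  rw [this]
  simp only [neg_zero, neg_mul, intervalIntegral.integral_neg]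
  rw [intervalIntegral.integral_comp_neg (fun t => B t * Y t), neg_zero,
    intervalIntegral.integral_symm]

theorem IsSolutionOn.mul_const {B : ℝ → Mat d} {Y : ℝ → Mat d} (hB : LocallyIntegrable B)
    (h : IsSolutionOn B univ Y) (M : Mat d) : IsSolutionOn B univ fun x => Y x * M := by
  refine ⟨h.1.mul continuousOn_const, fun x hx => ?_⟩
  have hi : IntervalIntegrable (fun t => B t * Y t) volume 0 x :=
    intervalIntegrable_of_locallyIntegrable
      (locallyIntegrable_mul_continuous hB (continuousOn_univ.mp h.1)) 0 x
  have := intervalIntegral_mul_mul hi 1 M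
  simp only [one_mul, mul_assoc] at this
  change Y x * M = Y 0 * M + ∫ t in (0 : ℝ)..x, B t * (Y t * M)
  rw [this, ← add_mul, ← h.2 x hx]

/-- The inverse of a fundamental matrix is obtained from the adjoint equation `W' = -B* W`. -/
theorem exists_left_inverse {B : ℝ → Mat d} (hB : LocallyIntegrable B) :
    ∃ W : ℝ → Mat d, Continuous W ∧ W 0 = 1 ∧ ∀ x, W x = W 0 + ∫ t in (0 : ℝ)..x, -(W t * B t) := by
  have hB' : LocallyIntegrable fun t => -star (B t) := by
    rw [locallyIntegrable_iff] at hB ⊢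
    intro K hK
    exact ((starL' ℝ : Mat d ≃L[ℝ] Mat d).toContinuousLinearMap.integrable_comp (hB K hK)).neg
  obtain ⟨Y, hc, hY⟩ := exists_fundamental_aux hB'
  have h0 : Y 0 = 1 := by simpa using hY 0
  refine ⟨fun x => star (Y x), hc.star, by simp [h0], fun x => ?_⟩
  have hi : IntervalIntegrable (fun t => -star (B t) * Y t) volume 0 x :=
    intervalIntegrable_of_locallyIntegrable (locallyIntegrable_mul_continuous hB' hc) 0 x
  have := (starL' ℝ : Mat d ≃L[ℝ] Mat d).toContinuousLinearMap.intervalIntegral_comp_comm hi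
  simp only [ContinuousLinearEquiv.coe_coe, starL'_apply] at this
  change star (Y x) = star (Y 0) + _
  rw [h0, hY x, star_add, ← this]
  simp

theorem left_inverse_mul_solution {B W Y : ℝ → Mat d} {J : Set ℝ} (hB : LocallyIntegrable B)
    (hWc : Continuous W) (hW : ∀ x, W x = W 0 + ∫ t in (0 : ℝ)..x, -(W t * B t))
    (hY : IsSolutionOn B J Y) (hJ : ∀ x ∈ J, uIcc 0 x ⊆ J) {x : ℝ} (hx : x ∈ J) :
    W x * Y x = W 0 * Y 0 := by
  have hWB : IntervalIntegrable (fun t => -(W t * B t)) volume 0 x :=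
    (intervalIntegrable_of_locallyIntegrable (locallyIntegrable_continuous_mul hB hWc) 0 x).neg
  have hBY : IntervalIntegrable (fun t => B t * Y t) volume 0 x :=
    (intervalIntegrable_of_locallyIntegrable hB 0 x).mul_continuousOn (hY.1.mono (hJ x hx))
  rw [mul_eq_add_integral hWB hBY (fun y _ => hW y) (fun y hy => hY.2 y (hJ x hx hy))]
  simp [mul_assoc]

namespace IsFundamentalMatrix

variable {A B R Φ Ψ V : ℝ → Mat d}

theorem continuous (h : IsFundamentalMatrix B Φ) : Continuous Φ := continuousOn_univ.mp h.2.1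

theorem exists_inverse (hB : LocallyIntegrable B) (h : IsFundamentalMatrix B Φ) :
    ∃ W : ℝ → Mat d, Continuous W ∧ (∀ x, W x * Φ x = 1) ∧
      ∀ x, W x = 1 + ∫ t in (0 : ℝ)..x, -(W t * B t) := by
  obtain ⟨W, hc, h0, hW⟩ := exists_left_inverse hB
  refine ⟨W, hc, fun x => ?_, fun x => by rw [hW x, h0]⟩
  rw [left_inverse_mul_solution hB hc hW h.2 (fun _ _ => subset_univ _) (mem_univ x), h0, h.1,
    one_mul]

theorem inv_mul (hB : LocallyIntegrable B) (h : IsFundamentalMatrix B Φ) (x : ℝ) :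
    (Φ x)⁻¹ * Φ x = 1 := by
  obtain ⟨W, -, hW, -⟩ := exists_inverse hB h
  rw [Matrix.inv_eq_left_inv (hW x), hW x]

theorem mul_inv (hB : LocallyIntegrable B) (h : IsFundamentalMatrix B Φ) (x : ℝ) :
    Φ x * (Φ x)⁻¹ = 1 :=
  mul_eq_one_comm.mp (inv_mul hB h x)

theorem continuous_inv (hB : LocallyIntegrable B) (h : IsFundamentalMatrix B Φ) :
    Continuous fun x => (Φ x)⁻¹ := by
  obtain ⟨W, hc, hW, -⟩ := exists_inverse hB h
  simpa only [Matrix.inv_eq_left_inv (hW _)] using hc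

theorem inv_eq (hB : LocallyIntegrable B) (h : IsFundamentalMatrix B Φ) (x : ℝ) :
    (Φ x)⁻¹ = 1 + ∫ t in (0 : ℝ)..x, -((Φ t)⁻¹ * B t) := by
  obtain ⟨W, -, hW, hW'⟩ := exists_inverse hB h
  have : ∀ x, (Φ x)⁻¹ = W x := fun x => Matrix.inv_eq_left_inv (hW x)
  simp only [this]
  exact hW' x

/-- Every solution is the fundamental matrix times its value at `0`. -/
theorem solution_eq (hB : LocallyIntegrable B) (h : IsFundamentalMatrix B Φ) {J : Set ℝ}
    {Y : ℝ → Mat d} (hY : IsSolutionOn B J Y) (hJ : ∀ x ∈ J, uIcc 0 x ⊆ J) {x : ℝ} (hx : x ∈ J) :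
    Y x = Φ x * Y 0 := by
  have h0 : (Φ 0)⁻¹ = 1 := by rw [h.1, inv_one]
  have := left_inverse_mul_solution hB (continuous_inv hB h)
    (fun x => by rw [h0]; exact inv_eq hB h x) hY hJ hx
  rw [h0, one_mul] at this
  rw [← this, ← mul_assoc, mul_inv hB h, one_mul]

theorem isSolutionOn_mul (hB : LocallyIntegrable B) (h : IsFundamentalMatrix B Φ) (J : Set ℝ)
    (M : Mat d) : IsSolutionOn B J fun x => Φ x * M :=
  (h.2.mul_const hB M).mono (subset_univ J)

theorem unique (hB : LocallyIntegrable B) (h : IsFundamentalMatrix B Φ)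
    (h' : IsFundamentalMatrix B Ψ) : Φ = Ψ := by
  ext1 x
  rw [h'.solution_eq hB h.2 (fun _ _ => subset_univ _) (mem_univ x), h.1, mul_one]

theorem locallyIntegrable_conj (hA : LocallyIntegrable A) (h : IsFundamentalMatrix A Φ)
    (hR : LocallyIntegrable R) : LocallyIntegrable fun t => (Φ t)⁻¹ * R t * Φ t :=
  locallyIntegrable_mul_continuous (locallyIntegrable_continuous_mul hR (h.continuous_inv hA))
    h.continuous

/-- Variation of constants in the interaction picture. -/
theorem mul_interaction (hA : LocallyIntegrable A) (h : IsFundamentalMatrix A Φ)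
    (hR : LocallyIntegrable R) (hV : IsFundamentalMatrix (fun t => (Φ t)⁻¹ * R t * Φ t) V) :
    IsFundamentalMatrix (fun t => A t + R t) fun t => Φ t * V t := by
  have h0 : Φ 0 * V 0 = 1 := by rw [h.1, hV.1, one_mul]
  refine ⟨h0, (h.continuous.mul hV.continuous).continuousOn, fun x _ => ?_⟩
  have hi := locallyIntegrable_conj hA h hR
  change Φ x * V x = Φ 0 * V 0 + _
  rw [mul_eq_add_integral
    (intervalIntegrable_of_locallyIntegrable (locallyIntegrable_mul_continuous hA h.continuous) 0 x)
    (intervalIntegrable_of_locallyIntegrable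
      (locallyIntegrable_mul_continuous hi hV.continuous) 0 x)
    (fun y _ => h.2.2 y (mem_univ y)) (fun y _ => hV.2.2 y (mem_univ y))]
  congr 1
  refine intervalIntegral.integral_congr fun t _ => ?_
  have : Φ t * ((Φ t)⁻¹ * R t * Φ t * V t) = (Φ t * (Φ t)⁻¹) * (R t * Φ t * V t) := by
    simp only [mul_assoc]
  rw [this, mul_inv hA h t, one_mul, add_mul, mul_assoc, mul_assoc]

/-- Duhamel's formula. -/
theorem inv_mul_eq (hA : LocallyIntegrable A) (h : IsFundamentalMatrix A Φ)
    (hR : LocallyIntegrable R) (h' : IsFundamentalMatrix (fun t => A t + R t) Ψ) (x : ℝ) :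
    (Ψ x)⁻¹ * Φ x = 1 - ∫ t in (0 : ℝ)..x, (Ψ t)⁻¹ * R t * Φ t := by
  have hAR : LocallyIntegrable fun t => A t + R t := hA.add hR
  have h0 : (Ψ 0)⁻¹ = 1 := by rw [h'.1, inv_one]
  rw [mul_eq_add_integral (F := fun t => (Ψ t)⁻¹)
    ((intervalIntegrable_of_locallyIntegrable
      (locallyIntegrable_continuous_mul hAR (h'.continuous_inv hAR)) 0 x).neg)
    (intervalIntegrable_of_locallyIntegrable (locallyIntegrable_mul_continuous hA h.continuous) 0 x)
    (fun y _ => by rw [h0]; exact h'.inv_eq hAR y) (fun y _ => h.2.2 y (mem_univ y)), h0, h.1,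
    one_mul, sub_eq_add_neg, ← intervalIntegral.integral_neg]
  congr 1
  refine intervalIntegral.integral_congr fun t _ => ?_
  change -((Ψ t)⁻¹ * (A t + R t)) * Φ t + (Ψ t)⁻¹ * (A t * Φ t) = _
  noncomm_ring

theorem comp_neg (h : IsFundamentalMatrix B Φ) :
    IsFundamentalMatrix (fun t => -B (-t)) fun t => Φ (-t) :=
  ⟨by simpa using h.1, h.2.comp_neg⟩

/-- The inverse of a fundamental matrix is again one, for the coefficient `-Φ⁻¹ B Φ`; this undoes
a passage to the interaction picture. -/
theorem inv_isFundamentalMatrix (hB : LocallyIntegrable B) (h : IsFundamentalMatrix B Φ) :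
    IsFundamentalMatrix (fun t => (Φ t)⁻¹ * (-B t) * Φ t) fun t => (Φ t)⁻¹ := by
  have h0 : (Φ 0)⁻¹ = 1 := by rw [h.1, inv_one]
  refine ⟨h0, (h.continuous_inv hB).continuousOn, fun x _ => ?_⟩
  change (Φ x)⁻¹ = (Φ 0)⁻¹ + _
  rw [h0, h.inv_eq hB x]
  congr 1
  refine intervalIntegral.integral_congr fun t _ => ?_
  simp only [mul_assoc, mul_inv hB h t, mul_one, mul_neg, neg_mul]

theorem commute (hB : LocallyIntegrable B) (h : IsFundamentalMatrix B Φ) {Q : Mat d}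
    (hQ : ∀ t, Commute (B t) Q) (x : ℝ) : Commute (Φ x) Q := by
  have hs : IsSolutionOn B univ fun t => Q * Φ t := by
    refine ⟨(continuous_const.mul h.continuous).continuousOn, fun x hx => ?_⟩
    have hi := intervalIntegrable_of_locallyIntegrable
      (locallyIntegrable_mul_continuous hB h.continuous) 0 x
    have e : ∀ t, B t * (Q * Φ t) = Q * (B t * Φ t) := fun t => by
      rw [← mul_assoc, (hQ t).eq, mul_assoc]
    have := intervalIntegral_mul_mul hi Q 1
    simp only [mul_one] at this
    simp only [e]
    rw [this, ← mul_add, ← h.2.2 x hx]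
  have := h.solution_eq hB hs (fun _ _ => subset_univ _) (mem_univ x)
  rw [h.1, mul_one] at this
  exact this.symm

end IsFundamentalMatrix

/-! ### Bohl exponents -/

/-- `κ` is an admissible rate in the definition of the upper Bohl exponent of `Q` on `J`. -/
def HasUpperRate (Φ : ℝ → Mat d) (J : Set ℝ) (Q : Mat d) (κ : ℝ) : Prop :=
  ∃ C : ℝ, 1 ≤ C ∧
    ∀ x ∈ J, ∀ x' ∈ J, x' ≤ x → ‖Φ x * Q * (Φ x')⁻¹‖ ≤ C * Real.exp (κ * (x - x'))

/-- `κ` is an admissible rate in the definition of the lower Bohl exponent of `Q` on `J`. -/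
def HasLowerRate (Φ : ℝ → Mat d) (J : Set ℝ) (Q : Mat d) (κ : ℝ) : Prop :=
  ∃ C : ℝ, 1 ≤ C ∧
    ∀ x ∈ J, ∀ x' ∈ J, x ≤ x' → ‖Φ x * Q * (Φ x')⁻¹‖ ≤ C * Real.exp (κ * (x - x'))

section

variable {Φ Ψ : ℝ → Mat d} {J J' : Set ℝ} {P Q : Mat d} {κ κ' : ℝ}

theorem hasUpperRate_of_le (C : ℝ)
    (h : ∀ x ∈ J, ∀ x' ∈ J, x' ≤ x → ‖Φ x * Q * (Φ x')⁻¹‖ ≤ C * Real.exp (κ * (x - x'))) :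
    HasUpperRate Φ J Q κ :=
  ⟨max C 1, le_max_right _ _, fun x hx x' hx' hle => (h x hx x' hx' hle).trans
    (mul_le_mul_of_nonneg_right (le_max_left _ _) (Real.exp_pos _).le)⟩

theorem hasLowerRate_of_le (C : ℝ)
    (h : ∀ x ∈ J, ∀ x' ∈ J, x ≤ x' → ‖Φ x * Q * (Φ x')⁻¹‖ ≤ C * Real.exp (κ * (x - x'))) :
    HasLowerRate Φ J Q κ :=
  ⟨max C 1, le_max_right _ _, fun x hx x' hx' hle => (h x hx x' hx' hle).trans
    (mul_le_mul_of_nonneg_right (le_max_left _ _) (Real.exp_pos _).le)⟩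

theorem hasLowerRate_iff_reverse :
    HasLowerRate Φ J Q κ ↔ HasUpperRate (fun x => Φ (-x)) (Neg.neg ⁻¹' J) Q (-κ) := by
  constructor
  · rintro ⟨C, h1, h⟩
    refine ⟨C, h1, fun x hx x' hx' hle => ?_⟩
    convert h (-x) hx (-x') hx' (neg_le_neg hle) using 3
    ring
  · rintro ⟨C, h1, h⟩
    refine ⟨C, h1, fun x hx x' hx' hle => ?_⟩
    convert h (-x) (by simpa using hx) (-x') (by simpa using hx') (neg_le_neg hle) using 3
    · simp
    · simp
    · ring

theorem hasUpperRate_iff_reverse :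
    HasUpperRate Φ J Q κ ↔ HasLowerRate (fun x => Φ (-x)) (Neg.neg ⁻¹' J) Q (-κ) := by
  rw [hasLowerRate_iff_reverse]
  simp only [neg_neg]
  have : Neg.neg ⁻¹' (Neg.neg ⁻¹' J) = J := by ext; simp
  rw [this]

theorem HasUpperRate.mono (h : HasUpperRate Φ J Q κ) (hκ : κ ≤ κ') : HasUpperRate Φ J Q κ' := by
  obtain ⟨C, h1, h⟩ := h
  refine ⟨C, h1, fun x hx x' hx' hle => (h x hx x' hx' hle).trans ?_⟩
  have : 0 ≤ x - x' := sub_nonneg.mpr hle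
  gcongr

theorem HasLowerRate.mono (h : HasLowerRate Φ J Q κ) (hκ : κ' ≤ κ) : HasLowerRate Φ J Q κ' := by
  rw [hasLowerRate_iff_reverse] at h ⊢
  exact h.mono (neg_le_neg hκ)

theorem HasUpperRate.subset (h : HasUpperRate Φ J Q κ) (hJ : J' ⊆ J) : HasUpperRate Φ J' Q κ := by
  obtain ⟨C, h1, h⟩ := h
  exact ⟨C, h1, fun x hx x' hx' hle => h x (hJ hx) x' (hJ hx') hle⟩

theorem HasLowerRate.subset (h : HasLowerRate Φ J Q κ) (hJ : J' ⊆ J) : HasLowerRate Φ J' Q κ := by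
  obtain ⟨C, h1, h⟩ := h
  exact ⟨C, h1, fun x hx x' hx' hle => h x (hJ hx) x' (hJ hx') hle⟩

theorem hasUpperRate_zero : HasUpperRate Φ J 0 κ :=
  hasUpperRate_of_le 0 fun x _ x' _ _ => by simp

theorem hasLowerRate_zero : HasLowerRate Φ J 0 κ :=
  hasLowerRate_of_le 0 fun x _ x' _ _ => by simp

theorem HasUpperRate.add (h : HasUpperRate Φ J Q κ) (h' : HasUpperRate Φ J P κ) :
    HasUpperRate Φ J (Q + P) κ := by
  obtain ⟨C, h1, h⟩ := h
  obtain ⟨C', h1', h'⟩ := h'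
  refine ⟨C + C', by linarith, fun x hx x' hx' hle => ?_⟩
  rw [mul_add, add_mul, add_mul]
  exact (norm_add_le _ _).trans (add_le_add (h x hx x' hx' hle) (h' x hx x' hx' hle))

theorem HasLowerRate.add (h : HasLowerRate Φ J Q κ) (h' : HasLowerRate Φ J P κ) :
    HasLowerRate Φ J (Q + P) κ := by
  rw [hasLowerRate_iff_reverse] at h h' ⊢
  exact h.add h'

theorem hasUpperRate_sum {ι : Type*} {s : Finset ι} {Q : ι → Mat d}
    (h : ∀ i ∈ s, HasUpperRate Φ J (Q i) κ) : HasUpperRate Φ J (∑ i ∈ s, Q i) κ :=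
  Finset.sum_induction _ (fun M => HasUpperRate Φ J M κ) (fun _ _ => HasUpperRate.add)
    hasUpperRate_zero h

theorem hasLowerRate_sum {ι : Type*} {s : Finset ι} {Q : ι → Mat d}
    (h : ∀ i ∈ s, HasLowerRate Φ J (Q i) κ) : HasLowerRate Φ J (∑ i ∈ s, Q i) κ :=
  Finset.sum_induction _ (fun M => HasLowerRate Φ J M κ) (fun _ _ => HasLowerRate.add)
    hasLowerRate_zero h

theorem hasUpperRate_of_lt (h : upperBohl Φ J Q < κ) : HasUpperRate Φ J Q κ := by
  obtain ⟨_, ⟨κ₁, h1, rfl⟩, hlt⟩ := sInf_lt_iff.mp h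
  exact HasUpperRate.mono h1 (EReal.coe_lt_coe_iff.mp hlt).le

theorem hasLowerRate_of_lt (h : κ < lowerBohl Φ J Q) : HasLowerRate Φ J Q κ := by
  obtain ⟨_, ⟨κ₁, h1, rfl⟩, hlt⟩ := lt_sSup_iff.mp h
  exact HasLowerRate.mono h1 (EReal.coe_lt_coe_iff.mp hlt).le

theorem HasUpperRate.upperBohl_le (h : HasUpperRate Φ J Q κ) : upperBohl Φ J Q ≤ κ :=
  sInf_le ⟨κ, h, rfl⟩

theorem HasLowerRate.le_lowerBohl (h : HasLowerRate Φ J Q κ) : κ ≤ lowerBohl Φ J Q :=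
  le_sSup ⟨κ, h, rfl⟩

theorem upperBohl_le_upperBohl (h : ∀ κ, HasUpperRate Φ J Q κ → HasUpperRate Ψ J' P κ) :
    upperBohl Ψ J' P ≤ upperBohl Φ J Q :=
  sInf_le_sInf (image_mono h)

theorem lowerBohl_le_lowerBohl (h : ∀ κ, HasLowerRate Φ J Q κ → HasLowerRate Ψ J' P κ) :
    lowerBohl Φ J Q ≤ lowerBohl Ψ J' P :=
  sSup_le_sSup (image_mono h)

theorem lowerBohl_eq_neg_reverse :
    lowerBohl Φ J Q = -upperBohl (fun x => Φ (-x)) (Neg.neg ⁻¹' J) Q := by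
  apply le_antisymm
  · refine sSup_le ?_
    rintro _ ⟨κ, h, rfl⟩
    have := (hasLowerRate_iff_reverse.mp h).upperBohl_le
    rw [EReal.coe_neg] at this
    exact EReal.le_neg_of_le_neg this
  · rw [EReal.neg_le]
    refine le_sInf ?_
    rintro _ ⟨κ, h, rfl⟩
    have h' : HasUpperRate (fun x => Φ (-x)) (Neg.neg ⁻¹' J) Q (- -κ) := by rwa [neg_neg]
    have := (hasLowerRate_iff_reverse.mpr h').le_lowerBohl
    rw [EReal.coe_neg] at this
    exact EReal.neg_le.mp this

theorem upperBohl_eq_neg_reverse :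
    upperBohl Φ J Q = -lowerBohl (fun x => Φ (-x)) (Neg.neg ⁻¹' J) Q := by
  rw [lowerBohl_eq_neg_reverse, neg_neg]
  simp only [neg_neg]
  congr 1
  ext; simp

end

/-! ### Integrable block-diagonal perturbations preserve growth rates -/

section Interaction

variable {Φ Z B : ℝ → Mat d} {J : Set ℝ} {Q : Mat d} {κ : ℝ}

/-- An integrable perturbation `B`, written in the interaction picture and commuting with the
projection `Q`, preserves upper rates: the block of `Q` satisfies a closed Volterra equation, to
which Grönwall's inequality applies. -/
theorem HasUpperRate.interaction (hΦ : Continuous Φ) (hinv : ∀ x, (Φ x)⁻¹ * Φ x = 1)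
    (hB : LocallyIntegrable B)
    (hZ : IsFundamentalMatrix B Z) (hint : Integrable fun t => ‖Φ t * B t * (Φ t)⁻¹‖)
    (hQ : IsIdempotentElem Q) (hc : ∀ t, Commute (B t) Q) (hJ : OrdConnected J)
    (h : HasUpperRate Φ J Q κ) : HasUpperRate (fun x => Φ x * Z x) J Q κ := by
  obtain ⟨C, hC1, h⟩ := h
  have hC0 : 0 ≤ C := by linarith
  set b : ℝ → ℝ := fun t => ‖Φ t * B t * (Φ t)⁻¹‖ with hb
  refine hasUpperRate_of_le (C * Real.exp (C * ∫ t, b t)) fun x hx x' hx' hle => ?_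
  have hBZ : LocallyIntegrable fun t => B t * Z t :=
    locallyIntegrable_mul_continuous hB hZ.continuous
  have hZc := hZ.commute hB hc
  set W : Mat d := Q * (Φ x' * Z x')⁻¹ with hW
  have hQW : Q * W = W := by rw [hW, ← mul_assoc, hQ.eq]
  have hcont : Continuous fun y => Φ y * Z y * W :=
    (hΦ.mul hZ.continuous).mul continuous_const
  set w : ℝ → ℝ := fun y => ‖Φ y * Z y * W‖ * Real.exp (-(κ * (y - x'))) with hw
  have hw0 : ∀ y, ‖Φ y * Z y * W‖ = w y * Real.exp (κ * (y - x')) := fun y => by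
    change _ = ‖Φ y * Z y * W‖ * Real.exp (-(κ * (y - x'))) * Real.exp (κ * (y - x'))
    rw [mul_assoc ‖_‖, ← Real.exp_add]; simp
  have hwc : Continuous w := by fun_prop
  have hi : ∀ u v, IntervalIntegrable (fun t => C * b t) volume u v := fun u v =>
    (hint.intervalIntegrable).const_mul C
  have hvolt : ∀ y, Φ y * Z y * W = Φ y * Q * (Φ x')⁻¹ +
      ∫ t in x'..y, (Φ y * Q * (Φ t)⁻¹) * (Φ t * B t * (Φ t)⁻¹) * (Φ t * Z t * W) := by
    intro y
    have e1 : Z y = Z x' + ∫ t in x'..y, B t * Z t := by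
      rw [hZ.2.2 y (mem_univ _), hZ.2.2 x' (mem_univ _), add_assoc]
      rw [intervalIntegral.integral_add_adjacent_intervals] <;>
        exact intervalIntegrable_of_locallyIntegrable hBZ _ _
    have e2 : Z x' * W = Q * (Φ x')⁻¹ := by
      rw [hW, ← mul_assoc, (hZc x').eq, Matrix.mul_inv_rev, mul_assoc, ← mul_assoc (Z x'),
        hZ.mul_inv hB, one_mul]
    have e3 : ∀ t, (Φ y * Q * (Φ t)⁻¹) * (Φ t * B t * (Φ t)⁻¹) * (Φ t * Z t * W)
        = Φ y * (B t * Z t) * W := by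
      intro t
      calc (Φ y * Q * (Φ t)⁻¹) * (Φ t * B t * (Φ t)⁻¹) * (Φ t * Z t * W)
          = Φ y * Q * ((Φ t)⁻¹ * Φ t) * B t * ((Φ t)⁻¹ * Φ t) * Z t * W := by noncomm_ring
        _ = Φ y * (Q * B t) * Z t * W := by rw [hinv]; noncomm_ring
        _ = Φ y * B t * (Q * Z t) * W := by rw [← (hc t).eq]; noncomm_ring
        _ = Φ y * B t * Z t * (Q * W) := by rw [← (hZc t).eq]; noncomm_ring
        _ = Φ y * (B t * Z t) * W := by rw [hQW]; noncomm_ring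
    simp only [e3]
    rw [intervalIntegral_mul_mul (intervalIntegrable_of_locallyIntegrable hBZ _ _), e1, mul_assoc,
      add_mul, e2]
    noncomm_ring
  have hgron : ∀ y ∈ Icc x' x, w y ≤ C + ∫ t in x'..y, C * b t * w t := by
    intro y hy
    have hyJ : y ∈ J := hJ.out hx' hx hy
    have h1 : ‖∫ t in x'..y, (Φ y * Q * (Φ t)⁻¹) * (Φ t * B t * (Φ t)⁻¹) * (Φ t * Z t * W)‖
        ≤ ∫ t in x'..y, Real.exp (κ * (y - x')) * (C * b t * w t) := by
      refine intervalIntegral.norm_integral_le_of_norm_le hy.1 (ae_of_all _ fun t ht => ?_)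
        (((hi _ _).mul_continuousOn hwc.continuousOn).const_mul _)
      have htJ : t ∈ J := hJ.out hx' hyJ ⟨ht.1.le, ht.2⟩
      calc ‖(Φ y * Q * (Φ t)⁻¹) * (Φ t * B t * (Φ t)⁻¹) * (Φ t * Z t * W)‖
          ≤ ‖Φ y * Q * (Φ t)⁻¹‖ * ‖Φ t * B t * (Φ t)⁻¹‖ * ‖Φ t * Z t * W‖ :=
            (norm_mul_le _ _).trans (by gcongr; exact norm_mul_le _ _)
        _ ≤ (C * Real.exp (κ * (y - t))) * b t * (w t * Real.exp (κ * (t - x'))) := by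
            rw [← hw0 t]
            gcongr
            exact h y hyJ t htJ ht.2
        _ = (Real.exp (κ * (y - t)) * Real.exp (κ * (t - x'))) * (C * b t * w t) := by ring
        _ = Real.exp (κ * (y - x')) * (C * b t * w t) := by
            rw [← Real.exp_add]; ring_nf
    rw [intervalIntegral.integral_const_mul] at h1
    have h2 := (norm_add_le _ _).trans (add_le_add (h y hyJ x' hx' hy.1) h1)
    rw [← hvolt y, hw0 y] at h2
    have h3 := Real.exp_pos (κ * (y - x'))
    have h4 : C * Real.exp (κ * (y - x')) + Real.exp (κ * (y - x')) * ∫ t in x'..y, C * b t * w t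
      = (C + ∫ t in x'..y, C * b t * w t) * Real.exp (κ * (y - x')) := by ring
    rw [h4] at h2
    exact le_of_mul_le_mul_right h2 h3
  have hfin := le_mul_exp_of_le_add_integral hle (hi x' x)
    (fun t => mul_nonneg hC0 (norm_nonneg _)) hwc.continuousOn hgron
  have hle2 : ∫ t in x'..x, C * b t ≤ C * ∫ t, b t := by
    rw [intervalIntegral.integral_const_mul, intervalIntegral.integral_of_le hle]
    exact mul_le_mul_of_nonneg_left
      (setIntegral_le_integral hint (ae_of_all _ fun t => norm_nonneg _)) hC0
  have e : Φ x * Z x * Q * (Φ x' * Z x')⁻¹ = Φ x * Z x * W := by rw [hW, ← mul_assoc]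
  rw [e, hw0 x]
  gcongr
  exact hfin.trans (by gcongr)

theorem locallyIntegrable_neg_comp_neg (hB : LocallyIntegrable B) :
    LocallyIntegrable fun t => -B (-t) := by
  rw [locallyIntegrable_iff] at hB ⊢
  intro K hK
  have hK' : IsCompact (Neg.neg ⁻¹' K : Set ℝ) := (Homeomorph.neg ℝ).isCompact_preimage.mpr hK
  have := ((Measure.measurePreserving_neg (volume : Measure ℝ)).integrableOn_comp_preimage
    (Homeomorph.neg ℝ).measurableEmbedding).mpr (hB _ hK')
  have e : Neg.neg ⁻¹' (Neg.neg ⁻¹' K : Set ℝ) = K := by ext; simp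
  rw [e] at this
  exact this.neg

theorem HasLowerRate.interaction (hΦ : Continuous Φ) (hinv : ∀ x, (Φ x)⁻¹ * Φ x = 1)
    (hB : LocallyIntegrable B)
    (hZ : IsFundamentalMatrix B Z) (hint : Integrable fun t => ‖Φ t * B t * (Φ t)⁻¹‖)
    (hQ : IsIdempotentElem Q) (hc : ∀ t, Commute (B t) Q) (hJ : OrdConnected J)
    (h : HasLowerRate Φ J Q κ) : HasLowerRate (fun x => Φ x * Z x) J Q κ := by
  rw [hasLowerRate_iff_reverse] at h ⊢
  have hB' : LocallyIntegrable fun t => -B (-t) := locallyIntegrable_neg_comp_neg hB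
  refine h.interaction (hΦ.comp continuous_neg) (fun x => hinv _) hB' hZ.comp_neg ?_ hQ
    (fun t => (hc _).neg_left) ?_
  · simpa using hint.comp_neg
  · exact ⟨fun x hx y hy z hz => hJ.out hy hx ⟨neg_le_neg hz.2, neg_le_neg hz.1⟩⟩

/-- Passing from `Φ` to `Φ Z` is reversible, since `Φ = (Φ Z) Z⁻¹`. -/
theorem exists_reverse_interaction (hΦ : Continuous Φ) (hinv : ∀ x, (Φ x)⁻¹ * Φ x = 1)
    (hB : LocallyIntegrable B)
    (hZ : IsFundamentalMatrix B Z) (hint : Integrable fun t => ‖Φ t * B t * (Φ t)⁻¹‖)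
    (hc : ∀ t, Commute (B t) Q) :
    Continuous (fun x => Φ x * Z x) ∧ (∀ x, (Φ x * Z x)⁻¹ * (Φ x * Z x) = 1) ∧
    ∃ B' Z', LocallyIntegrable B' ∧ IsFundamentalMatrix B' Z' ∧
      (Integrable fun t => ‖(Φ t * Z t) * B' t * (Φ t * Z t)⁻¹‖) ∧ (∀ t, Commute (B' t) Q) ∧
      (fun x => Φ x * Z x * Z' x) = Φ := by
  refine ⟨hΦ.mul hZ.continuous, fun x => ?_, fun t => (Z t)⁻¹ * (-B t) * Z t, fun t => (Z t)⁻¹,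
    hZ.locallyIntegrable_conj hB hB.neg, hZ.inv_isFundamentalMatrix hB, ?_, fun t => ?_, ?_⟩
  · rw [Matrix.mul_inv_rev, mul_assoc, ← mul_assoc (Φ x)⁻¹, hinv, one_mul, hZ.inv_mul hB]
  · refine hint.congr (ae_of_all _ fun t => ?_)
    have : (Φ t * Z t) * ((Z t)⁻¹ * (-B t) * Z t) * (Φ t * Z t)⁻¹
        = -(Φ t * B t * (Φ t)⁻¹) := by
      rw [Matrix.mul_inv_rev]
      calc (Φ t * Z t) * ((Z t)⁻¹ * (-B t) * Z t) * ((Z t)⁻¹ * (Φ t)⁻¹)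
          = -(Φ t * (Z t * (Z t)⁻¹) * B t * (Z t * (Z t)⁻¹) * (Φ t)⁻¹) := by noncomm_ring
        _ = _ := by rw [hZ.mul_inv hB]; noncomm_ring
    simp only [this, norm_neg]
  · have h1 := hZ.commute hB hc t
    have h2 : Commute (Z t)⁻¹ Q := by
      calc (Z t)⁻¹ * Q = (Z t)⁻¹ * (Q * Z t) * (Z t)⁻¹ := by
            rw [mul_assoc, mul_assoc, hZ.mul_inv hB, mul_one]
        _ = ((Z t)⁻¹ * Z t) * Q * (Z t)⁻¹ := by rw [← h1.eq]; noncomm_ring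
        _ = Q * (Z t)⁻¹ := by rw [hZ.inv_mul hB, one_mul]
    exact (h2.mul_left (hc t).neg_left).mul_left h1
  · ext1 x
    rw [mul_assoc, hZ.mul_inv hB, mul_one]

theorem hasUpperRate_interaction_iff (hΦ : Continuous Φ) (hinv : ∀ x, (Φ x)⁻¹ * Φ x = 1)
    (hB : LocallyIntegrable B)
    (hZ : IsFundamentalMatrix B Z) (hint : Integrable fun t => ‖Φ t * B t * (Φ t)⁻¹‖)
    (hQ : IsIdempotentElem Q) (hc : ∀ t, Commute (B t) Q) (hJ : OrdConnected J) :
    HasUpperRate (fun x => Φ x * Z x) J Q κ ↔ HasUpperRate Φ J Q κ := by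
  refine ⟨fun h => ?_, fun h => h.interaction hΦ hinv hB hZ hint hQ hc hJ⟩
  obtain ⟨h1, h2, B', Z', h3, h4, h5, h6, h7⟩ :=
    exists_reverse_interaction hΦ hinv hB hZ hint hc
  rw [← h7]
  exact h.interaction h1 h2 h3 h4 h5 hQ h6 hJ

theorem hasLowerRate_interaction_iff (hΦ : Continuous Φ) (hinv : ∀ x, (Φ x)⁻¹ * Φ x = 1)
    (hB : LocallyIntegrable B)
    (hZ : IsFundamentalMatrix B Z) (hint : Integrable fun t => ‖Φ t * B t * (Φ t)⁻¹‖)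
    (hQ : IsIdempotentElem Q) (hc : ∀ t, Commute (B t) Q) (hJ : OrdConnected J) :
    HasLowerRate (fun x => Φ x * Z x) J Q κ ↔ HasLowerRate Φ J Q κ := by
  refine ⟨fun h => ?_, fun h => h.interaction hΦ hinv hB hZ hint hQ hc hJ⟩
  obtain ⟨h1, h2, B', Z', h3, h4, h5, h6, h7⟩ :=
    exists_reverse_interaction hΦ hinv hB hZ hint hc
  rw [← h7]
  exact h.interaction h1 h2 h3 h4 h5 hQ h6 hJ

end Interaction

/-! ### Block diagonalization of a small integrable perturbation -/

/-- The antiderivative used for the `(i, j)` block: integrate from `-∞` if `i < j`, and from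
`+∞` if `j < i`; diagonal blocks are set to `0`. -/
noncomputable def splitPrimitive (i j : ℕ) (h : ℝ → Mat d) (x : ℝ) : Mat d :=
  if i < j then ∫ t in Iic x, h t else if j < i then -∫ t in Ioi x, h t else 0

/-- The integrability that makes `splitPrimitive i j h` an antiderivative of `h`. -/
def SplitIntegrable (i j : ℕ) (h : ℝ → Mat d) : Prop :=
  (i < j → ∀ x, IntegrableOn h (Iic x)) ∧ (j < i → ∀ x, IntegrableOn h (Ioi x))

theorem splitPrimitive_self (i : ℕ) (h : ℝ → Mat d) (x : ℝ) : splitPrimitive i i h x = 0 := by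
  simp [splitPrimitive]

theorem splitPrimitive_eq_add {i j : ℕ} {h : ℝ → Mat d} (hij : i ≠ j)
    (hh : SplitIntegrable i j h) (x : ℝ) :
    splitPrimitive i j h x = splitPrimitive i j h 0 + ∫ t in (0 : ℝ)..x, h t := by
  rcases hij.lt_or_gt with hlt | hlt
  · simp only [splitPrimitive, hlt, if_true]
    rw [← intervalIntegral.integral_Iic_sub_Iic (hh.1 hlt 0) (hh.1 hlt x)]
    abel
  · simp only [splitPrimitive, hlt, if_true, not_lt_of_gt hlt, if_false]
    rw [← intervalIntegral.integral_Ioi_sub_Ioi' (hh.2 hlt 0) (hh.2 hlt x)]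
    abel

theorem splitPrimitive_sub {i j : ℕ} {h h' : ℝ → Mat d} (hh : SplitIntegrable i j h)
    (hh' : SplitIntegrable i j h') (x : ℝ) :
    splitPrimitive i j (fun t => h t - h' t) x
      = splitPrimitive i j h x - splitPrimitive i j h' x := by
  unfold splitPrimitive
  split_ifs with h1 h2
  · exact integral_sub (hh.1 h1 x) (hh'.1 h1 x)
  · rw [integral_sub (hh.2 h2 x) (hh'.2 h2 x)]; abel
  · simp

theorem splitPrimitive_mul_mul {i j : ℕ} {h : ℝ → Mat d} (hh : SplitIntegrable i j h)
    (M N : Mat d) (x : ℝ) :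
    splitPrimitive i j (fun t => M * h t * N) x = M * splitPrimitive i j h x * N := by
  unfold splitPrimitive
  split_ifs with h1 h2
  · exact integral_mul_mul (hh.1 h1 x) M N
  · rw [integral_mul_mul (hh.2 h2 x) M N]; simp
  · simp

/-- The data of a splitting `1 = ∑ Q j` along `Φ` with uniformly bounded conjugates, such that the
growth rates of the blocks increase with the index; the latter enters only through the bound
`kernel` on the kernels of the off-diagonal Green operator. -/
structure BlockSplitting (Φ : ℝ → Mat d) (s : Finset ℕ) (Q : ℕ → Mat d) (M C : ℝ) : Prop where
  cont : Continuous Φ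
  cont_inv : Continuous fun x => (Φ x)⁻¹
  inv_mul : ∀ x, (Φ x)⁻¹ * Φ x = 1
  mul_inv : ∀ x, Φ x * (Φ x)⁻¹ = 1
  sum_eq : ∑ j ∈ s, Q j = 1
  idem : ∀ j ∈ s, IsIdempotentElem (Q j)
  disjoint : ∀ i ∈ s, ∀ j ∈ s, i ≠ j → Q i * Q j = 0
  conj : ∀ j ∈ s, ∀ x, ‖Φ x * Q j * (Φ x)⁻¹‖ ≤ M
  kernel : ∀ i ∈ s, ∀ j ∈ s, i < j → ∀ x t, t ≤ x →
    ‖Φ x * Q i * (Φ t)⁻¹‖ * ‖Φ t * Q j * (Φ x)⁻¹‖ ≤ C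

/-- The `(i, j)` block of `H` in the interaction picture. -/
noncomputable def blockPart (Φ : ℝ → Mat d) (Q : ℕ → Mat d) (i j : ℕ) (H : ℝ → Mat d) (t : ℝ) :
    Mat d :=
  Q i * ((Φ t)⁻¹ * H t * Φ t) * Q j

/-- The off-diagonal Green operator: in the interaction picture its off-diagonal blocks are the
antiderivatives `splitPrimitive` of the blocks of `H`, and its diagonal blocks are `0`. -/
noncomputable def greenOp (Φ : ℝ → Mat d) (s : Finset ℕ) (Q : ℕ → Mat d) (H : ℝ → Mat d)
    (x : ℝ) : Mat d :=
  Φ x * (∑ i ∈ s, ∑ j ∈ s, splitPrimitive i j (blockPart Φ Q i j H) x) * (Φ x)⁻¹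

/-- The block diagonal part of `X` with respect to the projections `Φ x * Q k * (Φ x)⁻¹`. -/
noncomputable def diagPart (Φ : ℝ → Mat d) (s : Finset ℕ) (Q : ℕ → Mat d) (x : ℝ) (X : Mat d) :
    Mat d :=
  ∑ k ∈ s, (Φ x * Q k * (Φ x)⁻¹) * X * (Φ x * Q k * (Φ x)⁻¹)

namespace BlockSplitting

variable {Φ : ℝ → Mat d} {s : Finset ℕ} {Q : ℕ → Mat d} {M C : ℝ}

theorem block_bound (hS : BlockSplitting Φ s Q M C) {H : ℝ → Mat d} (hH : Integrable H)
    {i j : ℕ} {I : Set ℝ} (hI : MeasurableSet I) {x : ℝ}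
    (hk : ∀ t ∈ I, ‖Φ x * Q i * (Φ t)⁻¹‖ * ‖Φ t * Q j * (Φ x)⁻¹‖ ≤ C) :
    IntegrableOn (blockPart Φ Q i j H) I ∧
      ‖Φ x * (∫ t in I, blockPart Φ Q i j H t) * (Φ x)⁻¹‖ ≤ |C| * ∫ t, ‖H t‖ := by
  set g : ℝ → Mat d := fun t => Φ x * blockPart Φ Q i j H t * (Φ x)⁻¹ with hg
  have hm : AEStronglyMeasurable (blockPart Φ Q i j H) volume :=
    (((hS.cont_inv.aestronglyMeasurable.mul hH.1).mul
      hS.cont.aestronglyMeasurable).const_mul _).mul_const _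
  have hgm : AEStronglyMeasurable g volume := (hm.const_mul _).mul_const _
  have hgb : ∀ t ∈ I, ‖g t‖ ≤ |C| * ‖H t‖ := by
    intro t ht
    have e : g t = (Φ x * Q i * (Φ t)⁻¹) * H t * (Φ t * Q j * (Φ x)⁻¹) := by
      simp only [hg, blockPart, mul_assoc]
    rw [e]
    calc _ ≤ ‖Φ x * Q i * (Φ t)⁻¹‖ * ‖H t‖ * ‖Φ t * Q j * (Φ x)⁻¹‖ :=
          (norm_mul_le _ _).trans (by gcongr; exact norm_mul_le _ _)
      _ = (‖Φ x * Q i * (Φ t)⁻¹‖ * ‖Φ t * Q j * (Φ x)⁻¹‖) * ‖H t‖ := by ring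
      _ ≤ |C| * ‖H t‖ := by gcongr; exact (hk t ht).trans (le_abs_self C)
  have hgI : IntegrableOn g I :=
    Integrable.mono' (hH.norm.const_mul |C|).integrableOn hgm.restrict
      ((ae_restrict_iff' hI).mpr (ae_of_all _ hgb))
  have hbI : IntegrableOn (blockPart Φ Q i j H) I := by
    have := (ContinuousLinearMap.mulLeftRight ℝ (Mat d) (Φ x)⁻¹ (Φ x)).integrable_comp hgI
    refine this.congr (ae_of_all _ fun t => ?_)
    simp only [hg, ContinuousLinearMap.mulLeftRight_apply]
    rw [mul_assoc, mul_assoc, mul_assoc, hS.inv_mul, mul_one, ← mul_assoc, hS.inv_mul, one_mul]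
  refine ⟨hbI, ?_⟩
  rw [← integral_mul_mul hbI]
  calc ‖∫ t in I, g t‖ ≤ ∫ t in I, ‖g t‖ := norm_integral_le_integral_norm _
    _ ≤ ∫ t in I, |C| * ‖H t‖ :=
        setIntegral_mono_on hgI.norm (hH.norm.const_mul |C|).integrableOn hI hgb
    _ ≤ ∫ t, |C| * ‖H t‖ := setIntegral_le_integral (hH.norm.const_mul |C|)
        (ae_of_all _ fun t => mul_nonneg (abs_nonneg _) (norm_nonneg _))
    _ = |C| * ∫ t, ‖H t‖ := integral_const_mul _ _

theorem kernel_gt (hS : BlockSplitting Φ s Q M C) {i j : ℕ} (hi : i ∈ s) (hj : j ∈ s)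
    (hij : j < i) (x t : ℝ) (ht : t ∈ Ioi x) :
    ‖Φ x * Q i * (Φ t)⁻¹‖ * ‖Φ t * Q j * (Φ x)⁻¹‖ ≤ C := by
  rw [mul_comm]
  exact hS.kernel j hj i hi hij t x (le_of_lt ht)

theorem splitIntegrable (hS : BlockSplitting Φ s Q M C) {H : ℝ → Mat d} (hH : Integrable H)
    {i j : ℕ} (hi : i ∈ s) (hj : j ∈ s) : SplitIntegrable i j (blockPart Φ Q i j H) :=
  ⟨fun hlt x => (hS.block_bound hH measurableSet_Iic
      (fun t ht => hS.kernel i hi j hj hlt x t ht)).1,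
    fun hlt x => (hS.block_bound hH measurableSet_Ioi
      (fun t ht => hS.kernel_gt hi hj hlt x t ht)).1⟩

theorem norm_splitPrimitive_le (hS : BlockSplitting Φ s Q M C) {H : ℝ → Mat d}
    (hH : Integrable H) {i j : ℕ} (hi : i ∈ s) (hj : j ∈ s) (x : ℝ) :
    ‖Φ x * splitPrimitive i j (blockPart Φ Q i j H) x * (Φ x)⁻¹‖ ≤ |C| * ∫ t, ‖H t‖ := by
  unfold splitPrimitive
  split_ifs with h1 h2
  · exact (hS.block_bound hH measurableSet_Iic (fun t ht => hS.kernel i hi j hj h1 x t ht)).2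
  · rw [mul_neg, neg_mul, norm_neg]
    exact (hS.block_bound hH measurableSet_Ioi (fun t ht => hS.kernel_gt hi hj h2 x t ht)).2
  · simp only [mul_zero, zero_mul, norm_zero]
    exact mul_nonneg (abs_nonneg _) (integral_nonneg fun _ => norm_nonneg _)

theorem norm_greenOp_le (hS : BlockSplitting Φ s Q M C) {H : ℝ → Mat d}
    (hH : Integrable H) (x : ℝ) :
    ‖greenOp Φ s Q H x‖ ≤ (s.card : ℝ) ^ 2 * |C| * ∫ t, ‖H t‖ := by
  have e : greenOp Φ s Q H x
      = ∑ i ∈ s, ∑ j ∈ s, Φ x * splitPrimitive i j (blockPart Φ Q i j H) x * (Φ x)⁻¹ := by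
    simp only [greenOp, Finset.mul_sum, Finset.sum_mul]
  rw [e]
  calc _ ≤ ∑ i ∈ s, ∑ j ∈ s, |C| * ∫ t, ‖H t‖ :=
        norm_sum_le_of_le _ fun i hi => norm_sum_le_of_le _ fun j hj =>
          hS.norm_splitPrimitive_le hH hi hj x
    _ = _ := by simp only [Finset.sum_const, nsmul_eq_mul]; ring

theorem greenOp_sub (hS : BlockSplitting Φ s Q M C) {H H' : ℝ → Mat d}
    (hH : Integrable H) (hH' : Integrable H') (x : ℝ) :
    greenOp Φ s Q H x - greenOp Φ s Q H' x = greenOp Φ s Q (fun t => H t - H' t) x := by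
  simp only [greenOp]
  rw [← sub_mul, ← mul_sub, ← Finset.sum_sub_distrib]
  congr 2
  refine Finset.sum_congr rfl fun i hi => ?_
  rw [← Finset.sum_sub_distrib]
  refine Finset.sum_congr rfl fun j hj => ?_
  rw [← splitPrimitive_sub (hS.splitIntegrable hH hi hj) (hS.splitIntegrable hH' hi hj)]
  congr 1
  ext1 t
  simp only [blockPart]
  noncomm_ring

theorem locallyIntegrable_blockPart (hS : BlockSplitting Φ s Q M C) {H : ℝ → Mat d}
    (hH : Integrable H) (i j : ℕ) : LocallyIntegrable (blockPart Φ Q i j H) :=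
  locallyIntegrable_mul_continuous (locallyIntegrable_continuous_mul
    (locallyIntegrable_mul_continuous (locallyIntegrable_continuous_mul hH.locallyIntegrable
      hS.cont_inv) hS.cont) continuous_const) continuous_const

theorem continuous_greenOp (hS : BlockSplitting Φ s Q M C) {H : ℝ → Mat d}
    (hH : Integrable H) : Continuous (greenOp Φ s Q H) := by
  refine (hS.cont.mul (continuous_finsetSum s fun i hi => continuous_finsetSum s fun j hj => ?_)).mul
    hS.cont_inv
  rcases eq_or_ne i j with rfl | hij
  · exact continuous_const.congr fun x => (splitPrimitive_self i _ x).symm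
  · have : splitPrimitive i j (blockPart Φ Q i j H) = fun x =>
        splitPrimitive i j (blockPart Φ Q i j H) 0 + ∫ t in (0 : ℝ)..x, blockPart Φ Q i j H t := by
      ext1 x
      exact splitPrimitive_eq_add hij (hS.splitIntegrable hH hi hj) x
    rw [this]
    exact continuous_const.add (intervalIntegral.continuous_primitive
      (intervalIntegrable_of_locallyIntegrable (hS.locallyIntegrable_blockPart hH i j)) 0)

theorem norm_diagPart_le (hS : BlockSplitting Φ s Q M C) (x : ℝ) (X : Mat d) :
    ‖diagPart Φ s Q x X‖ ≤ s.card * M ^ 2 * ‖X‖ := by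
  calc ‖diagPart Φ s Q x X‖ ≤ ∑ k ∈ s, M * ‖X‖ * M := by
        refine norm_sum_le_of_le _ fun k hk => ?_
        have h1 := hS.conj k hk x
        have h0 : 0 ≤ M := (norm_nonneg _).trans h1
        refine (norm_mul_le _ _).trans ?_
        gcongr
        refine (norm_mul_le _ _).trans ?_
        gcongr
    _ = _ := by simp only [Finset.sum_const, nsmul_eq_mul]; ring

theorem diagPart_sub (x : ℝ) (X Y : Mat d) :
    diagPart Φ s Q x (X - Y) = diagPart Φ s Q x X - diagPart Φ s Q x Y := by
  simp only [diagPart, mul_sub, sub_mul, Finset.sum_sub_distrib]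

/-- The nonlinear source term of the fixed point equation. Subtracting `S diag(R S)` removes the
diagonal blocks of `R S` whenever those of `S` are the identity. -/
noncomputable def source (Φ : ℝ → Mat d) (s : Finset ℕ) (Q : ℕ → Mat d) (R S : ℝ → Mat d)
    (t : ℝ) : Mat d :=
  R t * S t - S t * diagPart Φ s Q t (R t * S t)

theorem norm_source_le (hS : BlockSplitting Φ s Q M C) {R S : ℝ → Mat d} {c : ℝ}
    (hc : ∀ t, ‖S t‖ ≤ c) (t : ℝ) :
    ‖source Φ s Q R S t‖ ≤ (c + s.card * M ^ 2 * c ^ 2) * ‖R t‖ := by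
  have hc0 : 0 ≤ c := (norm_nonneg _).trans (hc t)
  have hM : 0 ≤ s.card * M ^ 2 := by positivity
  have h1 : ‖R t * S t‖ ≤ ‖R t‖ * c := (norm_mul_le _ _).trans (by gcongr; exact hc t)
  calc ‖source Φ s Q R S t‖ ≤ ‖R t * S t‖ + ‖S t‖ * ‖diagPart Φ s Q t (R t * S t)‖ :=
        (norm_sub_le _ _).trans (by gcongr; exact norm_mul_le _ _)
    _ ≤ ‖R t‖ * c + c * (s.card * M ^ 2 * (‖R t‖ * c)) := by
        gcongr
        · exact hc t
        · exact (hS.norm_diagPart_le t _).trans (by gcongr)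
    _ = _ := by ring

theorem norm_source_sub_le (hS : BlockSplitting Φ s Q M C) {R S S' : ℝ → Mat d} {c δ : ℝ}
    (hc : ∀ t, ‖S t‖ ≤ c) (hc' : ∀ t, ‖S' t‖ ≤ c) (hδ : ∀ t, ‖S t - S' t‖ ≤ δ) (t : ℝ) :
    ‖source Φ s Q R S t - source Φ s Q R S' t‖
      ≤ (1 + 2 * (s.card * M ^ 2) * c) * δ * ‖R t‖ := by
  have hc0 : 0 ≤ c := (norm_nonneg _).trans (hc t)
  have hδ0 : 0 ≤ δ := (norm_nonneg _).trans (hδ t)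
  have hM : 0 ≤ s.card * M ^ 2 := by positivity
  have e : source Φ s Q R S t - source Φ s Q R S' t = R t * (S t - S' t)
      - ((S t - S' t) * diagPart Φ s Q t (R t * S t)
        + S' t * diagPart Φ s Q t (R t * (S t - S' t))) := by
    rw [mul_sub (R t), diagPart_sub]
    simp only [source]
    noncomm_ring
  have h1 : ‖R t * S t‖ ≤ ‖R t‖ * c := (norm_mul_le _ _).trans (by gcongr; exact hc t)
  have h2 : ‖R t * (S t - S' t)‖ ≤ ‖R t‖ * δ := (norm_mul_le _ _).trans (by gcongr; exact hδ t)
  rw [e]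
  calc _ ≤ ‖R t * (S t - S' t)‖ + (‖S t - S' t‖ * ‖diagPart Φ s Q t (R t * S t)‖
        + ‖S' t‖ * ‖diagPart Φ s Q t (R t * (S t - S' t))‖) :=
        (norm_sub_le _ _).trans (by
          gcongr
          exact (norm_add_le _ _).trans (add_le_add (norm_mul_le _ _) (norm_mul_le _ _)))
    _ ≤ ‖R t‖ * δ + (δ * (s.card * M ^ 2 * (‖R t‖ * c)) + c * (s.card * M ^ 2 * (‖R t‖ * δ))) := by
        gcongr
        · exact hδ t
        · exact (hS.norm_diagPart_le t _).trans (by gcongr)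
        · exact hc' t
        · exact (hS.norm_diagPart_le t _).trans (by gcongr)
    _ = _ := by ring

theorem integrable_source (hS : BlockSplitting Φ s Q M C) {R S : ℝ → Mat d} (hR : Integrable R)
    (hSc : Continuous S) {c : ℝ} (hc : ∀ t, ‖S t‖ ≤ c) : Integrable (source Φ s Q R S) := by
  refine Integrable.mono' (hR.norm.const_mul _) ?_ (ae_of_all _ (hS.norm_source_le hc))
  have h1 : AEStronglyMeasurable (fun t => R t * S t) volume := hR.1.mul hSc.aestronglyMeasurable
  have h2 : ∀ k, AEStronglyMeasurable (fun t => Φ t * Q k * (Φ t)⁻¹) volume := fun k =>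
    ((hS.cont.mul continuous_const).mul hS.cont_inv).aestronglyMeasurable
  have h3 : AEStronglyMeasurable (fun t => diagPart Φ s Q t (R t * S t)) volume := by
    refine Finset.aestronglyMeasurable_fun_sum s fun k _ => ((h2 k).mul h1).mul (h2 k)
  exact h1.sub (hSc.aestronglyMeasurable.mul h3)

/-- The contraction principle solves `S = 1 + (Green operator)(R S - S diag(R S))` for small
`∫ ‖R‖`. -/
theorem exists_fixedPoint (hS : BlockSplitting Φ s Q M C) :
    ∃ η > 0, ∀ R : ℝ → Mat d, Integrable R → ∫ t, ‖R t‖ ≤ η →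
      ∃ S : ℝ → Mat d, Continuous S ∧ (∀ x, ‖S x - 1‖ ≤ 1 / 2) ∧
        ∀ x, S x = 1 + greenOp Φ s Q (source Φ s Q R S) x := by
  set c : ℝ := ‖(1 : Mat d)‖ + 1 / 2 with hc
  have hc0 : 0 ≤ c := by positivity
  have hM : 0 ≤ s.card * M ^ 2 := by positivity
  set D : ℝ := (s.card : ℝ) ^ 2 * |C| *
    ((c + s.card * M ^ 2 * c ^ 2) + (1 + 2 * (s.card * M ^ 2) * c)) + 1 with hD
  have hD0 : 0 < D := by positivity
  refine ⟨1 / (2 * D), by positivity, fun R hR hη => ?_⟩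
  have hint0 : 0 ≤ ∫ t, ‖R t‖ := integral_nonneg fun _ => norm_nonneg _
  have hsmall : D * ∫ t, ‖R t‖ ≤ 1 / 2 := by
    calc D * ∫ t, ‖R t‖ ≤ D * (1 / (2 * D)) := by gcongr
      _ = 1 / 2 := by field_simp
  let F : BoundedContinuousFunction ℝ (Mat d) → BoundedContinuousFunction ℝ (Mat d) := fun S =>
    BoundedContinuousFunction.ofNormedAddCommGroup
      (fun x => 1 + greenOp Φ s Q (source Φ s Q R S) x)
      (continuous_const.add (hS.continuous_greenOp
        (hS.integrable_source hR S.continuous S.norm_coe_le_norm)))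
      (‖(1 : Mat d)‖ + (s.card : ℝ) ^ 2 * |C| * ∫ t, ‖source Φ s Q R S t‖)
      (fun x => (norm_add_le _ _).trans (by
        gcongr
        exact hS.norm_greenOp_le (hS.integrable_source hR S.continuous S.norm_coe_le_norm) x))
  let one : BoundedContinuousFunction ℝ (Mat d) := BoundedContinuousFunction.const ℝ 1
  set ball := Metric.closedBall one (1 / 2) with hball
  have hmem : ∀ S ∈ ball, ∀ t, ‖S t - 1‖ ≤ 1 / 2 := fun S hSb t => by
    have := BoundedContinuousFunction.dist_coe_le_dist (f := S) (g := one) t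
    rw [dist_eq_norm] at this
    exact this.trans hSb
  have hbd : ∀ S ∈ ball, ∀ t, ‖S t‖ ≤ c := fun S hSb t => by
    calc ‖S t‖ = ‖1 + (S t - 1)‖ := by congr 1; abel
      _ ≤ c := (norm_add_le _ _).trans (by rw [hc]; gcongr; exact hmem S hSb t)
  have hmaps : MapsTo F ball ball := by
    intro S hSb
    rw [hball, Metric.mem_closedBall, BoundedContinuousFunction.dist_le (by norm_num)]
    intro x
    rw [dist_eq_norm]
    change ‖1 + greenOp Φ s Q (source Φ s Q R S) x - 1‖ ≤ 1 / 2
    rw [add_sub_cancel_left]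
    have hi := hS.integrable_source hR S.continuous (hbd S hSb)
    refine (hS.norm_greenOp_le hi x).trans (le_trans ?_ hsmall)
    calc (s.card : ℝ) ^ 2 * |C| * ∫ t, ‖source Φ s Q R S t‖
        ≤ (s.card : ℝ) ^ 2 * |C| * ∫ t, (c + s.card * M ^ 2 * c ^ 2) * ‖R t‖ := by
          refine mul_le_mul_of_nonneg_left ?_ (by positivity)
          exact integral_mono hi.norm (hR.norm.const_mul _) (hS.norm_source_le (hbd S hSb))
      _ = ((s.card : ℝ) ^ 2 * |C| * (c + s.card * M ^ 2 * c ^ 2)) * ∫ t, ‖R t‖ := by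
          rw [integral_const_mul]; ring
      _ ≤ D * ∫ t, ‖R t‖ := by
          gcongr
          rw [hD, mul_add]
          have : 0 ≤ (s.card : ℝ) ^ 2 * |C| * (1 + 2 * (s.card * M ^ 2) * c) := by positivity
          linarith
  have hcontr : ContractingWith (1 / 2) (hmaps.restrict F ball ball) := by
    refine ⟨by norm_num, LipschitzWith.of_dist_le_mul ?_⟩
    rintro ⟨S, hSb⟩ ⟨S', hSb'⟩
    change dist (F S) (F S') ≤ _ * dist S S'
    rw [BoundedContinuousFunction.dist_le (by positivity)]
    intro x
    rw [dist_eq_norm]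
    change ‖1 + greenOp Φ s Q (source Φ s Q R S) x
      - (1 + greenOp Φ s Q (source Φ s Q R S') x)‖ ≤ _
    have hi := hS.integrable_source hR S.continuous (hbd S hSb)
    have hi' := hS.integrable_source hR S'.continuous (hbd S' hSb')
    rw [add_sub_add_left_eq_sub, hS.greenOp_sub hi hi']
    have hδ : ∀ t, ‖S t - S' t‖ ≤ dist S S' := fun t => by
      rw [← dist_eq_norm]; exact BoundedContinuousFunction.dist_coe_le_dist t
    refine (hS.norm_greenOp_le (hi.sub hi') x).trans ?_
    calc (s.card : ℝ) ^ 2 * |C| * ∫ t, ‖source Φ s Q R S t - source Φ s Q R S' t‖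
        ≤ (s.card : ℝ) ^ 2 * |C| * ∫ t, (1 + 2 * (s.card * M ^ 2) * c) * dist S S' * ‖R t‖ := by
          refine mul_le_mul_of_nonneg_left ?_ (by positivity)
          exact integral_mono (hi.sub hi').norm (hR.norm.const_mul _)
            (hS.norm_source_sub_le (hbd S hSb) (hbd S' hSb') hδ)
      _ = ((s.card : ℝ) ^ 2 * |C| * (1 + 2 * (s.card * M ^ 2) * c)) * (∫ t, ‖R t‖)
            * dist S S' := by
          rw [integral_const_mul]; ring
      _ ≤ D * (∫ t, ‖R t‖) * dist S S' := by
          gcongr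
          rw [hD, mul_add]
          have : 0 ≤ (s.card : ℝ) ^ 2 * |C| * (c + s.card * M ^ 2 * c ^ 2) := by positivity
          linarith
      _ ≤ (1 / 2) * dist S S' := by gcongr
      _ = _ := by norm_num
  obtain ⟨S, hSb, hfix, -⟩ := ContractingWith.exists_fixedPoint' (x := one)
    Metric.isClosed_closedBall.isComplete hmaps hcontr
    (Metric.mem_closedBall_self (by norm_num)) (edist_ne_top _ _)
  exact ⟨S, S.continuous, hmem S hSb, fun x => (DFunLike.congr_fun hfix x).symm⟩

theorem sum_sum_mul_mul (hS : BlockSplitting Φ s Q M C) (X : Mat d) :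
    ∑ i ∈ s, ∑ j ∈ s, Q i * X * Q j = X := by
  calc ∑ i ∈ s, ∑ j ∈ s, Q i * X * Q j = (∑ i ∈ s, Q i) * X * ∑ j ∈ s, Q j := by
        simp only [Finset.sum_mul, Finset.mul_sum]
        rw [Finset.sum_comm]
    _ = X := by rw [hS.sum_eq, one_mul, mul_one]

theorem sum_diag_mul (hS : BlockSplitting Φ s Q M C) (X : ℕ → Mat d) {k : ℕ} (hk : k ∈ s) :
    (∑ l ∈ s, Q l * X l * Q l) * Q k = Q k * X k * Q k := by
  rw [Finset.sum_mul, Finset.sum_eq_single k]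
  · rw [mul_assoc, (hS.idem k hk).eq]
  · intro l hl hlk
    rw [mul_assoc, hS.disjoint l hl k hk hlk, mul_zero]
  · exact fun h => absurd hk h

theorem mul_sum_diag (hS : BlockSplitting Φ s Q M C) (X : ℕ → Mat d) {k : ℕ} (hk : k ∈ s) :
    Q k * (∑ l ∈ s, Q l * X l * Q l) = Q k * X k * Q k := by
  rw [Finset.mul_sum, Finset.sum_eq_single k]
  · rw [← mul_assoc, ← mul_assoc, (hS.idem k hk).eq]
  · intro l hl hlk
    rw [← mul_assoc, ← mul_assoc, hS.disjoint k hk l hl hlk.symm, zero_mul, zero_mul]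
  · exact fun h => absurd hk h

/-- The diagonal blocks of a sum of off-diagonal antiderivatives vanish. -/
theorem diag_sum_splitPrimitive (hS : BlockSplitting Φ s Q M C) {H : ℝ → Mat d}
    (hH : Integrable H) {k : ℕ} (hk : k ∈ s) (x : ℝ) :
    Q k * (∑ i ∈ s, ∑ j ∈ s, splitPrimitive i j (blockPart Φ Q i j H) x) * Q k = 0 := by
  simp only [Finset.mul_sum, Finset.sum_mul]
  refine Finset.sum_eq_zero fun i hi => Finset.sum_eq_zero fun j hj => ?_
  rw [← splitPrimitive_mul_mul (hS.splitIntegrable hH hi hj)]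
  rcases eq_or_ne i j with rfl | hij
  · exact splitPrimitive_self _ _ _
  have e : (fun t => Q k * blockPart Φ Q i j H t * Q k) = fun _ => 0 := by
    ext1 t
    simp only [blockPart]
    rcases eq_or_ne k i with rfl | hki
    · rw [mul_assoc, mul_assoc _ (Q j), hS.disjoint j hj k hk hij.symm]
      simp
    · rw [← mul_assoc, ← mul_assoc, hS.disjoint k hk i hi hki]
      simp
  rw [e]
  simp [splitPrimitive]

/-- The coefficient, in the interaction picture, of the block diagonal equation. -/
noncomputable def diagCoeff (Φ : ℝ → Mat d) (s : Finset ℕ) (Q : ℕ → Mat d) (X : ℝ → Mat d)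
    (t : ℝ) : Mat d :=
  ∑ k ∈ s, Q k * ((Φ t)⁻¹ * X t * Φ t) * Q k

theorem conj_diagCoeff (X : ℝ → Mat d) (t : ℝ) :
    Φ t * diagCoeff Φ s Q X t * (Φ t)⁻¹ = diagPart Φ s Q t (X t) := by
  simp only [diagCoeff, diagPart, Finset.mul_sum, Finset.sum_mul]
  refine Finset.sum_congr rfl fun k _ => ?_
  noncomm_ring

theorem commute_diagCoeff (hS : BlockSplitting Φ s Q M C) (X : ℝ → Mat d) (t : ℝ) {k : ℕ}
    (hk : k ∈ s) : Commute (diagCoeff Φ s Q X t) (Q k) :=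
  (hS.sum_diag_mul (fun _ => (Φ t)⁻¹ * X t * Φ t) hk).trans
    (hS.mul_sum_diag (fun _ => (Φ t)⁻¹ * X t * Φ t) hk).symm

theorem locallyIntegrable_diagCoeff (hS : BlockSplitting Φ s Q M C) {X : ℝ → Mat d}
    (hX : Integrable X) : LocallyIntegrable (diagCoeff Φ s Q X) :=
  locallyIntegrable_finsetSum s fun k _ => hS.locallyIntegrable_blockPart hX k k

theorem integrable_conj_diagCoeff (hS : BlockSplitting Φ s Q M C) {X : ℝ → Mat d}
    (hX : Integrable X) : Integrable fun t => ‖Φ t * diagCoeff Φ s Q X t * (Φ t)⁻¹‖ := by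
  refine Integrable.mono' (hX.norm.const_mul (s.card * M ^ 2)) ?_ (ae_of_all _ fun t => ?_)
  · exact ((hS.cont.aestronglyMeasurable.mul
      (hS.locallyIntegrable_diagCoeff hX).aestronglyMeasurable).mul
      hS.cont_inv.aestronglyMeasurable).norm
  · rw [norm_norm, conj_diagCoeff]
    exact hS.norm_diagPart_le t _

/-- A solution of the fixed point equation intertwines, in the interaction picture, the perturbed
equation with its block diagonal part. -/
theorem intertwining (hS : BlockSplitting Φ s Q M C) {R S : ℝ → Mat d}
    (hHi : Integrable (source Φ s Q R S))
    (hSeq : ∀ x, S x = 1 + greenOp Φ s Q (source Φ s Q R S) x) (x : ℝ) :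
    (Φ x)⁻¹ * S x * Φ x = (Φ 0)⁻¹ * S 0 * Φ 0 + ∫ t in (0 : ℝ)..x,
      (((Φ t)⁻¹ * R t * Φ t) * ((Φ t)⁻¹ * S t * Φ t)
        - ((Φ t)⁻¹ * S t * Φ t) * diagCoeff Φ s Q (fun t => R t * S t) t) := by
  set H := source Φ s Q R S with hH
  set B := diagCoeff Φ s Q (fun t => R t * S t) with hB
  set Rt : ℝ → Mat d := fun t => (Φ t)⁻¹ * R t * Φ t with hRt
  set Sg : ℝ → Mat d := fun t => (Φ t)⁻¹ * S t * Φ t with hSg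
  change Sg x = Sg 0 + ∫ t in (0 : ℝ)..x, (Rt t * Sg t - Sg t * B t)
  have hRS : ∀ t, (Φ t)⁻¹ * (R t * S t) * Φ t = Rt t * Sg t := by
    intro t
    calc (Φ t)⁻¹ * (R t * S t) * Φ t = (Φ t)⁻¹ * R t * (Φ t * (Φ t)⁻¹) * S t * Φ t := by
          rw [hS.mul_inv]; noncomm_ring
      _ = _ := by simp only [hRt, hSg]; noncomm_ring
  have hG : ∀ t, (Φ t)⁻¹ * H t * Φ t = Rt t * Sg t - Sg t * B t := by
    intro t
    have e : B t = (Φ t)⁻¹ * diagPart Φ s Q t (R t * S t) * Φ t := by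
      rw [← conj_diagCoeff (fun t => R t * S t)]
      calc B t = ((Φ t)⁻¹ * Φ t) * B t * ((Φ t)⁻¹ * Φ t) := by
            rw [hS.inv_mul, one_mul, mul_one]
        _ = _ := by noncomm_ring
    rw [e, ← hRS]
    calc (Φ t)⁻¹ * H t * Φ t = (Φ t)⁻¹ * (R t * S t) * Φ t
          - (Φ t)⁻¹ * S t * 1 * diagPart Φ s Q t (R t * S t) * Φ t := by
            simp only [hH, source]; noncomm_ring
      _ = _ := by rw [← hS.mul_inv t]; simp only [hSg]; noncomm_ring
  have hSgeq : ∀ x, Sg x = 1 + ∑ i ∈ s, ∑ j ∈ s, splitPrimitive i j (blockPart Φ Q i j H) x := by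
    intro x
    simp only [hSg]
    rw [hSeq x]
    simp only [greenOp]
    set X := ∑ i ∈ s, ∑ j ∈ s, splitPrimitive i j (blockPart Φ Q i j H) x
    calc (Φ x)⁻¹ * (1 + Φ x * X * (Φ x)⁻¹) * Φ x
        = (Φ x)⁻¹ * Φ x + ((Φ x)⁻¹ * Φ x) * X * ((Φ x)⁻¹ * Φ x) := by noncomm_ring
      _ = 1 + X := by rw [hS.inv_mul, one_mul, mul_one]
  have hdiag : ∀ k ∈ s, ∀ x, Q k * Sg x * Q k = Q k := by
    intro k hk x
    rw [hSgeq, mul_add, add_mul, hS.diag_sum_splitPrimitive hHi hk, mul_one, add_zero,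
      (hS.idem k hk).eq]
  -- the diagonal blocks of the source vanish, because those of `Sg` are the identity
  have hblock0 : ∀ k ∈ s, ∀ t, blockPart Φ Q k k H t = 0 := by
    intro k hk t
    have e1 : B t * Q k = Q k * (Rt t * Sg t) * Q k := by
      simp only [hB, diagCoeff, hRS]; exact hS.sum_diag_mul (fun _ => Rt t * Sg t) hk
    have e2 : Q k * (Sg t * B t) * Q k = Q k * (Rt t * Sg t) * Q k := by
      calc Q k * (Sg t * B t) * Q k = Q k * Sg t * (B t * Q k) := by noncomm_ring
        _ = (Q k * Sg t * Q k) * (Rt t * Sg t) * Q k := by rw [e1]; noncomm_ring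
        _ = _ := by rw [hdiag k hk]
    rw [blockPart, hG, mul_sub, sub_mul, e2, sub_self]
  have hi : ∀ i j, IntervalIntegrable (blockPart Φ Q i j H) volume 0 x := fun i j =>
    intervalIntegrable_of_locallyIntegrable (hS.locallyIntegrable_blockPart hHi i j) 0 x
  have e1 : ∀ i ∈ s, ∀ j ∈ s, splitPrimitive i j (blockPart Φ Q i j H) x
      = splitPrimitive i j (blockPart Φ Q i j H) 0
        + ∫ t in (0 : ℝ)..x, blockPart Φ Q i j H t := by
    intro i hi j hj
    rcases eq_or_ne i j with rfl | hij
    · simp [splitPrimitive_self, hblock0 i hi]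
    · exact splitPrimitive_eq_add hij (hS.splitIntegrable hHi hi hj) x
  have e2 : ∑ i ∈ s, ∑ j ∈ s, ∫ t in (0 : ℝ)..x, blockPart Φ Q i j H t
      = ∫ t in (0 : ℝ)..x, (Rt t * Sg t - Sg t * B t) := by
    have : ∀ i ∈ s, ∑ j ∈ s, ∫ t in (0 : ℝ)..x, blockPart Φ Q i j H t
        = ∫ t in (0 : ℝ)..x, ∑ j ∈ s, blockPart Φ Q i j H t := fun i _ =>
      (intervalIntegral.integral_finsetSum fun j _ => hi i j).symm
    rw [Finset.sum_congr rfl this, ← intervalIntegral.integral_finsetSum fun i _ =>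
      intervalIntegrable_of_locallyIntegrable
        (locallyIntegrable_finsetSum s fun j _ => hS.locallyIntegrable_blockPart hHi i j) 0 x]
    refine intervalIntegral.integral_congr fun t _ => ?_
    simp only [← hG]
    exact hS.sum_sum_mul_mul _
  rw [hSgeq x, hSgeq 0, Finset.sum_congr rfl fun i hi => Finset.sum_congr rfl (e1 i hi)]
  simp only [Finset.sum_add_distrib]
  rw [e2, add_assoc]

/-- For a small integrable perturbation the fundamental matrix `Ψ` is, up to a bounded change of
variables `S` close to the identity, that of an equation which preserves the blocks. -/
theorem exists_similarity (hS : BlockSplitting Φ s Q M C) {A : ℝ → Mat d}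
    (hA : LocallyIntegrable A) (hΦ : IsFundamentalMatrix A Φ) :
    ∃ η > 0, ∀ R : ℝ → Mat d, Integrable R → ∫ t, ‖R t‖ ≤ η →
      ∀ Ψ, IsFundamentalMatrix (fun t => A t + R t) Ψ →
      ∃ S B Z : ℝ → Mat d, Continuous S ∧ (∀ x, ‖S x - 1‖ ≤ 1 / 2) ∧
        LocallyIntegrable B ∧ IsFundamentalMatrix B Z ∧
        (Integrable fun t => ‖Φ t * B t * (Φ t)⁻¹‖) ∧ (∀ k ∈ s, ∀ t, Commute (B t) (Q k)) ∧
        ∀ x, Ψ x * S 0 = S x * (Φ x * Z x) := by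
  obtain ⟨η, hη, hfix⟩ := hS.exists_fixedPoint
  refine ⟨η, hη, fun R hR hRη Ψ hΨ => ?_⟩
  obtain ⟨S, hSc, hS1, hSeq⟩ := hfix R hR hRη
  have hbd : ∀ t, ‖S t‖ ≤ ‖(1 : Mat d)‖ + 1 / 2 := fun t => by
    calc ‖S t‖ = ‖1 + (S t - 1)‖ := by congr 1; abel
      _ ≤ _ := (norm_add_le _ _).trans (by gcongr; exact hS1 t)
  have hRl : LocallyIntegrable R := hR.locallyIntegrable
  have hRSi : Integrable fun t => R t * S t :=
    Integrable.mono' (hR.norm.mul_const _) (hR.1.mul hSc.aestronglyMeasurable)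
      (ae_of_all _ fun t => (norm_mul_le _ _).trans (by gcongr; exact hbd t))
  have hprim := hS.intertwining (hS.integrable_source hR hSc hbd) hSeq
  have hBl := hS.locallyIntegrable_diagCoeff hRSi
  have hRtl := hΦ.locallyIntegrable_conj hA hRl
  obtain ⟨Z, hZ⟩ := exists_isFundamentalMatrix hBl
  obtain ⟨V, hV⟩ := exists_isFundamentalMatrix hRtl
  have hΨV : Ψ = fun t => Φ t * V t :=
    hΨ.unique (hA.add hRl) (hΦ.mul_interaction hA hRl hV)
  have hsol : IsSolutionOn (fun t => (Φ t)⁻¹ * R t * Φ t) univ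
      fun x => (Φ x)⁻¹ * S x * Φ x * Z x := by
    have hSgc : Continuous fun t => (Φ t)⁻¹ * S t * Φ t := (hS.cont_inv.mul hSc).mul hS.cont
    refine ⟨(hSgc.mul hZ.continuous).continuousOn, fun x _ => ?_⟩
    have h1 := (locallyIntegrable_mul_continuous hRtl hSgc).sub
      (locallyIntegrable_continuous_mul hBl hSgc)
    have h2 := locallyIntegrable_mul_continuous hBl hZ.continuous
    have h3 := mul_eq_add_integral (intervalIntegrable_of_locallyIntegrable h1 0 x)
      (intervalIntegrable_of_locallyIntegrable h2 0 x)
      (F := fun t => (Φ t)⁻¹ * S t * Φ t) (fun y _ => hprim y) (fun y _ => hZ.2.2 y (mem_univ y))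
    refine h3.trans ?_
    congr 1
    refine intervalIntegral.integral_congr fun t _ => ?_
    simp only [Pi.sub_apply]
    noncomm_ring
  refine ⟨S, _, Z, hSc, hS1, hBl, hZ, hS.integrable_conj_diagCoeff hRSi,
    fun k hk t => hS.commute_diagCoeff _ t hk, fun x => ?_⟩
  have h1 := hV.solution_eq hRtl hsol (fun _ _ => subset_univ _) (mem_univ x)
  have h2 : (Φ 0)⁻¹ * S 0 * Φ 0 * Z 0 = S 0 := by simp [hΦ.1, hZ.1]
  rw [h2] at h1
  rw [hΨV]
  calc Φ x * V x * S 0 = (Φ x * (Φ x)⁻¹) * S x * (Φ x * Z x) := by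
        rw [mul_assoc, ← h1]; noncomm_ring
    _ = _ := by rw [hS.mul_inv, one_mul]

end BlockSplitting

theorem inv_bound_of_norm_sub_one_le {S : Mat d} (h : ‖S - 1‖ ≤ 1 / 2) :
    S⁻¹ * S = 1 ∧ S * S⁻¹ = 1 ∧ ‖S‖ ≤ 2 * ‖(1 : Mat d)‖ + 1 ∧ ‖S⁻¹‖ ≤ 2 * ‖(1 : Mat d)‖ + 1 := by
  have hlt : ‖1 - S‖ < 1 := by rw [norm_sub_rev]; linarith
  have hu : IsUnit S := by
    have := (Units.oneSub (1 - S) hlt).isUnit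
    simpa using this
  have hdet := (Matrix.isUnit_iff_isUnit_det S).mp hu
  have h1 : S⁻¹ * S = 1 := Matrix.nonsing_inv_mul S hdet
  refine ⟨h1, Matrix.mul_nonsing_inv S hdet, ?_, ?_⟩
  · have : ‖S‖ ≤ ‖(1 : Mat d)‖ + ‖S - 1‖ := by
      calc ‖S‖ = ‖1 + (S - 1)‖ := by congr 1; abel
        _ ≤ _ := norm_add_le _ _
    linarith [norm_nonneg (1 : Mat d)]
  · have : ‖S⁻¹‖ ≤ ‖(1 : Mat d)‖ + ‖S⁻¹‖ * ‖S - 1‖ := by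
      calc ‖S⁻¹‖ = ‖1 - S⁻¹ * (S - 1)‖ := by
            congr 1; rw [mul_sub, h1]; simp
        _ ≤ _ := (norm_sub_le _ _).trans (by gcongr; exact norm_mul_le _ _)
    nlinarith [norm_nonneg S⁻¹]

theorem exists_integral_indicator_Ici_le {R : ℝ → Mat d} (hR : Integrable R) {η : ℝ} (hη : 0 < η) :
    ∃ T : ℝ, 0 ≤ T ∧ ∫ t, ‖(Ici T).indicator R t‖ ≤ η := by
  have : Tendsto (fun T : ℝ => ∫ t, ‖(Ici T).indicator R t‖) atTop (nhds (∫ _ : ℝ, (0 : ℝ))) := by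
    refine tendsto_integral_filter_of_dominated_convergence (fun t => ‖R t‖) ?_ ?_ hR.norm ?_
    · exact Eventually.of_forall fun T => ((hR.indicator measurableSet_Ici).norm).1
    · refine Eventually.of_forall fun T => ae_of_all _ fun t => ?_
      rw [norm_norm]
      exact norm_indicator_le_norm_self R t
    · refine ae_of_all _ fun t => tendsto_const_nhds.congr' ?_
      filter_upwards [eventually_gt_atTop t] with T hT
      rw [indicator_of_notMem (by simpa using hT), norm_zero]
  rw [integral_zero] at this
  obtain ⟨T, hT, hT0⟩ := ((this.eventually (ge_mem_nhds hη)).and (eventually_ge_atTop 0)).exists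
  exact ⟨T, hT0, hT⟩

/-- On `[0, ∞)` smallness is not needed: the perturbation is small near infinity, and a compact
interval does not affect boundedness. -/
theorem BlockSplitting.exists_similarity_halfLine {A R Φ Ψ : ℝ → Mat d} {s : Finset ℕ}
    {Q : ℕ → Mat d} {M C : ℝ} (hS : BlockSplitting Φ s Q M C)
    (hA : LocallyIntegrable A) (hΦ : IsFundamentalMatrix A Φ) (hR : Integrable R)
    (hΨ : IsFundamentalMatrix (fun t => A t + R t) Ψ) :
    ∃ (L B Z : ℝ → Mat d) (K : ℝ), (∀ x, (L x)⁻¹ * L x = 1) ∧ (∀ x, L x * (L x)⁻¹ = 1) ∧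
      (∀ x ∈ Ici (0 : ℝ), ‖L x‖ ≤ K) ∧ (∀ x ∈ Ici (0 : ℝ), ‖(L x)⁻¹‖ ≤ K) ∧
      LocallyIntegrable B ∧ IsFundamentalMatrix B Z ∧
      (Integrable fun t => ‖Φ t * B t * (Φ t)⁻¹‖) ∧ (∀ k ∈ s, ∀ t, Commute (B t) (Q k)) ∧
      ∀ x, Ψ x = L x * (Φ x * Z x) * (L 0)⁻¹ := by
  obtain ⟨η, hη, hsim⟩ := hS.exists_similarity hA hΦ
  obtain ⟨T, hT0, hTη⟩ := exists_integral_indicator_Ici_le hR hη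
  set RT := (Ici T).indicator R with hRT
  have hRTi : Integrable RT := hR.indicator measurableSet_Ici
  have hRl := hR.locallyIntegrable
  have hART : LocallyIntegrable fun t => A t + RT t := hA.add hRTi.locallyIntegrable
  have hAR : LocallyIntegrable fun t => A t + R t := hA.add hRl
  obtain ⟨ΨT, hΨT⟩ := exists_isFundamentalMatrix hART
  obtain ⟨S, B, Z, hSc, hS1, hBl, hZ, hBi, hcomm, hrel⟩ := hsim RT hRTi hTη ΨT hΨT
  -- beyond `T` the truncated and the full equation have the same solutions
  obtain ⟨N, hN⟩ : ∃ N : Mat d, ∀ x, T ≤ x → (ΨT x)⁻¹ * Ψ x = N := by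
    refine ⟨1 - ∫ t in (0 : ℝ)..T, (ΨT t)⁻¹ * (RT t - R t) * Ψ t, fun x hx => ?_⟩
    have hRd : LocallyIntegrable fun t => RT t - R t := hRTi.locallyIntegrable.sub hRl
    have h' : IsFundamentalMatrix (fun t => (A t + R t) + (RT t - R t)) ΨT := by
      convert hΨT using 2; abel
    rw [hΨ.inv_mul_eq hAR hRd h' x]
    have hi : LocallyIntegrable fun t => (ΨT t)⁻¹ * (RT t - R t) * Ψ t :=
      locallyIntegrable_mul_continuous (locallyIntegrable_continuous_mul hRd
        (hΨT.continuous_inv hART)) hΨ.continuous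
    rw [← intervalIntegral.integral_add_adjacent_intervals
      (intervalIntegrable_of_locallyIntegrable hi 0 T)
      (intervalIntegrable_of_locallyIntegrable hi T x)]
    have : ∫ t in T..x, (ΨT t)⁻¹ * (RT t - R t) * Ψ t = ∫ t in T..x, (0 : Mat d) := by
      refine intervalIntegral.integral_congr fun t ht => ?_
      rw [uIcc_of_le hx] at ht
      simp [hRT, indicator_of_mem (show t ∈ Ici T from ht.1)]
    rw [this]; simp
  have hNi : N * N⁻¹ = 1 := by
    rw [← hN T le_rfl, Matrix.mul_inv_rev]
    have e1 := hΨ.mul_inv hAR T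
    have e2 := hΨT.inv_mul hART T
    have e3 : ((ΨT T)⁻¹)⁻¹ = ΨT T := Matrix.inv_eq_left_inv (hΨT.mul_inv hART T)
    rw [e3, mul_assoc, ← mul_assoc (Ψ T), e1, one_mul, e2]
  have hNi' : N⁻¹ * N = 1 := mul_eq_one_comm.mp hNi
  have hΘ : ∀ x, (Φ x * Z x) * ((Z x)⁻¹ * (Φ x)⁻¹) = 1 := fun x => by
    rw [mul_assoc, ← mul_assoc (Z x), hZ.mul_inv hBl, one_mul, hS.mul_inv]
  set L : ℝ → Mat d := fun x => Ψ x * (N⁻¹ * S 0) * ((Z x)⁻¹ * (Φ x)⁻¹) with hL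
  set L' : ℝ → Mat d := fun x => (Φ x * Z x) * ((S 0)⁻¹ * N) * (Ψ x)⁻¹ with hL'
  obtain ⟨s1, s2, -, -⟩ := inv_bound_of_norm_sub_one_le (hS1 0)
  have hLL' : ∀ x, L x * L' x = 1 := fun x => by
    calc L x * L' x = Ψ x * N⁻¹ * S 0 * ((Z x)⁻¹ * ((Φ x)⁻¹ * Φ x) * Z x) * (S 0)⁻¹ * N * (Ψ x)⁻¹ := by
          simp only [hL, hL']; noncomm_ring
      _ = Ψ x * N⁻¹ * (S 0 * (S 0)⁻¹) * N * (Ψ x)⁻¹ := by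
          rw [hS.inv_mul, mul_one, hZ.inv_mul hBl]; noncomm_ring
      _ = Ψ x * (N⁻¹ * N) * (Ψ x)⁻¹ := by rw [s2]; noncomm_ring
      _ = 1 := by rw [hNi', mul_one, hΨ.mul_inv hAR]
  have hinv : ∀ x, (L x)⁻¹ = L' x := fun x => Matrix.inv_eq_right_inv (hLL' x)
  have hLc : Continuous L := (hΨ.continuous.mul continuous_const).mul
    ((hZ.continuous_inv hBl).mul hS.cont_inv)
  have hLc' : Continuous L' := ((hS.cont.mul hZ.continuous).mul continuous_const).mul
    (hΨ.continuous_inv hAR)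
  have hLS : ∀ x, T ≤ x → L x = S x := fun x hx => by
    have e1 : Ψ x = ΨT x * N := by
      rw [← hN x hx, ← mul_assoc, hΨT.mul_inv hART, one_mul]
    calc L x = ΨT x * (N * N⁻¹) * S 0 * ((Z x)⁻¹ * (Φ x)⁻¹) := by
          simp only [hL]; rw [e1]; noncomm_ring
      _ = (ΨT x * S 0) * ((Z x)⁻¹ * (Φ x)⁻¹) := by rw [hNi, mul_one]
      _ = S x * ((Φ x * Z x) * ((Z x)⁻¹ * (Φ x)⁻¹)) := by rw [hrel, mul_assoc]
      _ = S x := by rw [hΘ, mul_one]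
  obtain ⟨K₁, hK₁⟩ := (isCompact_Icc (a := (0 : ℝ)) (b := T)).exists_bound_of_continuousOn
    hLc.continuousOn
  obtain ⟨K₂, hK₂⟩ := (isCompact_Icc (a := (0 : ℝ)) (b := T)).exists_bound_of_continuousOn
    hLc'.continuousOn
  refine ⟨L, B, Z, max (max K₁ K₂) (2 * ‖(1 : Mat d)‖ + 1), fun x => ?_, fun x => ?_,
    fun x hx => ?_, fun x hx => ?_, hBl, hZ, hBi, hcomm, fun x => ?_⟩
  · rw [hinv]; exact mul_eq_one_comm.mp (hLL' x)
  · rw [hinv, hLL']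
  · rcases le_total x T with h | h
    · exact (hK₁ x ⟨hx, h⟩).trans ((le_max_left _ _).trans (le_max_left _ _))
    · rw [hLS x h]
      exact (inv_bound_of_norm_sub_one_le (hS1 x)).2.2.1.trans (le_max_right _ _)
  · rcases le_total x T with h | h
    · rw [hinv]
      exact (hK₂ x ⟨hx, h⟩).trans ((le_max_right _ _).trans (le_max_left _ _))
    · rw [hLS x h]
      exact (inv_bound_of_norm_sub_one_le (hS1 x)).2.2.2.trans (le_max_right _ _)
  · have e1 : (Z x)⁻¹ * (Φ x)⁻¹ * (Φ x * Z x) = 1 := mul_eq_one_comm.mp (hΘ x)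
    have e0 : L' 0 = (S 0)⁻¹ * N := by
      simp [hL', hΦ.1, hZ.1, hΨ.1]
    rw [hinv, e0]
    calc Ψ x = Ψ x * (N⁻¹ * N) := by rw [hNi', mul_one]
      _ = Ψ x * N⁻¹ * (S 0 * (S 0)⁻¹) * N := by rw [s2]; noncomm_ring
      _ = Ψ x * (N⁻¹ * S 0) * 1 * ((S 0)⁻¹ * N) := by noncomm_ring
      _ = _ := by rw [← e1]; simp only [hL]; noncomm_ring

/-! ### Perturbed splittings on the half-line -/

/-- The part of `IsPerturbedSplitting` that concerns the half-line `[0, ∞)`. -/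
structure IsHalfLineSplitting (Φ Ψ : ℝ → Mat d) (k₀ : ℕ) (Q P : ℕ → Mat d) : Prop where
  idem : ∀ j ∈ Finset.Icc 1 k₀, IsIdempotentElem (P j)
  disjoint : ∀ i ∈ Finset.Icc 1 k₀, ∀ j ∈ Finset.Icc 1 k₀, i ≠ j → P i * P j = 0
  dichotomy : IsExpDichotomy Ψ (Ici 0) (∑ j ∈ Finset.Icc 1 k₀, P j)
  conj : ∀ j ∈ Finset.Icc 1 k₀, UniformlyConjugated Ψ (Ici 0) (P j)
  lower : ∀ j ∈ Finset.Icc 1 k₀, lowerBohl Ψ (Ici 0) (P j) = lowerBohl Φ (Ici 0) (Q j)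
  upper : ∀ j ∈ Finset.Icc 1 k₀, upperBohl Ψ (Ici 0) (P j) = upperBohl Φ (Ici 0) (Q j)

theorem isExpDichotomy_iff {Φ : ℝ → Mat d} {J : Set ℝ} {Q : Mat d} :
    IsExpDichotomy Φ J Q ↔ IsIdempotentElem Q ∧ (∃ κ > 0, HasUpperRate Φ J Q (-κ)) ∧
      ∃ κ > 0, HasLowerRate Φ J (1 - Q) κ := by
  constructor
  · rintro ⟨h, κ, κ', C, C', hκ, hκ', hC, hC', h1, h2⟩
    exact ⟨h, ⟨κ, hκ, C, hC, h1⟩, κ', hκ', C', hC', h2⟩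
  · rintro ⟨h, ⟨κ, hκ, C, hC, h1⟩, κ', hκ', C', hC', h2⟩
    exact ⟨h, κ, κ', C, C', hκ, hκ', hC, hC', h1, h2⟩

theorem IsExpDichotomy.subset {Φ : ℝ → Mat d} {J J' : Set ℝ} {Q : Mat d}
    (h : IsExpDichotomy Φ J Q) (hJ : J' ⊆ J) : IsExpDichotomy Φ J' Q := by
  rw [isExpDichotomy_iff] at h ⊢
  obtain ⟨h0, ⟨κ, hκ, h1⟩, κ', hκ', h2⟩ := h
  exact ⟨h0, ⟨κ, hκ, h1.subset hJ⟩, κ', hκ', h2.subset hJ⟩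

section Conjugation

variable {Θ Ψ L L' : ℝ → Mat d} {J : Set ℝ} {P Q : Mat d} {K κ : ℝ}

theorem norm_conj_le (hL : ∀ x ∈ J, ‖L x‖ ≤ K) (hL' : ∀ x ∈ J, ‖L' x‖ ≤ K)
    (hrel : ∀ x x', Ψ x * P * (Ψ x')⁻¹ = L x * (Θ x * Q * (Θ x')⁻¹) * L' x') {x x' : ℝ}
    (hx : x ∈ J) (hx' : x' ∈ J) :
    ‖Ψ x * P * (Ψ x')⁻¹‖ ≤ K ^ 2 * ‖Θ x * Q * (Θ x')⁻¹‖ := by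
  have hK : 0 ≤ K := (norm_nonneg _).trans (hL x hx)
  rw [hrel]
  calc _ ≤ ‖L x‖ * ‖Θ x * Q * (Θ x')⁻¹‖ * ‖L' x'‖ :=
        (norm_mul_le _ _).trans (by gcongr; exact norm_mul_le _ _)
    _ ≤ K * ‖Θ x * Q * (Θ x')⁻¹‖ * K := by
        gcongr
        exacts [hL x hx, hL' x' hx']
    _ = _ := by ring

theorem HasUpperRate.of_conj (h : HasUpperRate Θ J Q κ)
    (hL : ∀ x ∈ J, ‖L x‖ ≤ K) (hL' : ∀ x ∈ J, ‖L' x‖ ≤ K)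
    (hrel : ∀ x x', Ψ x * P * (Ψ x')⁻¹ = L x * (Θ x * Q * (Θ x')⁻¹) * L' x') :
    HasUpperRate Ψ J P κ := by
  obtain ⟨C, -, h⟩ := h
  refine hasUpperRate_of_le (K ^ 2 * C) fun x hx x' hx' hle => ?_
  refine (norm_conj_le hL hL' hrel hx hx').trans ?_
  rw [mul_assoc (K ^ 2)]
  gcongr
  exact h x hx x' hx' hle

theorem HasLowerRate.of_conj (h : HasLowerRate Θ J Q κ)
    (hL : ∀ x ∈ J, ‖L x‖ ≤ K) (hL' : ∀ x ∈ J, ‖L' x‖ ≤ K)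
    (hrel : ∀ x x', Ψ x * P * (Ψ x')⁻¹ = L x * (Θ x * Q * (Θ x')⁻¹) * L' x') :
    HasLowerRate Ψ J P κ := by
  obtain ⟨C, -, h⟩ := h
  refine hasLowerRate_of_le (K ^ 2 * C) fun x hx x' hx' hle => ?_
  refine (norm_conj_le hL hL' hrel hx hx').trans ?_
  rw [mul_assoc (K ^ 2)]
  gcongr
  exact h x hx x' hx' hle

end Conjugation

namespace IsOrderedSplitting

variable {Φ : ℝ → Mat d} {k₀ d' : ℕ} {Q₀ : Mat d} {Q : ℕ → Mat d}

theorem upper_lt_lower (h : IsOrderedSplitting Φ k₀ d' Q₀ Q) {i j : ℕ} (hi : 1 ≤ i) (hij : i < j)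
    (hj : j ≤ d') : upperBohl Φ univ (Q i) < lowerBohl Φ univ (Q j) := by
  induction j, hij using Nat.le_induction with
  | base => exact h.ordered i hi (by omega)
  | succ j hj' ih =>
    exact (ih (by omega)).trans ((h.segment j (by simp; omega)).trans_lt
      (h.ordered j (by omega) (by omega)))

theorem sum_eq_one (h : IsOrderedSplitting Φ k₀ d' Q₀ Q) (hk : k₀ ≤ d') :
    ∑ j ∈ Finset.Icc 1 d', Q j = 1 := by
  have e : Finset.Icc 1 d' = Finset.Icc 1 k₀ ∪ Finset.Icc (k₀ + 1) d' := by
    ext j; simp; omega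
  have hd : Disjoint (Finset.Icc 1 k₀) (Finset.Icc (k₀ + 1) d') := by
    rw [Finset.disjoint_left]; intro j; simp; omega
  rw [e, Finset.sum_union hd, ← h.sum_low, ← h.sum_high]
  abel

theorem exists_blockSplitting (h : IsOrderedSplitting Φ k₀ d' Q₀ Q) (hk : k₀ ≤ d')
    {A : ℝ → Mat d} (hA : LocallyIntegrable A) (hΦ : IsFundamentalMatrix A Φ) :
    ∃ M C, BlockSplitting Φ (Finset.Icc 1 d') Q M C := by
  have h1 : ∀ j, ∃ m : ℝ, j ∈ Finset.Icc 1 d' → ∀ x, ‖Φ x * Q j * (Φ x)⁻¹‖ ≤ m := fun j => by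
    by_cases hj : j ∈ Finset.Icc 1 d'
    · obtain ⟨m, hm⟩ := h.conj j hj
      exact ⟨m, fun _ x => hm x (mem_univ x)⟩
    · exact ⟨0, fun hj' => absurd hj' hj⟩
  have h2 : ∀ i j, ∃ c : ℝ, i ∈ Finset.Icc 1 d' → j ∈ Finset.Icc 1 d' → i < j → ∀ x t, t ≤ x →
      ‖Φ x * Q i * (Φ t)⁻¹‖ * ‖Φ t * Q j * (Φ x)⁻¹‖ ≤ c := fun i j => by
    by_cases hij : i ∈ Finset.Icc 1 d' ∧ j ∈ Finset.Icc 1 d' ∧ i < j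
    · obtain ⟨hi, hj, hij⟩ := hij
      rw [Finset.mem_Icc] at hi hj
      obtain ⟨κ, hκ1, hκ2⟩ := EReal.lt_iff_exists_real_btwn.mp
        (h.upper_lt_lower hi.1 hij hj.2)
      obtain ⟨C₁, hC₁, hu⟩ := hasUpperRate_of_lt hκ1
      obtain ⟨C₂, hC₂, hl⟩ := hasLowerRate_of_lt hκ2
      refine ⟨C₁ * C₂, fun _ _ _ x t ht => ?_⟩
      calc _ ≤ (C₁ * Real.exp (κ * (x - t))) * (C₂ * Real.exp (κ * (t - x))) :=
            mul_le_mul (hu x (mem_univ _) t (mem_univ _) ht) (hl t (mem_univ _) x (mem_univ _) ht)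
              (norm_nonneg _) (by positivity)
        _ = C₁ * C₂ * (Real.exp (κ * (x - t)) * Real.exp (κ * (t - x))) := by ring
        _ = C₁ * C₂ := by rw [← Real.exp_add]; ring_nf; simp
    · exact ⟨0, fun hi hj hlt => absurd ⟨hi, hj, hlt⟩ hij⟩
  choose m hm using h1
  choose c hc using h2
  refine ⟨∑ j ∈ Finset.Icc 1 d', |m j|,
    ∑ i ∈ Finset.Icc 1 d', ∑ j ∈ Finset.Icc 1 d', |c i j|,
    { cont := hΦ.continuous
      cont_inv := hΦ.continuous_inv hA
      inv_mul := hΦ.inv_mul hA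
      mul_inv := hΦ.mul_inv hA
      sum_eq := h.sum_eq_one hk
      idem := h.idem
      disjoint := h.disjoint
      conj := fun j hj x => (hm j hj x).trans ((le_abs_self _).trans
        (Finset.single_le_sum (f := fun j => |m j|) (fun _ _ => abs_nonneg _) hj))
      kernel := fun i hi j hj hij x t ht => (hc i j hi hj hij x t ht).trans
        ((le_abs_self _).trans
          ((Finset.single_le_sum (f := fun j => |c i j|) (fun _ _ => abs_nonneg _) hj).trans
            (Finset.single_le_sum (f := fun i => ∑ j ∈ Finset.Icc 1 d', |c i j|)
              (fun _ _ => Finset.sum_nonneg fun _ _ => abs_nonneg _) hi))) }⟩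

/-- The perturbed splitting consists of the conjugates `L 0 * Q j * (L 0)⁻¹`. -/
theorem exists_halfLineSplitting (h : IsOrderedSplitting Φ k₀ d' Q₀ Q) (hk : k₀ ≤ d')
    {A R Ψ : ℝ → Mat d} (hA : LocallyIntegrable A) (hΦ : IsFundamentalMatrix A Φ)
    (hR : Integrable R) (hΨ : IsFundamentalMatrix (fun t => A t + R t) Ψ) :
    ∃ P, IsHalfLineSplitting Φ Ψ k₀ Q P := by
  obtain ⟨M, C, hS⟩ := h.exists_blockSplitting hk hA hΦ
  obtain ⟨L, B, Z, K, hL1, hL2, hLK, hLK', hBl, hZ, hBi, hcomm, hrel⟩ :=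
    hS.exists_similarity_halfLine hA hΦ hR hΨ
  set G := L 0 with hG
  have hGG : (G⁻¹)⁻¹ = G := Matrix.inv_eq_left_inv (hL2 0)
  have hsub : ∀ j ∈ Finset.Icc 1 k₀, j ∈ Finset.Icc 1 d' := fun j hj => by
    simp only [Finset.mem_Icc] at hj ⊢; omega
  have hΨi : ∀ x, (Ψ x)⁻¹ = G * (Φ x * Z x)⁻¹ * (L x)⁻¹ := fun x => by
    rw [hrel, Matrix.mul_inv_rev, Matrix.mul_inv_rev, hGG, ← mul_assoc]
  have hr1 : ∀ N x x', Ψ x * (G * N * G⁻¹) * (Ψ x')⁻¹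
      = L x * ((Φ x * Z x) * N * (Φ x' * Z x')⁻¹) * (L x')⁻¹ := by
    intro N x x'
    rw [hΨi, hrel]
    calc L x * (Φ x * Z x) * G⁻¹ * (G * N * G⁻¹) * (G * (Φ x' * Z x')⁻¹ * (L x')⁻¹)
        = L x * (Φ x * Z x) * (G⁻¹ * G) * N * (G⁻¹ * G) * (Φ x' * Z x')⁻¹ * (L x')⁻¹ := by
          noncomm_ring
      _ = _ := by rw [hL1]; noncomm_ring
  have hr2 : ∀ N x x', (Φ x * Z x) * N * (Φ x' * Z x')⁻¹
      = (L x)⁻¹ * (Ψ x * (G * N * G⁻¹) * (Ψ x')⁻¹) * L x' := by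
    intro N x x'
    rw [hr1]
    calc _ = 1 * ((Φ x * Z x) * N * (Φ x' * Z x')⁻¹) * 1 := by rw [one_mul, mul_one]
      _ = ((L x)⁻¹ * L x) * ((Φ x * Z x) * N * (Φ x' * Z x')⁻¹) * ((L x')⁻¹ * L x') := by
          rw [hL1, hL1]
      _ = _ := by noncomm_ring
  have hupper : ∀ {N κ}, IsIdempotentElem N → (∀ t, Commute (B t) N) →
      (HasUpperRate Ψ (Ici 0) (G * N * G⁻¹) κ ↔ HasUpperRate Φ (Ici 0) N κ) := by
    intro N κ hN hNc
    rw [← hasUpperRate_interaction_iff hS.cont hS.inv_mul hBl hZ hBi hN hNc ordConnected_Ici]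
    exact ⟨fun h => h.of_conj hLK' hLK (hr2 N), fun h => h.of_conj hLK hLK' (hr1 N)⟩
  have hlower : ∀ {N κ}, IsIdempotentElem N → (∀ t, Commute (B t) N) →
      (HasLowerRate Ψ (Ici 0) (G * N * G⁻¹) κ ↔ HasLowerRate Φ (Ici 0) N κ) := by
    intro N κ hN hNc
    rw [← hasLowerRate_interaction_iff hS.cont hS.inv_mul hBl hZ hBi hN hNc ordConnected_Ici]
    exact ⟨fun h => h.of_conj hLK' hLK (hr2 N), fun h => h.of_conj hLK hLK' (hr1 N)⟩
  have hmul : ∀ N N', (G * N * G⁻¹) * (G * N' * G⁻¹) = G * (N * N') * G⁻¹ := by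
    intro N N'
    calc _ = G * N * (G⁻¹ * G) * N' * G⁻¹ := by noncomm_ring
      _ = _ := by rw [hL1]; noncomm_ring
  have hQ0c : ∀ t, Commute (B t) Q₀ := fun t => by
    rw [h.sum_low]
    exact Commute.sum_right _ _ _ fun j hj => hcomm j (hsub j hj) t
  have hsum : ∑ j ∈ Finset.Icc 1 k₀, G * Q j * G⁻¹ = G * Q₀ * G⁻¹ := by
    rw [← Finset.sum_mul, ← Finset.mul_sum, ← h.sum_low]
  have hone : 1 - G * Q₀ * G⁻¹ = G * (1 - Q₀) * G⁻¹ := by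
    rw [mul_sub, sub_mul, mul_one, hL2]
  refine ⟨fun j => G * Q j * G⁻¹, fun j hj => ?_, fun i hi j hj hij => ?_, ?_, fun j hj => ?_,
    fun j hj => ?_, fun j hj => ?_⟩
  · have : G * Q j * G⁻¹ * (G * Q j * G⁻¹) = G * Q j * G⁻¹ := by
      rw [hmul, (h.idem j (hsub j hj)).eq]
    exact this
  · rw [hmul, h.disjoint i (hsub i hi) j (hsub j hj) hij, mul_zero, zero_mul]
  · obtain ⟨hi, ⟨κ, hκ, hu⟩, κ', hκ', hl⟩ := isExpDichotomy_iff.mp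
      (h.dichotomy.subset (subset_univ (Ici 0)))
    rw [hsum, isExpDichotomy_iff, hone]
    refine ⟨?_, ⟨κ, hκ, (hupper hi hQ0c).mpr hu⟩, κ', hκ', (hlower hi.one_sub fun t =>
      (Commute.one_right _).sub_right (hQ0c t)).mpr hl⟩
    have : G * Q₀ * G⁻¹ * (G * Q₀ * G⁻¹) = G * Q₀ * G⁻¹ := by rw [hmul, hi.eq]
    exact this
  · refine ⟨K ^ 2 * M, fun x hx => (norm_conj_le hLK hLK' (hr1 (Q j)) hx hx).trans ?_⟩
    have hZQ := hZ.commute hBl (hcomm j (hsub j hj)) x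
    have : Φ x * Z x * Q j * (Φ x * Z x)⁻¹ = Φ x * Q j * (Φ x)⁻¹ := by
      rw [Matrix.mul_inv_rev]
      calc _ = Φ x * (Z x * Q j) * (Z x)⁻¹ * (Φ x)⁻¹ := by noncomm_ring
        _ = Φ x * Q j * (Z x * (Z x)⁻¹) * (Φ x)⁻¹ := by rw [hZQ.eq]; noncomm_ring
        _ = _ := by rw [hZ.mul_inv hBl, mul_one]
    rw [this]
    exact mul_le_mul_of_nonneg_left (hS.conj j (hsub j hj) x) (sq_nonneg K)
  · have hj' := hsub j hj
    exact le_antisymm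
      (lowerBohl_le_lowerBohl fun κ => (hlower (h.idem j hj') (hcomm j hj')).mp)
      (lowerBohl_le_lowerBohl fun κ => (hlower (h.idem j hj') (hcomm j hj')).mpr)
  · have hj' := hsub j hj
    exact le_antisymm
      (upperBohl_le_upperBohl fun κ => (hupper (h.idem j hj') (hcomm j hj')).mpr)
      (upperBohl_le_upperBohl fun κ => (hupper (h.idem j hj') (hcomm j hj')).mp)

end IsOrderedSplitting

/-! ### Exponential bounds and Lyapunov exponents -/

theorem logNorm_lt_coe_iff {M : Mat d} {y : ℝ} : logNorm M < y ↔ ‖M‖ < Real.exp y := by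
  rw [logNorm, ← EReal.log_exp (y : EReal), ENNReal.log_lt_log_iff, EReal.exp_coe,
    ← ofReal_norm, ENNReal.ofReal_lt_ofReal_iff (Real.exp_pos y)]

theorem logNorm_le_coe_iff {M : Mat d} {y : ℝ} : logNorm M ≤ y ↔ ‖M‖ ≤ Real.exp y := by
  rw [logNorm, ← EReal.log_exp (y : EReal), ENNReal.log_le_log_iff, EReal.exp_coe,
    ← ofReal_norm, ENNReal.ofReal_le_ofReal_iff (Real.exp_pos y).le]

theorem exists_bound_of_limsup_lt {F : ℝ → Mat d} {γ : ℝ} (hF : ContinuousOn F (Ici 0))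
    (h : limsup (fun x : ℝ => logNorm (F x) / (x : EReal)) atTop < γ) :
    ∃ C : ℝ, ∀ x, 0 ≤ x → ‖F x‖ ≤ C * Real.exp (γ * x) := by
  obtain ⟨X, hX⟩ := eventually_atTop.mp
    ((eventually_lt_of_limsup_lt h).and (eventually_gt_atTop (0 : ℝ)))
  have hlarge : ∀ x, X ≤ x → ‖F x‖ ≤ Real.exp (γ * x) := fun x hx => by
    obtain ⟨h1, h2⟩ := hX x hx
    rw [EReal.div_lt_iff (EReal.coe_pos.mpr h2) (EReal.coe_ne_top x), ← EReal.coe_mul,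
      logNorm_lt_coe_iff] at h1
    exact h1.le
  have hc : ContinuousOn (fun x => ‖F x‖ * Real.exp (-(γ * x))) (Icc 0 X) :=
    ((hF.mono Icc_subset_Ici_self).norm).mul (by fun_prop)
  obtain ⟨K, hK⟩ := isCompact_Icc.exists_bound_of_continuousOn hc
  refine ⟨max K 1, fun x hx => ?_⟩
  have hexp := Real.exp_pos (γ * x)
  rcases le_total x X with hle | hle
  · have h1 := (le_abs_self _).trans (hK x ⟨hx, hle⟩)
    calc ‖F x‖ = ‖F x‖ * Real.exp (-(γ * x)) * Real.exp (γ * x) := by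
          rw [mul_assoc, ← Real.exp_add]; simp
      _ ≤ max K 1 * Real.exp (γ * x) := by
          gcongr
          exact h1.trans (le_max_left _ _)
  · refine (hlarge x hle).trans ?_
    exact le_mul_of_one_le_left hexp.le (le_max_right _ _)

theorem limsup_le_of_bound {F : ℝ → Mat d} {γ γ' C : ℝ} (hγ : γ < γ')
    (h : ∀ x, 0 ≤ x → ‖F x‖ ≤ C * Real.exp (γ * x)) :
    limsup (fun x : ℝ => logNorm (F x) / (x : EReal)) atTop ≤ γ' := by
  have hlim : Tendsto (fun x : ℝ => Real.exp ((γ' - γ) * x)) atTop atTop :=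
    Real.tendsto_exp_atTop.comp (tendsto_id.const_mul_atTop (sub_pos.mpr hγ))
  refine limsup_le_of_le (by isBoundedDefault) ?_
  filter_upwards [hlim.eventually_ge_atTop C, eventually_gt_atTop (0 : ℝ)] with x hx hx0
  rw [EReal.div_le_iff_le_mul (EReal.coe_pos.mpr hx0) (EReal.coe_ne_top x), ← EReal.coe_mul,
    logNorm_le_coe_iff]
  calc ‖F x‖ ≤ C * Real.exp (γ * x) := h x hx0.le
    _ ≤ Real.exp ((γ' - γ) * x) * Real.exp (γ * x) := by gcongr
    _ = Real.exp (x * γ') := by rw [← Real.exp_add]; ring_nf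

/-- Vectors in the range of `P` that are not annihilated grow at least at the lower rate. -/
theorem HasLowerRate.mul_eq_zero {Φ : ℝ → Mat d} {P V : Mat d} {κ γ C : ℝ}
    (h : HasLowerRate Φ (Ici 0) P κ) (h0 : Φ 0 = 1) (hinv : ∀ x, (Φ x)⁻¹ * Φ x = 1)
    (hγ : γ < κ) (hV : ∀ x, 0 ≤ x → ‖Φ x * V‖ ≤ C * Real.exp (γ * x)) : P * V = 0 := by
  obtain ⟨C', hC', h⟩ := h
  have hb : ∀ x, 0 ≤ x → ‖P * V‖ ≤ C' * C * Real.exp (-((κ - γ) * x)) := fun x hx => by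
    calc ‖P * V‖ = ‖(Φ 0 * P * (Φ x)⁻¹) * (Φ x * V)‖ := by
          rw [h0, one_mul, mul_assoc, ← mul_assoc (Φ x)⁻¹, hinv, one_mul]
      _ ≤ (C' * Real.exp (κ * (0 - x))) * (C * Real.exp (γ * x)) :=
          (norm_mul_le _ _).trans (mul_le_mul (h 0 self_mem_Ici x hx hx) (hV x hx)
            (norm_nonneg _) (by positivity))
      _ = C' * C * (Real.exp (κ * (0 - x)) * Real.exp (γ * x)) := by ring
      _ = _ := by rw [← Real.exp_add]; ring_nf
  have hlim : Tendsto (fun x : ℝ => C' * C * Real.exp (-((κ - γ) * x))) atTop (nhds 0) := by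
    have : Tendsto (fun x : ℝ => Real.exp (-((κ - γ) * x))) atTop (nhds 0) :=
      Real.tendsto_exp_neg_atTop_nhds_zero.comp
        (tendsto_id.const_mul_atTop (sub_pos.mpr hγ))
    simpa using this.const_mul (C' * C)
  have : ‖P * V‖ ≤ 0 := ge_of_tendsto hlim (by
    filter_upwards [eventually_ge_atTop (0 : ℝ)] with x hx using hb x hx)
  exact norm_le_zero_iff.mp this

theorem HasUpperRate.exists_bound {Φ : ℝ → Mat d} {P : Mat d} {κ : ℝ}
    (h : HasUpperRate Φ (Ici 0) P κ) (h0 : Φ 0 = 1) :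
    ∃ C, 0 ≤ C ∧ ∀ x, 0 ≤ x → ‖Φ x * P‖ ≤ C * Real.exp (κ * x) := by
  obtain ⟨C, hC, h⟩ := h
  refine ⟨C, by linarith, fun x hx => ?_⟩
  simpa [h0] using h x hx 0 self_mem_Ici hx

/-- Iterating the bound over unit steps shows that the propagator has a finite lower rate. -/
theorem ExponentiallyBounded.exists_hasLowerRate {Φ : ℝ → Mat d} (h : ExponentiallyBounded Φ)
    (hinv : ∀ x, (Φ x)⁻¹ * Φ x = 1) (J : Set ℝ) : ∃ κ, HasLowerRate Φ J 1 κ := by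
  obtain ⟨C, hC⟩ := h
  set K : ℝ := max C 1 with hK
  have hK1 : 1 ≤ K := le_max_right _ _
  have hK0 : 0 < K := by linarith
  have key : ∀ n : ℕ, ∀ x x' : ℝ, x ≤ x' → x' - x ≤ n + 1 → ‖Φ x * (Φ x')⁻¹‖ ≤ K ^ (n + 1) := by
    intro n
    induction n with
    | zero =>
      intro x x' hle hn
      have hab : |x - x'| ≤ 1 := by
        rw [abs_sub_comm, abs_of_nonneg (by linarith)]; simpa using hn
      rw [zero_add, pow_one]
      exact (hC x x' hab).trans (le_max_left _ _)
    | succ n ih =>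
      intro x x' hle hn
      push_cast at hn
      rcases le_total (x' - x) 1 with h1 | h1
      · have hab : |x - x'| ≤ 1 := by rw [abs_sub_comm, abs_of_nonneg (by linarith)]; exact h1
        exact ((hC x x' hab).trans (le_max_left _ _)).trans
          (le_self_pow₀ hK1 (by omega))
      · have e : Φ x * (Φ x')⁻¹ = (Φ x * (Φ (x + 1))⁻¹) * (Φ (x + 1) * (Φ x')⁻¹) := by
          rw [mul_assoc, ← mul_assoc (Φ (x + 1))⁻¹, hinv, one_mul]
        rw [e, pow_succ']
        refine (norm_mul_le _ _).trans (mul_le_mul ?_ (ih _ _ (by linarith) (by linarith))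
          (norm_nonneg _) hK0.le)
        exact (hC x (x + 1) (by simp)).trans (le_max_left _ _)
  refine ⟨-Real.log K, hasLowerRate_of_le (K ^ 2) fun x _ x' _ hle => ?_⟩
  have h1 := key ⌈x' - x⌉₊ x x' hle ((Nat.le_ceil _).trans (by linarith))
  rw [mul_one]
  refine h1.trans ?_
  have hlog : 0 ≤ Real.log K := Real.log_nonneg hK1
  have hceil := Nat.ceil_lt_add_one (sub_nonneg.mpr hle)
  calc K ^ (⌈x' - x⌉₊ + 1) = Real.exp (((⌈x' - x⌉₊ : ℝ) + 1) * Real.log K) := by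
        rw [mul_comm, ← Nat.cast_succ, Real.exp_mul, Real.exp_log hK0, Real.rpow_natCast]
    _ ≤ Real.exp (2 * Real.log K + -Real.log K * (x - x')) := by
        apply Real.exp_le_exp.mpr
        nlinarith
    _ = K ^ 2 * Real.exp (-Real.log K * (x - x')) := by
        rw [Real.exp_add]
        congr 1
        rw [mul_comm, Real.exp_mul, Real.exp_log hK0]
        norm_cast

theorem norm_le_of_mul_eq {Φ : ℝ → Mat d} {E Q : Mat d} {x x' c M : ℝ} (hE : E * Q = Q)
    (hinv : (Φ x')⁻¹ * Φ x' = 1) (hM : ‖Φ x' * Q * (Φ x')⁻¹‖ ≤ M)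
    (h : ‖Φ x * E * (Φ x')⁻¹‖ ≤ c) : ‖Φ x * Q * (Φ x')⁻¹‖ ≤ c * M := by
  have e : (Φ x * E * (Φ x')⁻¹) * (Φ x' * Q * (Φ x')⁻¹) = Φ x * Q * (Φ x')⁻¹ := by
    calc _ = Φ x * E * ((Φ x')⁻¹ * Φ x') * Q * (Φ x')⁻¹ := by noncomm_ring
      _ = Φ x * (E * Q) * (Φ x')⁻¹ := by rw [hinv]; noncomm_ring
      _ = _ := by rw [hE]
  rw [← e]
  exact (norm_mul_le _ _).trans (mul_le_mul h hM (norm_nonneg _) ((norm_nonneg _).trans h))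

/-- A uniformly conjugated projection `Q` inherits the upper rates of any `E` with `E * Q = Q`. -/
theorem HasUpperRate.of_mul_eq {Φ : ℝ → Mat d} {J : Set ℝ} {E Q : Mat d} {κ : ℝ}
    (h : HasUpperRate Φ J E κ) (hE : E * Q = Q) (hinv : ∀ x, (Φ x)⁻¹ * Φ x = 1)
    (hQ : UniformlyConjugated Φ J Q) : HasUpperRate Φ J Q κ := by
  obtain ⟨C, -, h⟩ := h
  obtain ⟨M, hM⟩ := hQ
  refine hasUpperRate_of_le (C * M) fun x hx x' hx' hle => ?_
  rw [mul_right_comm C]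
  exact norm_le_of_mul_eq hE (hinv x') (hM x' hx') (h x hx x' hx' hle)

theorem HasLowerRate.of_mul_eq {Φ : ℝ → Mat d} {J : Set ℝ} {E Q : Mat d} {κ : ℝ}
    (h : HasLowerRate Φ J E κ) (hE : E * Q = Q) (hinv : ∀ x, (Φ x)⁻¹ * Φ x = 1)
    (hQ : UniformlyConjugated Φ J Q) : HasLowerRate Φ J Q κ := by
  obtain ⟨C, -, h⟩ := h
  obtain ⟨M, hM⟩ := hQ
  refine hasLowerRate_of_le (C * M) fun x hx x' hx' hle => ?_
  rw [mul_right_comm C]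
  exact norm_le_of_mul_eq hE (hinv x') (hM x' hx') (h x hx x' hx' hle)

/-! ### Bohl exponents of an ordered splitting on the half-line -/

namespace IsOrderedSplitting

variable {Φ : ℝ → Mat d} {k₀ d' : ℕ} {Q₀ : Mat d} {Q : ℕ → Mat d}

/-- The zero projection has upper Bohl exponent `-∞` and lower Bohl exponent `∞`. -/
theorem ne_zero (h : IsOrderedSplitting Φ k₀ d' Q₀ Q) {j : ℕ} (hj : j ∈ Finset.Icc 1 d') :
    Q j ≠ 0 := by
  intro h0
  have hs := h.segment j hj
  rw [h0] at hs
  have h1 := (hasLowerRate_zero (Φ := Φ) (J := univ) (κ := 1)).le_lowerBohl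
  have h2 := (hasUpperRate_zero (Φ := Φ) (J := univ) (κ := 0)).upperBohl_le
  have h3 : ((1 : ℝ) : EReal) ≤ ((0 : ℝ) : EReal) := (h1.trans hs).trans h2
  rw [EReal.coe_le_coe_iff] at h3
  linarith

/-- On `[0, ∞)` a nonzero projection cannot have an upper rate below one of its lower rates. -/
theorem lower_le_upper (h : IsOrderedSplitting Φ k₀ d' Q₀ Q) (h0 : Φ 0 = 1)
    (hinv : ∀ x, (Φ x)⁻¹ * Φ x = 1) {j : ℕ} (hj : j ∈ Finset.Icc 1 d') :
    lowerBohl Φ (Ici 0) (Q j) ≤ upperBohl Φ (Ici 0) (Q j) := by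
  by_contra! hlt
  obtain ⟨κ, h1, h2⟩ := EReal.lt_iff_exists_real_btwn.mp hlt
  obtain ⟨γ, h3, h4⟩ := EReal.lt_iff_exists_real_btwn.mp h1
  obtain ⟨C, -, hC⟩ := (hasUpperRate_of_lt h3).exists_bound h0
  have := (hasLowerRate_of_lt h2).mul_eq_zero h0 hinv (EReal.coe_lt_coe_iff.mp h4) hC
  rw [(h.idem j hj).eq] at this
  exact h.ne_zero hj this

theorem upper_lt_lower_Ici (h : IsOrderedSplitting Φ k₀ d' Q₀ Q) {i j : ℕ} (hi : 1 ≤ i)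
    (hij : i < j) (hj : j ≤ d') : upperBohl Φ (Ici 0) (Q i) < lowerBohl Φ (Ici 0) (Q j) :=
  calc upperBohl Φ (Ici 0) (Q i) ≤ upperBohl Φ univ (Q i) :=
        upperBohl_le_upperBohl fun _ hu => hu.subset (subset_univ _)
    _ < lowerBohl Φ univ (Q j) := h.upper_lt_lower hi hij hj
    _ ≤ lowerBohl Φ (Ici 0) (Q j) :=
        lowerBohl_le_lowerBohl fun _ hl => hl.subset (subset_univ _)

theorem upper_lt_zero (h : IsOrderedSplitting Φ k₀ d' Q₀ Q) (hk : k₀ ≤ d')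
    (hinv : ∀ x, (Φ x)⁻¹ * Φ x = 1) {j : ℕ}
    (hj : j ∈ Finset.Icc 1 k₀) : upperBohl Φ (Ici 0) (Q j) < 0 := by
  have hj' : j ∈ Finset.Icc 1 d' := by simp only [Finset.mem_Icc] at hj ⊢; omega
  obtain ⟨-, ⟨κ, hκ, hu⟩, -⟩ := isExpDichotomy_iff.mp h.dichotomy
  have hQ : Q₀ * Q j = Q j := by
    rw [h.sum_low, Finset.sum_mul, Finset.sum_eq_single j, (h.idem j hj').eq]
    · intro i hi hij
      exact h.disjoint i (by simp only [Finset.mem_Icc] at hi ⊢; omega) j hj' hij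
    · exact fun hn => absurd hj hn
  have := (hu.of_mul_eq hQ hinv (h.conj j hj')).subset (subset_univ (Ici 0))
  refine this.upperBohl_le.trans_lt ?_
  exact EReal.coe_lt_coe_iff.mpr (neg_lt_zero.mpr hκ)

theorem bot_lt_lower (h : IsOrderedSplitting Φ k₀ d' Q₀ Q) (hb : ExponentiallyBounded Φ)
    (hinv : ∀ x, (Φ x)⁻¹ * Φ x = 1) {j : ℕ}
    (hj : j ∈ Finset.Icc 1 d') : ⊥ < lowerBohl Φ (Ici 0) (Q j) := by
  obtain ⟨κ, hl⟩ := hb.exists_hasLowerRate hinv univ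
  have := (hl.of_mul_eq (one_mul _) hinv (h.conj j hj)).subset (subset_univ (Ici 0))
  exact (EReal.bot_lt_coe κ).trans_le this.le_lowerBohl

end IsOrderedSplitting

namespace IsHalfLineSplitting

variable {Φ Ψ : ℝ → Mat d} {k₀ d' : ℕ} {Q₀ : Mat d} {Q P : ℕ → Mat d}

/-- The complement of the first `j` perturbed projections consists of the blocks after the `j`-th
and of the growing part of the dichotomy. -/
theorem hasLowerRate_one_sub (hP : IsHalfLineSplitting Φ Ψ k₀ Q P)
    (h : IsOrderedSplitting Φ k₀ d' Q₀ Q) (hk : k₀ ≤ d') (h0 : Φ 0 = 1)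
    (hinv : ∀ x, (Φ x)⁻¹ * Φ x = 1) {j : ℕ} (hj : j ≤ k₀) {γ : ℝ} (hγ : γ < 0)
    (hγj : j + 1 ≤ k₀ → γ < lowerBohl Φ (Ici 0) (Q (j + 1))) :
    HasLowerRate Ψ (Ici 0) (1 - ∑ i ∈ Finset.Icc 1 j, P i) γ := by
  have e : Finset.Icc 1 k₀ = Finset.Icc 1 j ∪ Finset.Icc (j + 1) k₀ := by
    ext i; simp; omega
  have hd : Disjoint (Finset.Icc 1 j) (Finset.Icc (j + 1) k₀) := by
    rw [Finset.disjoint_left]; intro i; simp; omega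
  have e2 : 1 - ∑ i ∈ Finset.Icc 1 j, P i
      = (1 - ∑ i ∈ Finset.Icc 1 k₀, P i) + ∑ i ∈ Finset.Icc (j + 1) k₀, P i := by
    rw [e, Finset.sum_union hd]; abel
  rw [e2]
  obtain ⟨-, -, κ, hκ, hl⟩ := isExpDichotomy_iff.mp hP.dichotomy
  refine (hl.mono (by linarith)).add (hasLowerRate_sum fun i hi => ?_)
  rw [Finset.mem_Icc] at hi
  apply hasLowerRate_of_lt
  rw [hP.lower i (by simp only [Finset.mem_Icc]; omega)]
  have h1 := hγj (by omega)
  rcases hi.1.eq_or_lt with rfl | hlt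
  · exact h1
  · exact h1.trans_le ((h.lower_le_upper h0 hinv (by simp only [Finset.mem_Icc]; omega)).trans
      (h.upper_lt_lower_Ici (by omega) hlt (by omega)).le)

theorem hasUpperRate_sum (hP : IsHalfLineSplitting Φ Ψ k₀ Q P)
    (h : IsOrderedSplitting Φ k₀ d' Q₀ Q) (hk : k₀ ≤ d') (h0 : Φ 0 = 1)
    (hinv : ∀ x, (Φ x)⁻¹ * Φ x = 1) {j : ℕ} (hj : j ≤ k₀) {γ : ℝ}
    (hγj : 1 ≤ j → upperBohl Φ (Ici 0) (Q j) < γ) :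
    HasUpperRate Ψ (Ici 0) (∑ i ∈ Finset.Icc 1 j, P i) γ := by
  refine JostSplitting.hasUpperRate_sum fun i hi => ?_
  rw [Finset.mem_Icc] at hi
  apply hasUpperRate_of_lt
  rw [hP.upper i (by simp only [Finset.mem_Icc]; omega)]
  have h1 := hγj (by omega)
  rcases hi.2.eq_or_lt with rfl | hlt
  · exact h1
  · exact (((h.upper_lt_lower_Ici hi.1 hlt (by omega)).le).trans
      (h.lower_le_upper h0 hinv (by simp only [Finset.mem_Icc]; omega))).trans_lt h1

end IsHalfLineSplitting

/-! ### Generalized Jost solutions on the half-line -/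

/-- If `E` has upper rate `γ` and `1 - E` lower rate `γ` for the perturbed equation, then every
solution matrix `Φ Q` whose growth is compensated by the decay of `R` is asymptotic to a
perturbed solution up to `O(exp (γ x))`: integrate the `E` part of the variation of constants
formula from `0`, and the `1 - E` part from `∞`. -/
theorem exists_asymptotic_solution {A R Φ Ψ : ℝ → Mat d} (hA : LocallyIntegrable A)
    (hR : LocallyIntegrable R) (hΦ : IsFundamentalMatrix A Φ)
    (hΨ : IsFundamentalMatrix (fun t => A t + R t) Ψ) {E Q : Mat d} {β γ C : ℝ}
    (hQ : IsIdempotentElem Q)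
    (hu : HasUpperRate Ψ (Ici 0) E γ) (hl : HasLowerRate Ψ (Ici 0) (1 - E) γ)
    (hΦQ : ∀ x, 0 ≤ x → ‖Φ x * Q‖ ≤ C * Real.exp ((β + γ) * x))
    (hRβ : Integrable fun x : ℝ => ‖R x‖ * Real.exp (β * |x|)) :
    ∃ Y₀ : Mat d, Y₀ * Q = Y₀ ∧
      ∃ K : ℝ, ∀ x, 0 ≤ x → ‖Ψ x * Y₀ - Φ x * Q‖ ≤ K * Real.exp (γ * x) := by
  have hAR : LocallyIntegrable fun t => A t + R t := hA.add hR
  obtain ⟨C₁, hC₁, hu⟩ := hu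
  obtain ⟨C₂, hC₂, hl⟩ := hl
  have hC : 0 ≤ C := by
    have := (norm_nonneg _).trans (hΦQ 0 le_rfl)
    simpa using this
  set f : ℝ → Mat d := fun t => (Ψ t)⁻¹ * R t * Φ t * Q with hf
  have hf0 : LocallyIntegrable fun t => (Ψ t)⁻¹ * R t * Φ t :=
    locallyIntegrable_mul_continuous (locallyIntegrable_continuous_mul hR
      (hΨ.continuous_inv hAR)) hΦ.continuous
  have hfl : LocallyIntegrable f := locallyIntegrable_mul_continuous hf0 continuous_const
  have hfi : ∀ a b, IntervalIntegrable f volume a b := intervalIntegrable_of_locallyIntegrable hfl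
  set ρ : ℝ → ℝ := fun x => ‖R x‖ * Real.exp (β * |x|) with hρ
  have hρ0 : ∀ t, 0 ≤ ρ t := fun t => by positivity
  have hbound : ∀ {M : Mat d} {D x t : ℝ}, 0 ≤ t →
      ‖Ψ x * M * (Ψ t)⁻¹‖ ≤ D * Real.exp (γ * (x - t)) →
      ‖Ψ x * (M * f t)‖ ≤ D * C * Real.exp (γ * x) * ρ t := by
    intro M D x t ht h
    have hD : 0 ≤ D * Real.exp (γ * (x - t)) := (norm_nonneg _).trans h
    calc ‖Ψ x * (M * f t)‖ = ‖(Ψ x * M * (Ψ t)⁻¹) * R t * (Φ t * Q)‖ := by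
          simp only [hf]; congr 1; noncomm_ring
      _ ≤ ‖Ψ x * M * (Ψ t)⁻¹‖ * ‖R t‖ * ‖Φ t * Q‖ :=
          (norm_mul_le _ _).trans (by gcongr; exact norm_mul_le _ _)
      _ ≤ (D * Real.exp (γ * (x - t))) * ‖R t‖ * (C * Real.exp ((β + γ) * t)) := by
          gcongr
          exact hΦQ t ht
      _ = D * C * ‖R t‖ * (Real.exp (γ * (x - t)) * Real.exp ((β + γ) * t)) := by ring
      _ = D * C * ‖R t‖ * (Real.exp (γ * x) * Real.exp (β * |t|)) := by
          rw [← Real.exp_add, ← Real.exp_add, abs_of_nonneg ht]; ring_nf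
      _ = _ := by simp only [hρ]; ring
  -- integrability of the complementary part
  have hgi : IntegrableOn (fun t => (1 - E) * f t) (Ioi 0) := by
    refine Integrable.mono' (hRβ.const_mul (C₂ * C)).integrableOn
      (hfl.aestronglyMeasurable.const_mul _).restrict
      ((ae_restrict_iff' measurableSet_Ioi).mpr (ae_of_all _ fun t ht => ?_))
    have ht0 : (0 : ℝ) ≤ t := le_of_lt ht
    have := hbound ht0 (hl 0 self_mem_Ici t ht0 ht0)
    simpa [hΨ.1] using this
  have hgi' : ∀ x, 0 ≤ x → IntegrableOn (fun t => (1 - E) * f t) (Ioi x) := fun x hx =>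
    hgi.mono_set (Ioi_subset_Ioi hx)
  refine ⟨Q - ∫ t in Ioi 0, (1 - E) * f t, ?_, (C₁ * C + C₂ * C) * ∫ t, ρ t, fun x hx => ?_⟩
  · have := integral_mul_mul hgi 1 Q
    simp only [one_mul] at this
    rw [sub_mul, hQ.eq, ← this]
    congr 2
    ext1 t
    simp only [hf, mul_assoc, hQ.eq]
  · have hduh : (Ψ x)⁻¹ * (Φ x * Q) = Q - ∫ t in (0 : ℝ)..x, f t := by
      have h1 := intervalIntegral_mul_mul
        (intervalIntegrable_of_locallyIntegrable hf0 0 x) 1 Q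
      simp only [one_mul] at h1
      rw [← mul_assoc, hΦ.inv_mul_eq hA hR hΨ, sub_mul, one_mul, ← h1]
    have hsplit : ∫ t in (0 : ℝ)..x, f t
        = (∫ t in (0 : ℝ)..x, E * f t) + ∫ t in (0 : ℝ)..x, (1 - E) * f t := by
      rw [← intervalIntegral.integral_add ((hfi 0 x).const_mul E) ((hfi 0 x).const_mul (1 - E))]
      refine intervalIntegral.integral_congr fun t _ => ?_
      noncomm_ring
    have htail := intervalIntegral.integral_Ioi_sub_Ioi hgi hx
    have e : Ψ x * (Q - ∫ t in Ioi 0, (1 - E) * f t) - Φ x * Q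
        = (∫ t in (0 : ℝ)..x, Ψ x * (E * f t)) - ∫ t in Ioi x, Ψ x * ((1 - E) * f t) := by
      have e1 : Φ x * Q = Ψ x * ((Ψ x)⁻¹ * (Φ x * Q)) := by
        rw [← mul_assoc (Ψ x), hΨ.mul_inv hAR, one_mul]
      have e2 := intervalIntegral_mul_mul ((hfi 0 x).const_mul E) (Ψ x) 1
      have e3 := integral_mul_mul (hgi' x hx) (Ψ x) 1
      simp only [mul_one] at e2 e3
      rw [e1, hduh, hsplit, e2, e3, ← htail]
      noncomm_ring
    have b1 : ‖∫ t in (0 : ℝ)..x, Ψ x * (E * f t)‖ ≤ C₁ * C * Real.exp (γ * x) * ∫ t, ρ t := by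
      calc _ ≤ ∫ t in (0 : ℝ)..x, C₁ * C * Real.exp (γ * x) * ρ t :=
            intervalIntegral.norm_integral_le_of_norm_le hx
              (ae_of_all _ fun t ht => hbound ht.1.le (hu x hx t ht.1.le ht.2))
              (hRβ.const_mul _).intervalIntegrable
        _ = C₁ * C * Real.exp (γ * x) * ∫ t in Ioc 0 x, ρ t := by
            rw [intervalIntegral.integral_const_mul, intervalIntegral.integral_of_le hx]
        _ ≤ _ := mul_le_mul_of_nonneg_left (setIntegral_le_integral hRβ (ae_of_all _ hρ0))
            (by positivity)
    have b2 : ‖∫ t in Ioi x, Ψ x * ((1 - E) * f t)‖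
        ≤ C₂ * C * Real.exp (γ * x) * ∫ t, ρ t := by
      calc _ ≤ ∫ t in Ioi x, C₂ * C * Real.exp (γ * x) * ρ t := by
            refine norm_integral_le_of_norm_le (hRβ.const_mul _).integrableOn
              ((ae_restrict_iff' measurableSet_Ioi).mpr (ae_of_all _ fun t ht => ?_))
            have hxt : x ≤ t := le_of_lt ht
            exact hbound (hx.trans hxt) (hl x hx t (hx.trans hxt) hxt)
        _ = C₂ * C * Real.exp (γ * x) * ∫ t in Ioi x, ρ t := integral_const_mul _ _
        _ ≤ _ := mul_le_mul_of_nonneg_left (setIntegral_le_integral hRβ (ae_of_all _ hρ0))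
            (by positivity)
    rw [e]
    calc _ ≤ _ := norm_sub_le _ _
      _ ≤ _ := add_le_add b1 b2
      _ = _ := by ring

section HalfLine

variable {A R : ℝ → Mat d} {k₀ d' : ℕ} {Q₀ : Mat d} {Q P : ℕ → Mat d} {Y Y' : ℝ → Mat d} {j : ℕ}

local notation "Φ" => fundamentalMatrix A
local notation "Ψ" => fundamentalMatrix fun x => A x + R x

theorem exists_isJostSolutionPos (hA : LocallyIntegrable A) (hR : LocallyIntegrable R)
    (hbdd : ExponentiallyBounded Φ) (h : IsOrderedSplitting Φ k₀ d' Q₀ Q) (hk : k₀ ≤ d')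
    (hP : IsHalfLineSplitting Φ Ψ k₀ Q P) {β : ℝ} (hj : j ∈ Finset.Icc 1 k₀)
    (hβ : upperLyapunovPos Φ (Q j) - lowerBohl Φ (Ici 0) (Q j) < (β : EReal))
    (hRβ : Integrable fun x : ℝ => ‖R x‖ * Real.exp (β * |x|)) :
    ∃ Y, IsJostSolutionPos A R (Q j) Y := by
  have hΦ := fundamentalMatrix_spec hA
  have hAR : LocallyIntegrable fun x => A x + R x := hA.add hR
  have hΨ := fundamentalMatrix_spec hAR
  have hinv := hΦ.inv_mul hA
  have hj' : j ∈ Finset.Icc 1 d' := by simp only [Finset.mem_Icc] at hj ⊢; omega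
  have hbot := h.bot_lt_lower hbdd hinv hj'
  have hle := h.lower_le_upper hΦ.1 hinv hj'
  have hneg := hle.trans_lt (h.upper_lt_zero hk hinv hj)
  -- a rate `γ` below the lower Bohl exponent, compatible with the decay of `R`
  obtain ⟨k, hkeq⟩ : ∃ k : ℝ, lowerBohl Φ (Ici 0) (Q j) = k :=
    ⟨_, (EReal.coe_toReal (ne_top_of_lt hneg) hbot.ne').symm⟩
  rw [hkeq] at hβ hneg
  have hk0 : k < 0 := EReal.coe_lt_coe_iff.mp hneg
  rw [EReal.sub_lt_iff (Or.inl (EReal.coe_ne_bot k)) (Or.inl (EReal.coe_ne_top k)),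
    ← EReal.coe_add] at hβ
  obtain ⟨μ, hμ1, hμ2⟩ := EReal.lt_iff_exists_real_btwn.mp hβ
  rw [EReal.coe_lt_coe_iff] at hμ2
  obtain ⟨γ₁, hγ₁k, hγ₁⟩ : ∃ γ₁ : ℝ, γ₁ < k ∧
      (1 ≤ j - 1 → upperBohl Φ (Ici 0) (Q (j - 1)) < γ₁) := by
    rw [Finset.mem_Icc] at hj'
    by_cases h1 : 1 ≤ j - 1
    · have := h.upper_lt_lower_Ici h1 (show j - 1 < j by omega) hj'.2
      rw [hkeq] at this
      obtain ⟨γ₁, h2, h3⟩ := EReal.lt_iff_exists_real_btwn.mp this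
      exact ⟨γ₁, EReal.coe_lt_coe_iff.mp h3, fun _ => h2⟩
    · exact ⟨k - 1, by linarith, fun h2 => absurd h2 h1⟩
  set γ := max (μ - β) γ₁ with hγ
  have hγk : γ < k := max_lt (by linarith) hγ₁k
  have hμγ : μ ≤ β + γ := by linarith [le_max_left (μ - β) γ₁]
  rw [Finset.mem_Icc] at hj
  have hu := hP.hasUpperRate_sum h hk hΦ.1 hinv (show j - 1 ≤ k₀ by omega) (γ := γ)
    (fun h1 => (hγ₁ h1).trans_le (EReal.coe_le_coe_iff.mpr (le_max_right _ _)))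
  have hl := hP.hasLowerRate_one_sub h hk hΦ.1 hinv (show j - 1 ≤ k₀ by omega) (γ := γ)
    (by linarith) (fun _ => by
      rw [Nat.sub_add_cancel hj.1, hkeq]; exact EReal.coe_lt_coe_iff.mpr hγk)
  obtain ⟨C, hC⟩ := exists_bound_of_limsup_lt (F := fun x => Φ x * Q j) (γ := β + γ)
    (hΦ.continuous.mul continuous_const).continuousOn
    (hμ1.trans_le (EReal.coe_le_coe_iff.mpr hμγ))
  obtain ⟨Y₀, hY₀, K, hK⟩ := exists_asymptotic_solution hA hR hΦ hΨ (h.idem j hj') hu hl hC hRβ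
  refine ⟨fun x => Ψ x * Y₀, hΨ.isSolutionOn_mul hAR _ _, ?_, ?_⟩
  · obtain ⟨γ', h1, h2⟩ := exists_between hγk
    rw [hkeq]
    exact (limsup_le_of_bound h1 hK).trans_lt (EReal.coe_lt_coe_iff.mpr h2)
  · simp only [hΨ.1, one_mul, hY₀]

namespace IsJostSolutionPos

theorem eq_mul (hA : LocallyIntegrable A) (hR : LocallyIntegrable R) {M : Mat d}
    (hY : IsJostSolutionPos A R M Y) {x : ℝ} (hx : 0 ≤ x) : Y x = Ψ x * Y 0 := by
  have hAR : LocallyIntegrable fun x => A x + R x := hA.add hR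
  refine (fundamentalMatrix_spec hAR).solution_eq hAR hY.1 (fun y hy z hz => ?_) hx
  rw [uIcc_of_le hy] at hz
  exact hz.1

/-- The error of a Jost solution decays faster than the lower Bohl exponent allows. -/
theorem exists_bound (hA : LocallyIntegrable A) (hR : LocallyIntegrable R) {M : Mat d}
    (hY : IsJostSolutionPos A R M Y) : ∃ γ C : ℝ, γ < lowerBohl Φ (Ici 0) M ∧
      ∀ x, 0 ≤ x → ‖Ψ x * Y 0 - Φ x * M‖ ≤ C * Real.exp (γ * x) := by
  obtain ⟨γ, h1, h2⟩ := EReal.lt_iff_exists_real_btwn.mp hY.2.1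
  obtain ⟨C, hC⟩ := exists_bound_of_limsup_lt (hY.1.1.sub
    ((fundamentalMatrix_spec hA).continuous.mul continuous_const).continuousOn) h1
  exact ⟨γ, C, h2, fun x hx => by rw [← hY.eq_mul hA hR hx]; exact hC x hx⟩

theorem sum_mul_eq (hA : LocallyIntegrable A) (hR : LocallyIntegrable R)
    (h : IsOrderedSplitting Φ k₀ d' Q₀ Q) (hk : k₀ ≤ d')
    (hP : IsHalfLineSplitting Φ Ψ k₀ Q P) (hj : j ∈ Finset.Icc 1 k₀)
    (hY : IsJostSolutionPos A R (Q j) Y) : (∑ i ∈ Finset.Icc 1 j, P i) * Y 0 = Y 0 := by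
  have hΦ := fundamentalMatrix_spec hA
  have hAR : LocallyIntegrable fun x => A x + R x := hA.add hR
  have hΨ := fundamentalMatrix_spec hAR
  have hinv := hΦ.inv_mul hA
  have hj' : j ∈ Finset.Icc 1 d' := by simp only [Finset.mem_Icc] at hj ⊢; omega
  have hneg := h.upper_lt_zero hk hinv hj
  have hle := h.lower_le_upper hΦ.1 hinv hj'
  rw [Finset.mem_Icc] at hj
  obtain ⟨γ, C, hγ, hC⟩ := hY.exists_bound hA hR
  -- rates `κ < κ'` between the `j`-th Bohl segment and the next one
  obtain ⟨κ', hκ1, hκ0, hκ2⟩ : ∃ κ' : ℝ, upperBohl Φ (Ici 0) (Q j) < κ' ∧ κ' < 0 ∧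
      (j + 1 ≤ k₀ → κ' < lowerBohl Φ (Ici 0) (Q (j + 1))) := by
    by_cases h1 : j + 1 ≤ k₀
    · obtain ⟨κ', h2, h3⟩ := EReal.lt_iff_exists_real_btwn.mp
        (lt_min hneg (h.upper_lt_lower_Ici hj.1 (Nat.lt_succ_self j) (by omega)))
      exact ⟨κ', h2, EReal.coe_lt_coe_iff.mp (h3.trans_le (min_le_left _ _)),
        fun _ => h3.trans_le (min_le_right _ _)⟩
    · obtain ⟨κ', h2, h3⟩ := EReal.lt_iff_exists_real_btwn.mp hneg
      exact ⟨κ', h2, EReal.coe_lt_coe_iff.mp h3, fun h4 => absurd h4 h1⟩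
  obtain ⟨κ, h2, h3⟩ := EReal.lt_iff_exists_real_btwn.mp hκ1
  rw [EReal.coe_lt_coe_iff] at h3
  obtain ⟨D, hD0, hD⟩ := (hasUpperRate_of_lt h2).exists_bound hΦ.1
  have hγκ : γ < κ := EReal.coe_lt_coe_iff.mp ((hγ.trans_le hle).trans h2)
  have hC0 : 0 ≤ C := by simpa using (norm_nonneg _).trans (hC 0 le_rfl)
  have hb : ∀ x, 0 ≤ x → ‖Ψ x * Y 0‖ ≤ (C + D) * Real.exp (κ * x) := fun x hx => by
    calc ‖Ψ x * Y 0‖ = ‖(Ψ x * Y 0 - Φ x * Q j) + Φ x * Q j‖ := by rw [sub_add_cancel]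
      _ ≤ C * Real.exp (γ * x) + D * Real.exp (κ * x) :=
          (norm_add_le _ _).trans (add_le_add (hC x hx) (hD x hx))
      _ ≤ C * Real.exp (κ * x) + D * Real.exp (κ * x) := by gcongr
      _ = _ := by ring
  have := (hP.hasLowerRate_one_sub h hk hΦ.1 hinv hj.2 hκ0 hκ2).mul_eq_zero hΨ.1
    (hΨ.inv_mul hAR) h3 hb
  rw [sub_mul, one_mul, sub_eq_zero] at this
  exact this.symm

theorem sum_mul_sub_eq (hA : LocallyIntegrable A) (hR : LocallyIntegrable R)
    (h : IsOrderedSplitting Φ k₀ d' Q₀ Q) (hk : k₀ ≤ d')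
    (hP : IsHalfLineSplitting Φ Ψ k₀ Q P) (hj : j ∈ Finset.Icc 1 k₀)
    (hY : IsJostSolutionPos A R (Q j) Y) (hY' : IsJostSolutionPos A R (Q j) Y') :
    (∑ i ∈ Finset.Icc 1 (j - 1), P i) * (Y 0 - Y' 0) = Y 0 - Y' 0 := by
  have hΦ := fundamentalMatrix_spec hA
  have hAR : LocallyIntegrable fun x => A x + R x := hA.add hR
  have hΨ := fundamentalMatrix_spec hAR
  have hinv := hΦ.inv_mul hA
  have hj' : j ∈ Finset.Icc 1 d' := by simp only [Finset.mem_Icc] at hj ⊢; omega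
  have hneg := (h.lower_le_upper hΦ.1 hinv hj').trans_lt (h.upper_lt_zero hk hinv hj)
  rw [Finset.mem_Icc] at hj
  obtain ⟨γ, C, hγ, hC⟩ := hY.exists_bound hA hR
  obtain ⟨γ', C', hγ', hC'⟩ := hY'.exists_bound hA hR
  have hm : ((max γ γ' : ℝ) : EReal) < lowerBohl Φ (Ici 0) (Q j) := by
    rcases max_choice γ γ' with he | he <;> rw [he] <;> assumption
  obtain ⟨κ, h1, h2⟩ := EReal.lt_iff_exists_real_btwn.mp hm
  have hC0 : 0 ≤ C := by simpa using (norm_nonneg _).trans (hC 0 le_rfl)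
  have hC0' : 0 ≤ C' := by simpa using (norm_nonneg _).trans (hC' 0 le_rfl)
  have hb : ∀ x, 0 ≤ x → ‖Ψ x * (Y 0 - Y' 0)‖ ≤ (C + C') * Real.exp (max γ γ' * x) :=
    fun x hx => by
      calc ‖Ψ x * (Y 0 - Y' 0)‖
          = ‖(Ψ x * Y 0 - Φ x * Q j) - (Ψ x * Y' 0 - Φ x * Q j)‖ := by
            rw [sub_sub_sub_cancel_right, mul_sub]
        _ ≤ C * Real.exp (γ * x) + C' * Real.exp (γ' * x) :=
            (norm_sub_le _ _).trans (add_le_add (hC x hx) (hC' x hx))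
        _ ≤ C * Real.exp (max γ γ' * x) + C' * Real.exp (max γ γ' * x) := by
            gcongr
            exacts [le_max_left _ _, le_max_right _ _]
        _ = _ := by ring
  have := (hP.hasLowerRate_one_sub h hk hΦ.1 hinv (show j - 1 ≤ k₀ by omega)
    (EReal.coe_lt_coe_iff.mp (h2.trans hneg))
    (fun _ => by rw [Nat.sub_add_cancel hj.1]; exact h2)).mul_eq_zero hΨ.1
    (hΨ.inv_mul hAR) (EReal.coe_lt_coe_iff.mp h1) hb
  rw [sub_mul, one_mul, sub_eq_zero] at this
  exact this.symm

/-- A column of `Y 0` in the range of the first `j - 1` perturbed projections would make the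
corresponding column of `Φ Q j` grow more slowly than its lower Bohl exponent. -/
theorem mul_eq_zero_of_eq (hA : LocallyIntegrable A) (hR : LocallyIntegrable R)
    (h : IsOrderedSplitting Φ k₀ d' Q₀ Q) (hk : k₀ ≤ d')
    (hP : IsHalfLineSplitting Φ Ψ k₀ Q P) (hj : j ∈ Finset.Icc 2 k₀)
    (hY : IsJostSolutionPos A R (Q j) Y) {W U : Mat d}
    (hWU : Y 0 * W = (∑ i ∈ Finset.Icc 1 (j - 1), P i) * U) : Y 0 * W = 0 := by
  have hΦ := fundamentalMatrix_spec hA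
  have hAR : LocallyIntegrable fun x => A x + R x := hA.add hR
  have hΨ := fundamentalMatrix_spec hAR
  have hinv := hΦ.inv_mul hA
  rw [Finset.mem_Icc] at hj
  obtain ⟨γ, C, hγ, hC⟩ := hY.exists_bound hA hR
  obtain ⟨κ₁, h1, h2⟩ := EReal.lt_iff_exists_real_btwn.mp
    (h.upper_lt_lower_Ici (show 1 ≤ j - 1 by omega) (show j - 1 < j by omega) (by omega))
  obtain ⟨D, hD0, hD⟩ := (hP.hasUpperRate_sum h hk hΦ.1 hinv (show j - 1 ≤ k₀ by omega)
    (fun _ => h1)).exists_bound hΨ.1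
  have hm : ((max γ κ₁ : ℝ) : EReal) < lowerBohl Φ (Ici 0) (Q j) := by
    rcases max_choice γ κ₁ with he | he <;> rw [he] <;> assumption
  obtain ⟨κ, h3, h4⟩ := EReal.lt_iff_exists_real_btwn.mp hm
  have hC0 : 0 ≤ C := by simpa using (norm_nonneg _).trans (hC 0 le_rfl)
  have hb : ∀ x, 0 ≤ x →
      ‖Φ x * (Q j * W)‖ ≤ (D * ‖U‖ + C * ‖W‖) * Real.exp (max γ κ₁ * x) := fun x hx => by
    calc ‖Φ x * (Q j * W)‖ = ‖(Ψ x * (∑ i ∈ Finset.Icc 1 (j - 1), P i)) * U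
          - (Ψ x * Y 0 - Φ x * Q j) * W‖ := by
          congr 1
          rw [mul_assoc (Ψ x), ← hWU]
          noncomm_ring
      _ ≤ D * Real.exp (κ₁ * x) * ‖U‖ + C * Real.exp (γ * x) * ‖W‖ := by
          refine (norm_sub_le _ _).trans (add_le_add ?_ ?_)
          · exact (norm_mul_le _ _).trans (by gcongr; exact hD x hx)
          · exact (norm_mul_le _ _).trans (by gcongr; exact hC x hx)
      _ ≤ D * Real.exp (max γ κ₁ * x) * ‖U‖ + C * Real.exp (max γ κ₁ * x) * ‖W‖ := by
          gcongr
          exacts [le_max_right _ _, le_max_left _ _]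
      _ = _ := by ring
  have h0 := (hasLowerRate_of_lt h4).mul_eq_zero hΦ.1 hinv (EReal.coe_lt_coe_iff.mp h3) hb
  rw [← mul_assoc, (h.idem j (by simp only [Finset.mem_Icc]; omega)).eq] at h0
  rw [hY.2.2, mul_assoc, h0, mul_zero]

end IsJostSolutionPos

/-! ### Ranges of the initial values on the half-line -/

theorem ran_le_of_mul_eq {M N : Mat d} (h : N * M = M) : ran M ≤ ran N := by
  rintro _ ⟨w, rfl⟩
  refine ⟨M.mulVec w, ?_⟩
  simp only [Matrix.mulVecLin_apply, Matrix.mulVec_mulVec, h]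

theorem IsJostSolutionPos.eqOn (hA : LocallyIntegrable A) (hR : LocallyIntegrable R)
    (h : IsOrderedSplitting Φ k₀ d' Q₀ Q) (hk₁ : 1 ≤ k₀) (hk : k₀ ≤ d')
    (hP : IsHalfLineSplitting Φ Ψ k₀ Q P)
    (hY : IsJostSolutionPos A R (Q 1) Y) (hY' : IsJostSolutionPos A R (Q 1) Y') :
    EqOn Y Y' (Ici 0) := by
  intro x hx
  have := hY.sum_mul_sub_eq hA hR h hk hP (Finset.mem_Icc.mpr ⟨le_rfl, hk₁⟩) hY'
  simp only [Nat.sub_self, Finset.Icc_eq_empty_of_lt zero_lt_one, Finset.sum_empty,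
    zero_mul] at this
  rw [hY.eq_mul hA hR hx, hY'.eq_mul hA hR hx, sub_eq_zero.mp this.symm]

theorem IsJostSolutionPos.ran_diff_subset (hA : LocallyIntegrable A) (hR : LocallyIntegrable R)
    (h : IsOrderedSplitting Φ k₀ d' Q₀ Q) (hk : k₀ ≤ d')
    (hP : IsHalfLineSplitting Φ Ψ k₀ Q P) (hj : j ∈ Finset.Icc 2 k₀)
    (hY : IsJostSolutionPos A R (Q j) Y) :
    (ran (Y 0) : Set (Fin d → ℂ)) \ {0} ⊆
      (ran (∑ k ∈ Finset.Icc 1 j, P k) : Set (Fin d → ℂ)) \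
        (ran (∑ k ∈ Finset.Icc 1 (j - 1), P k) : Set (Fin d → ℂ)) := by
  rintro v ⟨hv, hv0⟩
  have hj' : j ∈ Finset.Icc 1 k₀ := by simp only [Finset.mem_Icc] at hj ⊢; omega
  refine ⟨ran_le_of_mul_eq (hY.sum_mul_eq hA hR h hk hP hj') hv, ?_⟩
  rintro ⟨u, hu⟩
  obtain ⟨w, hw⟩ := hv
  -- pass from vectors to matrices all of whose columns agree
  have e : Y 0 * (Matrix.vecMulVec w (1 : Fin d → ℂ) : Mat d)
      = (∑ k ∈ Finset.Icc 1 (j - 1), P k) * (Matrix.vecMulVec u (1 : Fin d → ℂ) : Mat d) := by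
    rw [Matrix.mul_vecMulVec, Matrix.mul_vecMulVec, ← Matrix.mulVecLin_apply,
      ← Matrix.mulVecLin_apply, hw, hu]
  have h0 := hY.mul_eq_zero_of_eq hA hR h hk hP hj e
  rw [Matrix.mul_vecMulVec, ← Matrix.mulVecLin_apply, hw] at h0
  refine hv0 (funext fun i => ?_)
  have := congrFun (congrFun h0 i) i
  simpa [Matrix.vecMulVec_apply] using this

/-- The decay rate is nonnegative because `λ₊(Q j) ≥ ϰ'₊(Q j)`. -/
theorem IsOrderedSplitting.decayRate_nonneg (hA : LocallyIntegrable A)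
    (hbdd : ExponentiallyBounded Φ)
    (h : IsOrderedSplitting Φ k₀ d' Q₀ Q) (hk : k₀ ≤ d') {β : ℝ} (hj : j ∈ Finset.Icc 1 k₀)
    (hβ : upperLyapunovPos Φ (Q j) - lowerBohl Φ (Ici 0) (Q j) < (β : EReal)) : 0 ≤ β := by
  have hΦ := fundamentalMatrix_spec hA
  have hinv := hΦ.inv_mul hA
  have hj' : j ∈ Finset.Icc 1 d' := by simp only [Finset.mem_Icc] at hj ⊢; omega
  have hneg := (h.lower_le_upper hΦ.1 hinv hj').trans_lt (h.upper_lt_zero hk hinv hj)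
  have hbot := h.bot_lt_lower hbdd hinv hj'
  by_contra! hβ0
  have h1 : upperLyapunovPos Φ (Q j) < lowerBohl Φ (Ici 0) (Q j) := by
    rw [EReal.sub_lt_iff (Or.inl hbot.ne') (Or.inl (ne_top_of_lt hneg))] at hβ
    refine hβ.trans_le ?_
    have : (β : EReal) ≤ 0 := by exact_mod_cast hβ0.le
    simpa using add_le_add_left this (lowerBohl Φ (Ici 0) (Q j))
  obtain ⟨κ, h2, h3⟩ := EReal.lt_iff_exists_real_btwn.mp h1
  obtain ⟨γ, h4, h5⟩ := EReal.lt_iff_exists_real_btwn.mp h2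
  obtain ⟨C, hC⟩ := exists_bound_of_limsup_lt (F := fun x => Φ x * Q j)
    (hΦ.continuous.mul continuous_const).continuousOn h4
  have := (hasLowerRate_of_lt h3).mul_eq_zero hΦ.1 hinv (EReal.coe_lt_coe_iff.mp h5) hC
  rw [(h.idem j hj').eq] at this
  exact h.ne_zero hj' this

end HalfLine

theorem integrable_of_integrable_mul_exp {R : ℝ → Mat d} (hR : LocallyIntegrable R) {β : ℝ}
    (hβ : 0 ≤ β) (hRβ : Integrable fun x : ℝ => ‖R x‖ * Real.exp (β * |x|)) : Integrable R := by
  refine Integrable.mono' hRβ hR.aestronglyMeasurable (ae_of_all _ fun x => ?_)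
  exact le_mul_of_one_le_right (norm_nonneg _) (Real.one_le_exp (by positivity))

/-! ### Time reversal -/

theorem preimage_neg_Ici_zero : Neg.neg ⁻¹' (Ici (0 : ℝ)) = Iic 0 := by ext; simp

theorem preimage_neg_Iic_zero : Neg.neg ⁻¹' (Iic (0 : ℝ)) = Ici 0 := by ext; simp

theorem fundamentalMatrix_reverse {A : ℝ → Mat d} (hA : LocallyIntegrable A) :
    fundamentalMatrix (fun x => -A (-x)) = fun x => fundamentalMatrix A (-x) :=
  (fundamentalMatrix_spec (locallyIntegrable_neg_comp_neg hA)).unique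
    (locallyIntegrable_neg_comp_neg hA) (fundamentalMatrix_spec hA).comp_neg

theorem lowerBohl_reverse (Φ : ℝ → Mat d) (Q : Mat d) :
    lowerBohl (fun x => Φ (-x)) (Ici 0) Q = -upperBohl Φ (Iic 0) Q := by
  rw [upperBohl_eq_neg_reverse, neg_neg, preimage_neg_Iic_zero]

theorem upperBohl_reverse (Φ : ℝ → Mat d) (Q : Mat d) :
    upperBohl (fun x => Φ (-x)) (Ici 0) Q = -lowerBohl Φ (Iic 0) Q := by
  rw [lowerBohl_eq_neg_reverse, neg_neg, preimage_neg_Iic_zero]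

theorem isExpDichotomy_reverse {Φ : ℝ → Mat d} {J : Set ℝ} {Q : Mat d} :
    IsExpDichotomy Φ J Q ↔ IsExpDichotomy (fun x => Φ (-x)) (Neg.neg ⁻¹' J) (1 - Q) := by
  rw [isExpDichotomy_iff, isExpDichotomy_iff, sub_sub_cancel]
  simp only [hasUpperRate_iff_reverse (Φ := Φ), hasLowerRate_iff_reverse (Φ := Φ), neg_neg,
    IsIdempotentElem.one_sub_iff]
  tauto

theorem limsup_atTop_comp_neg (u : ℝ → EReal) :
    limsup (fun x => u (-x)) atTop = limsup u atBot := by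
  rw [← map_neg_atTop]
  rfl

theorem upperLyapunovPos_reverse (Φ : ℝ → Mat d) (Q : Mat d) :
    upperLyapunovPos (fun x => Φ (-x)) Q = -lowerLyapunovNeg Φ Q := by
  rw [upperLyapunovPos, lowerLyapunovNeg, neg_neg, ← limsup_atTop_comp_neg]
  refine limsup_congr ?_
  filter_upwards [eventually_ge_atTop (0 : ℝ)] with x hx
  rw [abs_neg, abs_of_nonneg hx]

theorem limsup_logNorm_reverse (F : ℝ → Mat d) :
    limsup (fun x : ℝ => logNorm (F (-x)) / (x : EReal)) atTop
      = -liminf (fun x : ℝ => logNorm (F x) / (x : EReal)) atBot := by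
  rw [← EReal.limsup_neg, ← limsup_atTop_comp_neg]
  refine limsup_congr (Eventually.of_forall fun x => ?_)
  simp only [Pi.neg_apply, EReal.coe_neg, EReal.div_eq_inv_mul, EReal.inv_neg, neg_mul, neg_neg]

theorem isJostSolutionPos_reverse {A R Y : ℝ → Mat d} {M : Mat d} (hA : LocallyIntegrable A)
    (h : IsJostSolutionNeg A R M Y) :
    IsJostSolutionPos (fun x => -A (-x)) (fun x => -R (-x)) M fun x => Y (-x) := by
  obtain ⟨h1, h2, h3⟩ := h
  refine ⟨?_, ?_, by simpa using h3⟩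
  · have := h1.comp_neg
    rw [preimage_neg_Iic_zero] at this
    simpa only [neg_add] using this
  · rw [fundamentalMatrix_reverse hA, lowerBohl_reverse,
      limsup_logNorm_reverse fun x => Y x - fundamentalMatrix A x * M]
    exact EReal.neg_lt_neg_iff.mpr h2

theorem isJostSolutionNeg_reverse {A R Y : ℝ → Mat d} {M : Mat d} (hA : LocallyIntegrable A)
    (h : IsJostSolutionPos (fun x => -A (-x)) (fun x => -R (-x)) M Y) :
    IsJostSolutionNeg A R M fun x => Y (-x) := by
  obtain ⟨h1, h2, h3⟩ := h
  refine ⟨?_, ?_, by simpa using h3⟩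
  · have := h1.comp_neg
    rw [preimage_neg_Ici_zero] at this
    simpa only [neg_add, neg_neg] using this
  · rw [fundamentalMatrix_reverse hA, lowerBohl_reverse] at h2
    have := limsup_logNorm_reverse fun x => Y (-x) - fundamentalMatrix A x * M
    simp only [neg_neg] at this
    rw [this] at h2
    exact EReal.neg_lt_neg_iff.mp h2

theorem sum_Icc_reverse {M : Type*} [AddCommMonoid M] (f : ℕ → M) {d' a b : ℕ} (ha : 1 ≤ a)
    (hb : b ≤ d') :
    ∑ j ∈ Finset.Icc a b, f (d' + 1 - j) = ∑ j ∈ Finset.Icc (d' + 1 - b) (d' + 1 - a), f j := by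
  refine Finset.sum_nbij' (fun j => d' + 1 - j) (fun j => d' + 1 - j) ?_ ?_ ?_ ?_ ?_
  all_goals simp only [Finset.mem_Icc]
  · intro j hj; omega
  · intro j hj; omega
  · intro j hj; omega
  · intro j hj; omega
  · intro j hj; trivial

/-- Time reversal reverses the order of the Bohl segments, hence the numbering of the blocks, and
exchanges the dichotomy projection with its complement. -/
theorem IsOrderedSplitting.reverse {Φ : ℝ → Mat d} {k₀ d' : ℕ} {Q₀ : Mat d} {Q : ℕ → Mat d}
    (h : IsOrderedSplitting Φ k₀ d' Q₀ Q) (hk : k₀ ≤ d') :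
    IsOrderedSplitting (fun x => Φ (-x)) (d' - k₀) d' (1 - Q₀) fun j => Q (d' + 1 - j) := by
  have hm : ∀ j ∈ Finset.Icc 1 d', d' + 1 - j ∈ Finset.Icc 1 d' := fun j hj => by
    simp only [Finset.mem_Icc] at hj ⊢; omega
  have hJ : Neg.neg ⁻¹' (univ : Set ℝ) = univ := rfl
  have hu : ∀ M : Mat d, upperBohl (fun x => Φ (-x)) univ M = -lowerBohl Φ univ M := fun M => by
    rw [lowerBohl_eq_neg_reverse, neg_neg, hJ]
  have hl : ∀ M : Mat d, lowerBohl (fun x => Φ (-x)) univ M = -upperBohl Φ univ M := fun M => by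
    rw [upperBohl_eq_neg_reverse, neg_neg, hJ]
  refine ⟨?_, ?_, ?_, fun j hj => h.idem _ (hm j hj), fun i hi j hj hij => ?_, fun j hj => ?_,
    fun j hj => ?_, fun j hj1 hj2 => ?_⟩
  · have := isExpDichotomy_reverse.mp h.dichotomy
    rwa [hJ] at this
  · rw [h.sum_high, sum_Icc_reverse Q le_rfl (Nat.sub_le _ _)]
    congr 2; omega
  · rw [sub_sub_cancel, h.sum_low, sum_Icc_reverse Q (by omega) le_rfl]
    congr 2 <;> omega
  · refine h.disjoint _ (hm i hi) _ (hm j hj) ?_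
    simp only [Finset.mem_Icc] at hi hj; omega
  · obtain ⟨M, hM⟩ := h.conj _ (hm j hj)
    exact ⟨M, fun x _ => hM (-x) (mem_univ _)⟩
  · rw [hu, hl]
    exact EReal.neg_le_neg_iff.mpr (h.segment _ (hm j hj))
  · rw [hu, hl]
    have := h.ordered (d' + 1 - (j + 1)) (by omega) (by omega)
    rw [show d' + 1 - (j + 1) + 1 = d' + 1 - j by omega] at this
    exact EReal.neg_lt_neg_iff.mpr this

theorem ExponentiallyBounded.reverse {Φ : ℝ → Mat d} (h : ExponentiallyBounded Φ) :
    ExponentiallyBounded fun x => Φ (-x) := by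
  obtain ⟨C, hC⟩ := h
  refine ⟨C, fun x x' hx => hC _ _ ?_⟩
  rwa [neg_sub_neg, abs_sub_comm]

section Splitting

variable {Φ Ψ : ℝ → Mat d} {k₀ d' : ℕ} {Q P P₁ P₂ : ℕ → Mat d}

theorem IsPerturbedSplitting.pos (h : IsPerturbedSplitting Φ Ψ k₀ d' Q P) (hk : k₀ ≤ d') :
    IsHalfLineSplitting Φ Ψ k₀ Q P :=
  ⟨fun j hj => h.idem j (by simp only [Finset.mem_Icc] at hj ⊢; omega), h.disjoint_pos,
    h.dichotomy_pos, h.conj_pos, h.lower_pos, h.upper_pos⟩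

/-- The part on `(-∞, 0]` of a perturbed splitting is a half-line splitting of the reversed
equation. -/
theorem IsPerturbedSplitting.neg (h : IsPerturbedSplitting Φ Ψ k₀ d' Q P) (hk : k₀ ≤ d') :
    IsHalfLineSplitting (fun x => Φ (-x)) (fun x => Ψ (-x)) (d' - k₀)
      (fun j => Q (d' + 1 - j)) fun j => P (d' + 1 - j) := by
  have hm : ∀ j ∈ Finset.Icc 1 (d' - k₀), d' + 1 - j ∈ Finset.Icc (k₀ + 1) d' := fun j hj => by
    simp only [Finset.mem_Icc] at hj ⊢; omega
  refine ⟨fun j hj => h.idem _ ?_, fun i hi j hj hij => ?_, ?_, fun j hj => ?_, fun j hj => ?_,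
    fun j hj => ?_⟩
  · have := hm j hj
    simp only [Finset.mem_Icc] at this ⊢; omega
  · refine h.disjoint_neg _ (hm i hi) _ (hm j hj) ?_
    simp only [Finset.mem_Icc] at hi hj; omega
  · have := isExpDichotomy_reverse.mp h.dichotomy_neg
    rw [preimage_neg_Iic_zero, sub_sub_cancel] at this
    rw [sum_Icc_reverse P le_rfl (Nat.sub_le _ _)]
    convert this using 3 <;> omega
  · obtain ⟨M, hM⟩ := h.conj_neg _ (hm j hj)
    exact ⟨M, fun x hx => hM (-x) (by simpa using hx)⟩
  · rw [lowerBohl_reverse, lowerBohl_reverse, h.upper_neg _ (hm j hj)]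
  · rw [upperBohl_reverse, upperBohl_reverse, h.lower_neg _ (hm j hj)]

theorem isPerturbedSplitting_glue (hk : k₀ ≤ d') (h₁ : IsHalfLineSplitting Φ Ψ k₀ Q P₁)
    (h₂ : IsHalfLineSplitting (fun x => Φ (-x)) (fun x => Ψ (-x)) (d' - k₀)
      (fun j => Q (d' + 1 - j)) P₂) :
    IsPerturbedSplitting Φ Ψ k₀ d' Q fun j => if j ≤ k₀ then P₁ j else P₂ (d' + 1 - j) := by
  have hlow : ∀ j ∈ Finset.Icc 1 k₀, (if j ≤ k₀ then P₁ j else P₂ (d' + 1 - j)) = P₁ j :=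
    fun j hj => if_pos (Finset.mem_Icc.mp hj).2
  have hhigh : ∀ j ∈ Finset.Icc (k₀ + 1) d',
      (if j ≤ k₀ then P₁ j else P₂ (d' + 1 - j)) = P₂ (d' + 1 - j) := fun j hj =>
    if_neg (by have := (Finset.mem_Icc.mp hj).1; omega)
  have hm : ∀ j ∈ Finset.Icc (k₀ + 1) d', d' + 1 - j ∈ Finset.Icc 1 (d' - k₀) := fun j hj => by
    simp only [Finset.mem_Icc] at hj ⊢; omega
  have hrr : ∀ j ∈ Finset.Icc (k₀ + 1) d', d' + 1 - (d' + 1 - j) = j := fun j hj => by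
    simp only [Finset.mem_Icc] at hj; omega
  have hs1 := Finset.sum_congr rfl hlow
  have hs2 := Finset.sum_congr rfl hhigh
  rw [sum_Icc_reverse P₂ (by omega) le_rfl] at hs2
  refine
    { idem := fun j hj => ?_
      disjoint_pos := fun i hi j hj hij => ?_
      disjoint_neg := fun i hi j hj hij => ?_
      dichotomy_pos := ?_
      dichotomy_neg := ?_
      conj_pos := fun j hj => ?_
      conj_neg := fun j hj => ?_
      lower_pos := fun j hj => ?_
      upper_pos := fun j hj => ?_
      lower_neg := fun j hj => ?_
      upper_neg := fun j hj => ?_ }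
  · rw [Finset.mem_Icc] at hj
    by_cases hjk : j ≤ k₀
    · have : j ∈ Finset.Icc 1 k₀ := Finset.mem_Icc.mpr ⟨hj.1, hjk⟩
      rw [hlow j this]
      exact h₁.idem j this
    · have : j ∈ Finset.Icc (k₀ + 1) d' := Finset.mem_Icc.mpr ⟨by omega, hj.2⟩
      rw [hhigh j this]
      exact h₂.idem _ (hm j this)
  · rw [hlow i hi, hlow j hj]
    exact h₁.disjoint i hi j hj hij
  · rw [hhigh i hi, hhigh j hj]
    refine h₂.disjoint _ (hm i hi) _ (hm j hj) ?_
    simp only [Finset.mem_Icc] at hi hj; omega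
  · rw [hs1]
    exact h₁.dichotomy
  · rw [hs2, isExpDichotomy_reverse, preimage_neg_Iic_zero, sub_sub_cancel]
    convert h₂.dichotomy using 3 <;> omega
  · rw [hlow j hj]
    exact h₁.conj j hj
  · rw [hhigh j hj]
    obtain ⟨M, hM⟩ := h₂.conj _ (hm j hj)
    refine ⟨M, fun x hx => ?_⟩
    simpa using hM (-x) (by simpa using hx)
  · rw [hlow j hj]
    exact h₁.lower j hj
  · rw [hlow j hj]
    exact h₁.upper j hj
  · rw [hhigh j hj]
    have := h₂.upper _ (hm j hj)
    rw [upperBohl_reverse, upperBohl_reverse, hrr j hj, neg_inj] at this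
    exact this
  · rw [hhigh j hj]
    have := h₂.lower _ (hm j hj)
    rw [lowerBohl_reverse, lowerBohl_reverse, hrr j hj, neg_inj] at this
    exact this

end Splitting

end JostSplitting

open JostSplitting

theorem mainTheorem8 {d : ℕ} (hd : 2 ≤ d) (A R : ℝ → Mat d)
    (hA : LocallyIntegrable A) (hR : LocallyIntegrable R)
    (hbdd : ExponentiallyBounded (fundamentalMatrix A))
    (d' k₀ : ℕ) (hd'₂ : 2 ≤ d') (hd'd : d' ≤ d) (hk₁ : 1 ≤ k₀) (hk₂ : k₀ ≤ d' - 1)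
    (Q₀ : Mat d) (Q : ℕ → Mat d)
    (hQ : IsOrderedSplitting (fundamentalMatrix A) k₀ d' Q₀ Q)
    (β : ℝ)
    (hβpos : ∀ j ∈ Finset.Icc 1 k₀,
      upperLyapunovPos (fundamentalMatrix A) (Q j)
        - lowerBohl (fundamentalMatrix A) (Ici 0) (Q j) < (β : EReal))
    (hβneg : ∀ j ∈ Finset.Icc (k₀ + 1) d',
      upperBohl (fundamentalMatrix A) (Iic 0) (Q j)
        - lowerLyapunovNeg (fundamentalMatrix A) (Q j) < (β : EReal))
    (hRβ : Integrable (fun x : ℝ => ‖R x‖ * Real.exp (β * |x|))) :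
    -- existence of generalized Jost solutions
    (∀ j ∈ Finset.Icc 1 k₀, ∃ Y, IsJostSolutionPos A R (Q j) Y) ∧
    (∀ j ∈ Finset.Icc (k₀ + 1) d', ∃ Y, IsJostSolutionNeg A R (Q j) Y) ∧
    -- uniqueness of the extreme ones
    (∀ Y Y', IsJostSolutionPos A R (Q 1) Y → IsJostSolutionPos A R (Q 1) Y' →
      EqOn Y Y' (Ici 0)) ∧
    (∀ Y Y', IsJostSolutionNeg A R (Q d') Y → IsJostSolutionNeg A R (Q d') Y' →
      EqOn Y Y' (Iic 0)) ∧
    -- the perturbed equation has exponential splittings with the same Bohl segments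
    (∃ P, IsPerturbedSplitting (fundamentalMatrix A) (fundamentalMatrix fun x => A x + R x)
      k₀ d' Q P) ∧
    -- range properties relative to any such splitting
    ∀ P, IsPerturbedSplitting (fundamentalMatrix A) (fundamentalMatrix fun x => A x + R x)
        k₀ d' Q P →
      (∀ Y, IsJostSolutionPos A R (Q 1) Y → ran (Y 0) ≤ ran (P 1)) ∧
      (∀ Y, IsJostSolutionNeg A R (Q d') Y → ran (Y 0) ≤ ran (P d')) ∧
      (∀ j ∈ Finset.Icc 2 k₀, ∀ Y, IsJostSolutionPos A R (Q j) Y →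
        (ran (Y 0) : Set (Fin d → ℂ)) \ {0} ⊆
          (ran (∑ k ∈ Finset.Icc 1 j, P k) : Set (Fin d → ℂ)) \
            (ran (∑ k ∈ Finset.Icc 1 (j - 1), P k) : Set (Fin d → ℂ))) ∧
      (∀ j ∈ Finset.Icc (k₀ + 1) (d' - 1), ∀ Y, IsJostSolutionNeg A R (Q j) Y →
        (ran (Y 0) : Set (Fin d → ℂ)) \ {0} ⊆
          (ran (∑ k ∈ Finset.Icc j d', P k) : Set (Fin d → ℂ)) \
            (ran (∑ k ∈ Finset.Icc (j + 1) d', P k) : Set (Fin d → ℂ))) ∧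
      (∀ j ∈ Finset.Icc 2 k₀, ∀ Y Y', IsJostSolutionPos A R (Q j) Y →
        IsJostSolutionPos A R (Q j) Y' →
          ran (Y 0 - Y' 0) ≤ ran (∑ k ∈ Finset.Icc 1 (j - 1), P k)) ∧
      (∀ j ∈ Finset.Icc (k₀ + 1) (d' - 1), ∀ Y Y', IsJostSolutionNeg A R (Q j) Y →
        IsJostSolutionNeg A R (Q j) Y' →
          ran (Y 0 - Y' 0) ≤ ran (∑ k ∈ Finset.Icc (j + 1) d', P k)) := by
  have hk : k₀ ≤ d' := by omega
  have h1mem : 1 ∈ Finset.Icc 1 k₀ := Finset.mem_Icc.mpr ⟨le_rfl, hk₁⟩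
  have hβ0 : 0 ≤ β := hQ.decayRate_nonneg hA hbdd hk h1mem (hβpos 1 h1mem)
  have hRi : Integrable R := integrable_of_integrable_mul_exp hR hβ0 hRβ
  have hΦ := fundamentalMatrix_spec hA
  have hAR : LocallyIntegrable fun x => A x + R x := hA.add hR
  have hΨ := fundamentalMatrix_spec hAR
  -- the time-reversed equation satisfies the same hypotheses
  have hA' := locallyIntegrable_neg_comp_neg hA
  have hR' := locallyIntegrable_neg_comp_neg hR
  have eΦ := fundamentalMatrix_reverse hA
  have eΨ : fundamentalMatrix (fun x => -A (-x) + -R (-x))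
      = fun x => fundamentalMatrix (fun x => A x + R x) (-x) := by
    rw [← fundamentalMatrix_reverse hAR]
    simp only [neg_add]
  have hQ' := hQ.reverse hk
  have hb' := hbdd.reverse
  rw [← eΦ] at hQ' hb'
  have hk' : d' - k₀ ≤ d' := Nat.sub_le _ _
  have hRβ' : Integrable fun x : ℝ => ‖-R (-x)‖ * Real.exp (β * |x|) := by
    simpa only [norm_neg, abs_neg] using hRβ.comp_neg
  have hβ' : ∀ j ∈ Finset.Icc (k₀ + 1) d',
      upperLyapunovPos (fundamentalMatrix fun x => -A (-x)) (Q j)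
        - lowerBohl (fundamentalMatrix fun x => -A (-x)) (Ici 0) (Q j) < (β : EReal) :=
    fun j hj => by
      rw [eΦ, upperLyapunovPos_reverse, lowerBohl_reverse, sub_eq_add_neg, neg_neg, add_comm,
        ← sub_eq_add_neg]
      exact hβneg j hj
  have hm : ∀ j ∈ Finset.Icc (k₀ + 1) d', d' + 1 - j ∈ Finset.Icc 1 (d' - k₀) := fun j hj => by
    simp only [Finset.mem_Icc] at hj ⊢; omega
  have hrr : ∀ j ∈ Finset.Icc (k₀ + 1) d', d' + 1 - (d' + 1 - j) = j := fun j hj => by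
    simp only [Finset.mem_Icc] at hj; omega
  have hm₂ : ∀ j ∈ Finset.Icc (k₀ + 1) (d' - 1), j ∈ Finset.Icc (k₀ + 1) d' := fun j hj => by
    simp only [Finset.mem_Icc] at hj ⊢; omega
  obtain ⟨P₁, hP₁⟩ := hQ.exists_halfLineSplitting hk hA hΦ hRi hΨ
  have hRi' : Integrable fun x => -R (-x) := hRi.comp_neg.neg
  have hΨ' := fundamentalMatrix_spec
    (show LocallyIntegrable fun x => -A (-x) + -R (-x) from hA'.add hR')
  obtain ⟨P₂, hP₂⟩ := hQ'.exists_halfLineSplitting hk' hA' (fundamentalMatrix_spec hA') hRi' hΨ'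
  have hJ : ∀ j ∈ Finset.Icc (k₀ + 1) d', ∀ Y, IsJostSolutionNeg A R (Q j) Y →
      IsJostSolutionPos (fun x => -A (-x)) (fun x => -R (-x)) (Q (d' + 1 - (d' + 1 - j)))
        fun x => Y (-x) := fun j hj Y hY => by
    rw [hrr j hj]
    exact isJostSolutionPos_reverse hA hY
  have hd1 : d' + 1 - 1 = d' := by omega
  have hJd : ∀ Y, IsJostSolutionNeg A R (Q d') Y →
      IsJostSolutionPos (fun x => -A (-x)) (fun x => -R (-x)) (Q (d' + 1 - 1))
        fun x => Y (-x) := fun Y hY => by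
    rw [hd1]
    exact isJostSolutionPos_reverse hA hY
  refine ⟨fun j hj => ?_, fun j hj => ?_, fun Y Y' hY hY' => ?_, fun Y Y' hY hY' => ?_,
    ⟨_, isPerturbedSplitting_glue (P₂ := P₂) hk hP₁ ?_⟩, fun P hP => ?_⟩
  · exact exists_isJostSolutionPos hA hR hbdd hQ hk hP₁ hj (hβpos j hj) hRβ
  · have h := hβ' j hj
    rw [← hrr j hj] at h
    obtain ⟨Y, hY⟩ := exists_isJostSolutionPos hA' hR' hb' hQ' hk' hP₂ (hm j hj) h hRβ'
    rw [hrr j hj] at hY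
    exact ⟨_, isJostSolutionNeg_reverse hA hY⟩
  · exact hY.eqOn hA hR hQ hk₁ hk hP₁ hY'
  · intro x hx
    have := (hJd Y hY).eqOn hA' hR' hQ' (by omega) hk' hP₂ (hJd Y' hY')
      (show -x ∈ Ici (0 : ℝ) by simpa using hx)
    simpa only [neg_neg] using this
  · rwa [eΦ, eΨ] at hP₂
  have hPp := hP.pos hk
  have hPn := hP.neg hk
  rw [← eΦ, ← eΨ] at hPn
  have hlow : ∀ j ∈ Finset.Icc (k₀ + 1) d',
      ∑ k ∈ Finset.Icc 1 (d' + 1 - j), P (d' + 1 - k) = ∑ k ∈ Finset.Icc j d', P k :=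
    fun j hj => by
      have := Finset.mem_Icc.mp hj
      rw [sum_Icc_reverse P le_rfl (by omega), hrr j hj, hd1]
  have hlow' : ∀ j ∈ Finset.Icc (k₀ + 1) d',
      ∑ k ∈ Finset.Icc 1 (d' + 1 - j - 1), P (d' + 1 - k) = ∑ k ∈ Finset.Icc (j + 1) d', P k :=
    fun j hj => by
      have := Finset.mem_Icc.mp hj
      rw [sum_Icc_reverse P le_rfl (by omega), hd1,
        show d' + 1 - (d' + 1 - j - 1) = j + 1 by omega]
  refine ⟨fun Y hY => ?_, fun Y hY => ?_, fun j hj Y hY => ?_, fun j hj Y hY => ?_,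
    fun j hj Y Y' hY hY' => ?_, fun j hj Y Y' hY hY' => ?_⟩
  · have := hY.sum_mul_eq hA hR hQ hk hPp h1mem
    rw [Finset.Icc_self, Finset.sum_singleton] at this
    exact ran_le_of_mul_eq this
  · have := (hJd Y hY).sum_mul_eq hA' hR' hQ' hk' hPn (Finset.mem_Icc.mpr ⟨le_rfl, by omega⟩)
    rw [Finset.Icc_self, Finset.sum_singleton, hd1, neg_zero] at this
    exact ran_le_of_mul_eq this
  · exact hY.ran_diff_subset hA hR hQ hk hPp hj
  · have hj' : d' + 1 - j ∈ Finset.Icc 2 (d' - k₀) := by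
      simp only [Finset.mem_Icc] at hj ⊢; omega
    have := (hJ j (hm₂ j hj) Y hY).ran_diff_subset hA' hR' hQ' hk' hPn hj'
    rwa [hlow j (hm₂ j hj), hlow' j (hm₂ j hj), neg_zero] at this
  · have hj' : j ∈ Finset.Icc 1 k₀ := by simp only [Finset.mem_Icc] at hj ⊢; omega
    exact ran_le_of_mul_eq (hY.sum_mul_sub_eq hA hR hQ hk hPp hj' hY')
  · have := (hJ j (hm₂ j hj) Y hY).sum_mul_sub_eq hA' hR' hQ' hk' hPn (hm j (hm₂ j hj))
      (hJ j (hm₂ j hj) Y' hY')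
    rw [hlow' j (hm₂ j hj), neg_zero] at this
    exact ran_le_of_mul_eq this
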